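/- Let $G=(V,E)$ be a locally finite simple graph on a countable vertex set $V$, $\deg$ its vertex degree, and $q:V\to\mathbb R$ with $q_\pm=\max(\pm q,0)$. On functions put $(\Delta f+qf)(v)=\sum_{w\sim v}(f(v)-f(w))+q(v)f(v)$; let $C_c(V)$ be the finitely supported functions, and for expressions $A,B$ write $A\le B$ on $C_c(V)$ if $\langle f,Af\rangle\le\langle f,Bf\rangle$ for all $f\in C_c(V)$. Let $\alpha\in(0,1)$ and let $q\in\mathcal K_\alpha$, i.e. there is $C\ge 0$ with $q_-\le\alpha(\Delta+q_+)+C$ on $C_c(V)$. The operator $\Delta+q$ on $\ell^2(V)$ is the form sum (KLMN theorem) of $-q_-$ and of the selfadjoint operator $\Delta+q_+$ with domain $\{\varphi\in\ell^2(V):\Delta\varphi+q_+\varphi\in\ell^2(V)\}$; $\deg+q$ also denotes the maximal multiplication operator on $\ell^2(V)$. For $a,k\ge 0$, $(G,q)$ is called $(a,k)$-sparse if for every finite $W\subseteq V$ $$2|E_W|\le k|W|+a\Big(|\partial W|+\sum_{x\in W}q_+(x)\Big),$$ where $|E_W|$ is the number of edges with both ends in $W$ and $|\partial W|$ the number of edges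 between $W$ and $V\setminus W$. Put $\liminf_{|x|\to\infty}g(x)=\sup_{W\subseteq V\text{ finite}}\inf_{x\in V\setminus W}g(x)$, and let $\lambda_n(T)$, $n\ge 0$, be the eigenvalues of $T$ below its essential spectrum in increasing order, counted with multiplicity. The following are equivalent: (i) There are $a,k\ge 0$ such that $(G,q)$ is $(a,k)$-sparse. (ii) There are $\tilde a\in(0,1)$ and $\tilde k\ge 0$ such that on $C_c(V)$: $(1-\tilde a)(\deg+q)-\tilde k\le\Delta+q\le(1+\tilde a)(\deg+q)+\tilde k$. (iii) There are $\tilde a\in(0,1)$ and $\tilde k\ge 0$ such that on $C_c(V)$: $(1-\tilde a)(\deg+q)-\tilde k\le\Delta+q$. (iv) $\mathcal D(|\Delta+q|^{1/2})=\mathcal D(|\deg+q|^{1/2})$. Furthermore, if $\Delta+q$ has purely discrete spectrum, then $\liminf_{|x|\to\infty}(\deg+q)(x)=\infty$; and if the equivalent conditions (i)–(iv) hold, the converse holds too, so that $\Delta+q$ then has purely discrete spectrum if and only if $\liminf_{|x|\to\infty}(\deg+q)(x)=\infty$. If $V$ is infinite and $\liminf_{|x|\to\infty}(\deg+q)(x)=\infty$,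 then for all $\tilde a\in(0,1)$ and $\tilde k\ge 0$ for which the inequality in (iii) holds (in particular for those in (ii)), $$1-\tilde a\le\liminf_{n\to\infty}\frac{\lambda_n(\Delta+q)}{\lambda_n(\deg+q)}\le\limsup_{n\to\infty}\frac{\lambda_n(\Delta+q)}{\lambda_n(\deg+q)}\le 1+\tilde a.$$ -/

import Mathlib

open scoped ComplexConjugate Topology

noncomputable section

namespace SparseForm

/-! ### Operator theory in a complex Hilbert space -/

section OperatorTheory

variable {H : Type*} [NormedAddCommGroup H] [InnerProductSpace ℂ H] [CompleteSpace H]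

/-- The square `T²` of an unbounded operator, with its natural domain
`{φ ∈ D(T) | T φ ∈ D(T)}`. -/
def opSq (T : H →ₗ.[ℂ] H) : H →ₗ.[ℂ] H :=
  T.comp (T.domRestrict ((T.domain.comap T.toFun).map T.domain.subtype)) (by
    rintro ⟨x, hx⟩
    obtain ⟨y, hy, rfl⟩ := (Submodule.mem_inf.mp hx).1
    have e := LinearPMap.domRestrict_apply (f := T) (x := ⟨T.domain.subtype y, hx⟩) (y := y) rfl
    exact e.symm ▸ hy)

/-- `S` is a non-negative selfadjoint operator with `S² = A`. -/
def IsPosSqrt (A S : H →ₗ.[ℂ] H) : Prop :=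
  IsSelfAdjoint S ∧ (∀ φ : S.domain, 0 ≤ (inner ℂ (φ : H) (S φ)).re) ∧ opSq S = A

open Classical in
/-- The non-negative selfadjoint square root `A^{1/2}` of a non-negative selfadjoint operator `A`
(for such `A` it exists and is unique). -/
def opSqrt (A : H →ₗ.[ℂ] H) : H →ₗ.[ℂ] H :=
  if h : ∃ S, IsPosSqrt A S then h.choose else ⊥

/-- The absolute value `|T| = (T²)^{1/2}` of a selfadjoint operator `T`. -/
def opAbs (T : H →ₗ.[ℂ] H) : H →ₗ.[ℂ] H := opSqrt (opSq T)

/-- The form domain `D(|T|^{1/2})` of a selfadjoint operator `T`. -/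
def formDomain (T : H →ₗ.[ℂ] H) : Submodule ℂ H := (opSqrt (opAbs T)).domain

/-- The graph of the operator associated with the form
`Q(ψ, φ) = ⟨A^{1/2} ψ, A^{1/2} φ⟩ - ⟨B^{1/2} ψ, B^{1/2} φ⟩` on `D(A^{1/2}) ∩ D(B^{1/2})`:
the pairs `(φ, η)` with `φ ∈ D(Q)` and `Q(ψ, φ) = ⟨ψ, η⟩` for all `ψ ∈ D(Q)`. -/
def formSubGraph (A B : H →ₗ.[ℂ] H) : Submodule ℂ (H × H) where
  carrier := {p | ∃ (hA : p.1 ∈ (opSqrt A).domain) (hB : p.1 ∈ (opSqrt B).domain),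
    ∀ (ψ : H) (kA : ψ ∈ (opSqrt A).domain) (kB : ψ ∈ (opSqrt B).domain),
      inner ℂ (opSqrt A ⟨ψ, kA⟩) (opSqrt A ⟨p.1, hA⟩)
        - inner ℂ (opSqrt B ⟨ψ, kB⟩) (opSqrt B ⟨p.1, hB⟩) = inner ℂ ψ p.2}
  add_mem' := by
    rintro p r ⟨pA, pB, hp⟩ ⟨rA, rB, hr⟩
    refine ⟨add_mem pA rA, add_mem pB rB, fun ψ kA kB => ?_⟩
    have eA : opSqrt A ⟨(p + r).1, add_mem pA rA⟩
        = opSqrt A ⟨p.1, pA⟩ + opSqrt A ⟨r.1, rA⟩ := by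
      rw [← LinearPMap.map_add]; rfl
    have eB : opSqrt B ⟨(p + r).1, add_mem pB rB⟩
        = opSqrt B ⟨p.1, pB⟩ + opSqrt B ⟨r.1, rB⟩ := by
      rw [← LinearPMap.map_add]; rfl
    rw [eA, eB, Prod.snd_add, inner_add_right, inner_add_right, inner_add_right,
      ← hp ψ kA kB, ← hr ψ kA kB]
    ring
  zero_mem' := by
    refine ⟨zero_mem _, zero_mem _, fun ψ kA kB => ?_⟩
    have eA : opSqrt A ⟨(0 : H × H).1, zero_mem _⟩ = 0 := (opSqrt A).map_zero
    have eB : opSqrt B ⟨(0 : H × H).1, zero_mem _⟩ = 0 := (opSqrt B).map_zero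
    rw [eA, eB]
    simp
  smul_mem' := by
    rintro c p ⟨pA, pB, hp⟩
    refine ⟨Submodule.smul_mem _ c pA, Submodule.smul_mem _ c pB, fun ψ kA kB => ?_⟩
    have eA : opSqrt A ⟨(c • p).1, Submodule.smul_mem _ c pA⟩ = c • opSqrt A ⟨p.1, pA⟩ := by
      rw [← LinearPMap.map_smul]; rfl
    have eB : opSqrt B ⟨(c • p).1, Submodule.smul_mem _ c pB⟩ = c • opSqrt B ⟨p.1, pB⟩ := by
      rw [← LinearPMap.map_smul]; rfl
    rw [eA, eB, Prod.smul_snd, inner_smul_right, inner_smul_right, inner_smul_right,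
      ← hp ψ kA kB]
    ring

/-- The form sum of `A` and `-B`, for non-negative selfadjoint operators `A` and `B`; when
`B ≤ α A + C` in the form sense with `α < 1`, it is the selfadjoint operator given by the
KLMN theorem. -/
def formSub (A B : H →ₗ.[ℂ] H) : H →ₗ.[ℂ] H := (formSubGraph A B).toLinearPMap

/-- `z` belongs to the resolvent set of `T`: the operator `T - z : D(T) → H` has an everywhere
defined bounded inverse `R`. -/
def IsResolventPoint (T : H →ₗ.[ℂ] H) (z : ℂ) : Prop :=
  ∃ R : H →L[ℂ] H,
    (∀ η : H, ∃ h : R η ∈ T.domain, T ⟨R η, h⟩ - z • R η = η) ∧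
    ∀ φ : T.domain, R (T φ - z • (φ : H)) = φ

/-- The spectrum of an unbounded operator. -/
def opSpectrum (T : H →ₗ.[ℂ] H) : Set ℂ := {z | ¬ IsResolventPoint T z}

/-- The eigenspace `{φ ∈ D(T) | T φ = z φ}`. -/
def eigenspace (T : H →ₗ.[ℂ] H) (z : ℂ) : Submodule ℂ H :=
  (LinearMap.ker (T.toFun - z • T.domain.subtype)).map T.domain.subtype

/-- The discrete spectrum: the isolated points of the spectrum that are eigenvalues of finite
multiplicity. -/
def discreteSpectrum (T : H →ₗ.[ℂ] H) : Set ℂ :=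
  {z ∈ opSpectrum T | (∃ U ∈ 𝓝 z, U ∩ opSpectrum T = {z}) ∧
    eigenspace T z ≠ ⊥ ∧ FiniteDimensional ℂ (eigenspace T z)}

/-- The essential spectrum of a selfadjoint operator. -/
def essSpectrum (T : H →ₗ.[ℂ] H) : Set ℂ := opSpectrum T \ discreteSpectrum T

/-- The spectrum is purely discrete. -/
def HasPurelyDiscreteSpectrum (T : H →ₗ.[ℂ] H) : Prop := essSpectrum T = ∅

/-- `λ_n(T)`, `n ≥ 0`: the `n`-th eigenvalue below the essential spectrum, in increasing order
and counted with multiplicity. It is the least `t` below the essential spectrum such that there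
are at least `n + 1` linearly independent eigenvectors to eigenvalues `≤ t`. -/
def eigenvalue (T : H →ₗ.[ℂ] H) (n : ℕ) : ℝ :=
  sInf {t : ℝ | (∀ z ∈ essSpectrum T, t < z.re) ∧
    ∃ v : Fin (n + 1) → H, LinearIndependent ℂ v ∧
      ∀ i, ∃ s : ℝ, s ≤ t ∧ v i ∈ eigenspace T (s : ℂ)}

end OperatorTheory

/-! ### Graphs, Laplacians and sparseness -/

section Graphs

variable {V : Type*}

/-- The operator on `ℓ²(V)` with maximal domain `{φ ∈ ℓ²(V) | L φ ∈ ℓ²(V)}` that acts as a given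
linear map `L` on functions. -/
def maxOp (L : (V → ℂ) →ₗ[ℂ] (V → ℂ)) : lp (fun _ : V => ℂ) 2 →ₗ.[ℂ] lp (fun _ : V => ℂ) 2 where
  domain :=
    { carrier := {φ | Memℓp (L (φ : V → ℂ)) 2}
      add_mem' := by
        intro φ ψ hφ hψ
        simp only [Set.mem_ofPred_eq, lp.coeFn_add, map_add] at *
        exact hφ.add hψ
      zero_mem' := by
        simp only [Set.mem_ofPred_eq, lp.coeFn_zero, map_zero]
        exact zero_memℓp
      smul_mem' := by
        intro c φ hφ
        simp only [Set.mem_ofPred_eq, lp.coeFn_smul, map_smul] at *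
        exact hφ.const_smul c }
  toFun :=
    { toFun := fun φ => ⟨L ((φ : lp (fun _ : V => ℂ) 2) : V → ℂ), φ.2⟩
      map_add' := by
        intro φ ψ
        ext1
        exact map_add L _ _
      map_smul' := by
        intro c φ
        ext1
        exact map_smul L c _ }

/-- Multiplication of functions by a real function `g`. -/
def mulFun (g : V → ℝ) : (V → ℂ) →ₗ[ℂ] (V → ℂ) where
  toFun f := fun x => (g x : ℂ) * f x
  map_add' f h := by ext x; simp [mul_add]
  map_smul' c f := by ext x; simp [mul_left_comm]

/-- The selfadjoint operator of multiplication by a real function on `ℓ²(V)`. -/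
def mulOp (g : V → ℝ) : lp (fun _ : V => ℂ) 2 →ₗ.[ℂ] lp (fun _ : V => ℂ) 2 := maxOp (mulFun g)

/-- `⟨f, L f⟩` for a finitely supported function `f` (its real part; it is real for the symmetric
expressions below). -/
def quadForm (L : (V → ℂ) →ₗ[ℂ] (V → ℂ)) (f : V →₀ ℂ) : ℝ :=
  ∑ x ∈ f.support, (conj (f x) * L f x).re

/-- The squared `ℓ²`-norm of a finitely supported function. -/
def normSq (f : V →₀ ℂ) : ℝ := ∑ x ∈ f.support, ‖f x‖ ^ 2

/-- `liminf_{|x| → ∞} g(x)`, the supremum over the finite sets `W` of `inf_{x ∉ W} g(x)`. -/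
def liminfAtInfinity (g : V → ℝ) : EReal :=
  ⨆ W : Finset V, ⨅ x : {x : V // x ∉ W}, ((g x : ℝ) : EReal)

/-- The positive part of `q`. -/
def qPos (q : V → ℝ) : V → ℝ := fun x => max (q x) 0

/-- The negative part of `q`. -/
def qNeg (q : V → ℝ) : V → ℝ := fun x => max (-q x) 0

variable (G : SimpleGraph V) [G.LocallyFinite]

/-- The formal Schrödinger expression
`(Δ + q) f (v) = ∑_{w ∼ v} (f(v) - f(w)) + q(v) f(v)`. -/
def schrodingerFun (q : V → ℝ) : (V → ℂ) →ₗ[ℂ] (V → ℂ) where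
  toFun f := fun v => ∑ w ∈ G.neighborFinset v, (f v - f w) + (q v : ℂ) * f v
  map_add' f h := by
    ext v
    simp only [Pi.add_apply, mul_add, add_sub_add_comm, Finset.sum_add_distrib]
    ring
  map_smul' c f := by
    ext v
    simp only [Pi.smul_apply, smul_eq_mul, RingHom.id_apply, mul_add, Finset.mul_sum, mul_sub]
    ring

/-- The function `deg + q`. -/
def degAdd (q : V → ℝ) : V → ℝ := fun x => (G.degree x : ℝ) + q x

/-- The class `K_α`: there is `C ≥ 0` with `q₋ ≤ α (Δ + q₊) + C` in the form sense on the finitely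
supported functions. -/
def MemK (α : ℝ) (q : V → ℝ) : Prop :=
  ∃ C : ℝ, 0 ≤ C ∧ ∀ f : V →₀ ℂ,
    quadForm (mulFun (qNeg q)) f ≤ α * quadForm (schrodingerFun G (qPos q)) f + C * normSq f

/-- The Schrödinger operator `Δ + q`: the form sum of the operator `Δ + q₊` with maximal domain
and of `-q₋`. -/
def schrodingerOp (q : V → ℝ) : lp (fun _ : V => ℂ) 2 →ₗ.[ℂ] lp (fun _ : V => ℂ) 2 :=
  formSub (maxOp (schrodingerFun G (qPos q))) (mulOp (qNeg q))

open Classical in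
/-- The number `|E_W|` of (undirected) edges of the subgraph induced on `W`. -/
def edgeCount (W : Finset V) : ℝ :=
  (((W ×ˢ W).filter fun p => G.Adj p.1 p.2).card : ℝ) / 2

open Classical in
/-- The number `|∂W|` of edges from `W` to its complement. -/
def boundaryCount (W : Finset V) : ℝ :=
  ∑ x ∈ W, (((G.neighborFinset x).filter fun y => y ∉ W).card : ℝ)

/-- `(G, q)` is `(a, k)`-sparse. -/
def IsSparse (q : V → ℝ) (a k : ℝ) : Prop :=
  ∀ W : Finset V,
    2 * edgeCount G W ≤ k * (W.card : ℝ) + a * (boundaryCount G W + ∑ x ∈ W, qPos q x)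

/-- `(1 - a) (deg + q) - k ≤ Δ + q` on the finitely supported functions. -/
def LowerBound (q : V → ℝ) (a k : ℝ) : Prop :=
  ∀ f : V →₀ ℂ, (1 - a) * quadForm (mulFun (degAdd G q)) f - k * normSq f
    ≤ quadForm (schrodingerFun G q) f

/-- `Δ + q ≤ (1 + a) (deg + q) + k` on the finitely supported functions. -/
def UpperBound (q : V → ℝ) (a k : ℝ) : Prop :=
  ∀ f : V →₀ ℂ, quadForm (schrodingerFun G q) f
    ≤ (1 + a) * quadForm (mulFun (degAdd G q)) f + k * normSq f

end Graphs

end SparseForm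

end

/-!
# Sparse graphs and the form domain of `Δ + q`

**Forms instead of operators.** A semibounded operator `T` enters through a bounded non-negative
operator `R = (T + c)⁻¹` (`IsResolventAt`), and `R` is factorized through a Hilbert space `K` with an
injective bounded map `J : K → ℓ²(V)` whose range is the form domain. For `Δ + q₊` the space `K` is
the graph of the gradient `f ↦ (√q₊ f, (f(x) - f(y)) / √2)` with maximal domain, and `R = J J†`
(`isResolventAt_maxOp`); that the maximal operator is selfadjoint and that the finitely supported
functions are dense in `K` both come from the maximum principle for `(Δ + q₊ + 1) φ = 0`. The form
bound on `q₋` makes `W = 1 + C J† J - β† β`, with `β = √q₋ J`, invertible on `K`, and `R = J W⁻¹ J†`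
is the resolvent of `Δ + q` (`isResolventAt_formSub`). The inequalities on finitely supported functions
extend to `K` by density. By the inequality of Heinz and the range lemma of Douglas
(`mem_formDomain_iff`), the form domain of `Δ + q` is the range of `J`, and that of `deg + q` is the
domain of multiplication by `√(deg + q + c)`.

**The equivalences.** Sparseness is the inequality `2 ∑ min(h(x), h(y)) ≤ k ∑ h + a (…)`, summed over
edges, for indicator functions `h`. It is additive over the layers of `h` and thus holds for all
`h ≥ 0` (`IsSparse.sum_min_le`); for `h = |f|²` it bounds the form of `deg + q₊` by that of `Δ + q₊`,
hence gives the lower bound for `Δ + q`. Conversely the lower bound for indicator functions is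
sparseness. The lower bound for `|f|` is the upper bound for `f`, since the form of `Δ + q` differs from
that of `deg + q` by the adjacency form (`LowerBound.upperBound`). The two bounds give equality of the
form domains, and equality of the form domains gives the lower bound by the closed graph theorem.

**The spectrum.** The spectrum of `T` is purely discrete iff `R` is compact
(`hasPurelyDiscreteSpectrum_of_isCompactOperator`, `isCompactOperator_of_hasPurelyDiscreteSpectrum`).
The diagonal entries of the resolvent of `Δ + q` are at least `1 / (deg(x) + q(x) + c)`, so compactness
forces `deg + q → ∞`; given the lower bound, `deg + q → ∞` makes `J` compact. The eigenvalues are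
compared as in the min-max principle, with the unit vectors as eigenvectors of `deg + q`:
`(1 - a) λₙ(deg + q) - k ≤ λₙ(Δ + q) ≤ (1 + a) λₙ(deg + q) + k` (`NegPart.le_eigenvalue`,
`NegPart.eigenvalue_le`), and `λₙ(deg + q) → ∞`.
-/

open scoped ComplexConjugate Topology

noncomputable section

set_option linter.unusedSectionVars false

namespace SparseForm

/-! ### Unbounded operators through their graphs and resolvents -/

section AbstractOperators

variable {H : Type*} [NormedAddCommGroup H] [InnerProductSpace ℂ H] [CompleteSpace H]
variable {H' : Type*} [NormedAddCommGroup H'] [InnerProductSpace ℂ H'] [CompleteSpace H']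
variable {K : Type*} [NormedAddCommGroup K] [InnerProductSpace ℂ K] [CompleteSpace K]
variable {K' : Type*} [NormedAddCommGroup K'] [InnerProductSpace ℂ K'] [CompleteSpace K']

open ContinuousLinearMap in
/-- Douglas' range lemma: `J J† ≤ C² J' J'†` puts the range of `J` into that of `J'`, with control
of the preimages. The functional `J'† η ↦ ⟨u, J† η⟩` is bounded by `C ‖u‖`, and a vector representing
its Hahn-Banach extension is the preimage sought. -/
theorem exists_eq_of_norm_adjoint_le {J : K →L[ℂ] H} {J' : K' →L[ℂ] H} {C : ℝ} (hC : 0 ≤ C)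
    (h : ∀ η, ‖adjoint J η‖ ≤ C * ‖adjoint J' η‖) (u : K) :
    ∃ u' : K', J' u' = J u ∧ ‖u'‖ ≤ C * ‖u‖ := by
  set A : H →ₗ[ℂ] K' := (adjoint J').toLinearMap with hA
  set ℓ : H →ₗ[ℂ] ℂ := (innerSL ℂ u ∘L adjoint J).toLinearMap with hℓ
  have hbound : ∀ η, ‖ℓ η‖ ≤ C * ‖u‖ * ‖A η‖ := fun η => by
    calc ‖ℓ η‖ ≤ ‖u‖ * ‖adjoint J η‖ := norm_inner_le_norm _ _
      _ ≤ ‖u‖ * (C * ‖adjoint J' η‖) := by gcongr; exact h η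
      _ = _ := by simp [hA]; ring
  have hker : LinearMap.ker A ≤ LinearMap.ker ℓ := fun η hη => by
    rw [LinearMap.mem_ker] at hη ⊢
    have := hbound η
    rw [hη, norm_zero, mul_zero] at this
    exact norm_le_zero_iff.mp this
  set g : LinearMap.range A →ₗ[ℂ] ℂ :=
    ((LinearMap.ker A).liftQ ℓ hker) ∘ₗ A.quotKerEquivRange.symm.toLinearMap with hg
  have hgA : ∀ η, g ⟨A η, LinearMap.mem_range_self A η⟩ = ℓ η := fun η => by
    have : A.quotKerEquivRange.symm ⟨A η, LinearMap.mem_range_self A η⟩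
        = (LinearMap.ker A).mkQ η := by
      rw [LinearEquiv.symm_apply_eq]; rfl
    simp [hg, this]
  have hgb : ∀ x, ‖g x‖ ≤ C * ‖u‖ * ‖x‖ := by
    rintro ⟨_, η, rfl⟩
    rw [hgA]
    exact hbound η
  obtain ⟨G, hG, hGn⟩ := exists_extension_norm_eq (𝕜 := ℂ) (LinearMap.range A)
    (g.mkContinuous (C * ‖u‖) hgb)
  refine ⟨(InnerProductSpace.toDual ℂ K').symm G, ?_, ?_⟩
  · refine ext_inner_right ℂ fun η => ?_
    rw [← adjoint_inner_right, InnerProductSpace.toDual_symm_apply, ← adjoint_inner_right]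
    exact (hG ⟨A η, LinearMap.mem_range_self A η⟩).trans (hgA η)
  · rw [LinearIsometryEquiv.norm_map, hGn]
    exact LinearMap.mkContinuous_norm_le _ (by positivity) _

/-- `T + c` is the inverse of the non-negative bounded operator `R`. The second field says this about
the graph of `T`, so that neither domains nor the values of `T` on them have to be mentioned. -/
structure IsResolventAt (T : H →ₗ.[ℂ] H) (c : ℝ) (R : H →L[ℂ] H) : Prop where
  isPositive : R.IsPositive
  mem_graph_iff : ∀ φ η, (φ, η) ∈ T.graph ↔ R (η + (c : ℂ) • φ) = φ

namespace IsResolventAt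

variable {T : H →ₗ.[ℂ] H} {c : ℝ} {R R' : H →L[ℂ] H}

theorem injective (h : IsResolventAt T c R) : Function.Injective R := by
  rw [injective_iff_map_eq_zero]
  intro η hη
  exact T.graph_fst_eq_zero_snd ((h.mem_graph_iff 0 η).mpr (by simpa using hη)) rfl

theorem graph_apply (h : IsResolventAt T c R) (η : H) : (R η, η - (c : ℂ) • R η) ∈ T.graph :=
  (h.mem_graph_iff _ _).mpr (by simp)

theorem mem_domain_iff (h : IsResolventAt T c R) {φ : H} : φ ∈ T.domain ↔ ∃ η, R η = φ := by
  rw [LinearPMap.mem_domain_iff]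
  constructor
  · rintro ⟨η, hη⟩
    exact ⟨_, (h.mem_graph_iff _ _).mp hη⟩
  · rintro ⟨η, rfl⟩
    exact ⟨_, h.graph_apply η⟩

theorem unique (h : IsResolventAt T c R) (h' : IsResolventAt T c R') : R = R' := by
  ext η
  have := (h'.mem_graph_iff _ _).mp (h.graph_apply η)
  rwa [sub_add_cancel, eq_comm] at this

theorem inner_apply_comm (h : IsResolventAt T c R) (φ ψ : H) :
    inner ℂ (R φ) ψ = inner ℂ φ (R ψ) := h.isPositive.inner_left_eq_inner_right φ ψ

end IsResolventAt

theorem dense_range_of_isPositive {R : H →L[ℂ] H} (hR : R.IsPositive)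
    (hinj : Function.Injective R) : Dense (Set.range R) := by
  have : (LinearMap.range R.toLinearMap).topologicalClosure = ⊤ := by
    rw [Submodule.topologicalClosure_eq_top_iff, Submodule.eq_bot_iff]
    intro x hx
    apply hinj
    rw [map_zero, ← inner_self_eq_zero (𝕜 := ℂ), ← hR.inner_left_eq_inner_right]
    exact (Submodule.mem_orthogonal _ x).mp hx (R (R x)) ⟨R x, rfl⟩
  exact Submodule.dense_iff_topologicalClosure_eq_top.mpr this

/-- A densely defined operator is selfadjoint iff its graph is its own annihilator under the
symplectic form `⟨b, φ⟩ - ⟨a, η⟩`. -/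
theorem isSelfAdjoint_iff_graph {T : H →ₗ.[ℂ] H} :
    IsSelfAdjoint T ↔ Dense (T.domain : Set H) ∧
      ∀ φ η, (φ, η) ∈ T.graph ↔ ∀ a b, (a, b) ∈ T.graph → inner ℂ b φ = inner ℂ a η := by
  constructor
  · intro h
    refine ⟨h.dense_domain, fun φ η => ?_⟩
    have := LinearPMap.adjoint_graph_eq_graph_adjoint h.dense_domain
    rw [LinearPMap.isSelfAdjoint_def.mp h] at this
    conv_lhs => rw [this]
    simp [sub_eq_zero]
  · rintro ⟨hd, h⟩
    rw [LinearPMap.isSelfAdjoint_def]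
    refine LinearPMap.eq_of_eq_graph ?_
    rw [LinearPMap.adjoint_graph_eq_graph_adjoint hd]
    ext ⟨φ, η⟩
    rw [h]
    simp [sub_eq_zero]

theorem IsResolventAt.isSelfAdjoint {T : H →ₗ.[ℂ] H} {c : ℝ} {R : H →L[ℂ] H}
    (h : IsResolventAt T c R) : IsSelfAdjoint T := by
  rw [isSelfAdjoint_iff_graph]
  constructor
  · have : (T.domain : Set H) = Set.range R := by
      ext φ; exact h.mem_domain_iff
    rw [this]
    exact dense_range_of_isPositive h.isPositive h.injective
  · intro φ η
    constructor
    · intro hφ a b hab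
      rw [h.mem_graph_iff] at hφ hab
      have := h.inner_apply_comm (b + (c : ℂ) • a) (η + (c : ℂ) • φ)
      rw [hφ, hab, inner_add_left, inner_add_right, inner_smul_left, inner_smul_right] at this
      simpa using this.symm
    · intro H
      rw [h.mem_graph_iff]
      refine ext_inner_left ℂ fun ξ => ?_
      have := H _ _ (h.graph_apply ξ)
      rw [inner_sub_left, inner_smul_left] at this
      rw [← h.inner_apply_comm, inner_add_right, inner_smul_right, ← this]
      simp

theorem mem_graph_opSq {T : H →ₗ.[ℂ] H} {φ η : H} :
    (φ, η) ∈ (opSq T).graph ↔ ∃ ξ, (φ, ξ) ∈ T.graph ∧ (ξ, η) ∈ T.graph := by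
  have key : ∀ x : (opSq T).domain, ∃ (hx : (x : H) ∈ T.domain) (hy : T ⟨x, hx⟩ ∈ T.domain),
      opSq T x = T ⟨T ⟨x, hx⟩, hy⟩ := by
    rintro ⟨x, hx⟩
    obtain ⟨y, hy, hyx⟩ := (Submodule.mem_inf.mp hx).1
    simp only [Submodule.subtype_apply] at hyx
    subst hyx
    exact ⟨y.2, hy, rfl⟩
  constructor
  · intro h
    rw [LinearPMap.mem_graph_iff] at h
    obtain ⟨x, hx, hη⟩ := h
    obtain ⟨h1, h2, h3⟩ := key x
    simp only at hx hη
    subst hx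
    exact ⟨_, T.mem_graph ⟨x, h1⟩, by rw [← hη, h3]; exact T.mem_graph ⟨_, h2⟩⟩
  · rintro ⟨ξ, h1, h2⟩
    rw [LinearPMap.mem_graph_iff] at h1 h2
    obtain ⟨x, rfl, rfl⟩ := h1
    obtain ⟨y, hy, rfl⟩ := h2
    simp only at hy
    have hx : (x : H) ∈ (opSq T).domain :=
      ⟨⟨x, by change T x ∈ T.domain; rw [← hy]; exact y.2, rfl⟩, x.2⟩
    obtain ⟨h1, h2, h3⟩ := key ⟨x, hx⟩
    have := (opSq T).mem_graph ⟨x, hx⟩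
    rw [h3] at this
    have e : y = ⟨T ⟨x, h1⟩, h2⟩ := Subtype.ext hy
    rw [e]
    exact this

/-- The graph of `N`, as a subspace of the Hilbert sum of the two spaces: the domain of `N` with
the inner product `⟨φ, ψ⟩ + ⟨N φ, N ψ⟩`. -/
def graphSpace (N : H →ₗ.[ℂ] H') : Submodule ℂ (WithLp 2 (H × H')) :=
  N.graph.comap (WithLp.linearEquiv 2 ℂ (H × H')).toLinearMap

/-- The embedding `(φ, N φ) ↦ φ` of the graph into the Hilbert space. -/
def graphFst (N : H →ₗ.[ℂ] H') : graphSpace N →L[ℂ] H :=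
  WithLp.fstL 2 ℂ H H' ∘L (graphSpace N).subtypeL

/-- The map `(φ, N φ) ↦ N φ` on the graph. -/
def graphSnd (N : H →ₗ.[ℂ] H') : graphSpace N →L[ℂ] H' :=
  WithLp.sndL 2 ℂ H H' ∘L (graphSpace N).subtypeL

/-- The point `(φ, η)` of the graph. -/
def graphMk {N : H →ₗ.[ℂ] H'} {φ : H} {η : H'} (h : (φ, η) ∈ N.graph) : graphSpace N :=
  ⟨WithLp.toLp 2 (φ, η), h⟩

section graph

variable {N : H →ₗ.[ℂ] H'}

@[simp] theorem graphFst_mk {φ : H} {η : H'} (h : (φ, η) ∈ N.graph) :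
    graphFst N (graphMk h) = φ := rfl

@[simp] theorem graphSnd_mk {φ : H} {η : H'} (h : (φ, η) ∈ N.graph) :
    graphSnd N (graphMk h) = η := rfl

theorem graph_fst_snd (u : graphSpace N) : (graphFst N u, graphSnd N u) ∈ N.graph := u.2

theorem inner_graphSpace (u v : graphSpace N) :
    inner ℂ u v = inner ℂ (graphFst N u) (graphFst N v)
      + inner ℂ (graphSnd N u) (graphSnd N v) := rfl

theorem norm_sq_graphSpace (u : graphSpace N) :
    ‖u‖ ^ 2 = ‖graphFst N u‖ ^ 2 + ‖graphSnd N u‖ ^ 2 := by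
  rw [norm_sq_eq_re_inner (𝕜 := ℂ) u, inner_graphSpace, map_add, inner_self_eq_norm_sq,
    inner_self_eq_norm_sq]

theorem graphFst_injective (N : H →ₗ.[ℂ] H') : Function.Injective (graphFst N) := by
  rw [injective_iff_map_eq_zero]
  intro u hu
  have h2 : graphSnd N u = 0 := N.graph_fst_eq_zero_snd (graph_fst_snd u) hu
  have := norm_sq_graphSpace u
  rw [hu, h2] at this
  simpa using this

theorem mem_range_graphFst {φ : H} : φ ∈ Set.range (graphFst N) ↔ φ ∈ N.domain := by
  rw [LinearPMap.mem_domain_iff]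
  constructor
  · rintro ⟨u, rfl⟩
    exact ⟨_, graph_fst_snd u⟩
  · rintro ⟨η, h⟩
    exact ⟨graphMk h, rfl⟩

theorem completeSpace_graphSpace (h : N.IsClosed) : CompleteSpace (graphSpace N) := by
  have : IsClosed (graphSpace N : Set (WithLp 2 (H × H'))) :=
    IsClosed.preimage (WithLp.prod_continuous_ofLp 2 H H') h
  exact this.completeSpace_coe

end graph

open ContinuousLinearMap in
/-- Von Neumann's theorem: `T² + 1` is invertible for selfadjoint `T`. The inverse maps `η` to the
first component of the orthogonal projection of `(η, 0)` to the graph of `T`. -/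
theorem isResolventAt_opSq {T : H →ₗ.[ℂ] H} (hT : IsSelfAdjoint T)
    [CompleteSpace (graphSpace T)] :
    IsResolventAt (opSq T) 1 (graphFst T ∘L adjoint (graphFst T)) where
  isPositive := isPositive_self_comp_adjoint _
  mem_graph_iff φ η := by
    have hg := (isSelfAdjoint_iff_graph.mp hT).2
    rw [mem_graph_opSq, comp_apply, Complex.ofReal_one, one_smul]
    constructor
    · rintro ⟨ξ, h1, h2⟩
      have : adjoint (graphFst T) (η + φ) = graphMk h1 := by
        refine ext_inner_left ℂ fun v => ?_
        rw [adjoint_inner_right, inner_graphSpace, graphFst_mk, graphSnd_mk, inner_add_right,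
          (hg ξ η).mp h2 _ _ (graph_fst_snd v), add_comm]
      rw [this, graphFst_mk]
    · intro h
      set u := adjoint (graphFst T) (η + φ) with hu
      refine ⟨graphSnd T u, h ▸ graph_fst_snd u, (hg _ _).mpr fun a b hab => ?_⟩
      have := adjoint_inner_right (graphFst T) (graphMk hab) (η + φ)
      rw [← hu, inner_graphSpace, graphFst_mk, graphSnd_mk, h, inner_add_right, add_comm] at this
      exact add_right_cancel this

open ContinuousLinearMap in
theorem comp_adjoint_le_one {J : K →L[ℂ] H} (hJ : ‖J‖ ≤ 1) : J ∘L adjoint J ≤ 1 := by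
  have hle : ∀ η, ‖adjoint J η‖ ≤ ‖η‖ := fun η => by
    simpa using (adjoint J).le_of_opNorm_le ((LinearIsometryEquiv.norm_map _ J).trans_le hJ) η
  rw [ContinuousLinearMap.le_def, isPositive_def']
  refine ⟨?_, fun η => ?_⟩
  · exact (IsSelfAdjoint.one _).sub (isPositive_self_comp_adjoint _).isSelfAdjoint
  · rw [reApplyInnerSelf_apply, sub_apply, comp_apply, inner_sub_left, map_sub, one_apply_eq_self,
      ← adjoint_inner_right, inner_self_eq_norm_sq, inner_self_eq_norm_sq, sub_nonneg]
    have := hle η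
    gcongr

open ContinuousLinearMap in
theorem graphFst_comp_adjoint_le_one (N : H →ₗ.[ℂ] H') [CompleteSpace (graphSpace N)] :
    graphFst N ∘L adjoint (graphFst N) ≤ 1 := by
  refine comp_adjoint_le_one (opNorm_le_bound _ zero_le_one fun u => ?_)
  rw [one_mul]
  refine le_of_sq_le_sq ?_ (norm_nonneg _)
  rw [norm_sq_graphSpace u]
  exact le_add_of_nonneg_right (sq_nonneg _)

end AbstractOperators

/-! ### Square roots, form domains and form sums -/

section AbstractForms

variable {H : Type*} [NormedAddCommGroup H] [InnerProductSpace ℂ H] [CompleteSpace H]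
variable {H' : Type*} [NormedAddCommGroup H'] [InnerProductSpace ℂ H'] [CompleteSpace H']
variable {K : Type*} [NormedAddCommGroup K] [InnerProductSpace ℂ K] [CompleteSpace K]

open ContinuousLinearMap

/-- If `(A + 1)⁻¹ = R ≤ 1` and `P = √R`, `Q = √(1 - R)`, then `Q P⁻¹` is the square root of
`A = R⁻¹ - 1`; its graph is the range of `η ↦ (P η, Q η)`. -/
theorem exists_isPosSqrt {A : H →ₗ.[ℂ] H} {R : H →L[ℂ] H} (h : IsResolventAt A 1 R)
    (h1 : R ≤ 1) : ∃ S, IsPosSqrt A S := by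
  have hR0 : 0 ≤ R := (nonneg_iff_isPositive R).mpr h.isPositive
  have hR1 : 0 ≤ 1 - R := sub_nonneg.mpr h1
  set P := CFC.sqrt R with hP
  set Q := CFC.sqrt (1 - R) with hQ
  have hP0 : 0 ≤ P := CFC.sqrt_nonneg _
  have hQ0 : 0 ≤ Q := CFC.sqrt_nonneg _
  have hPP : ∀ x, P (P x) = R x := fun x => congrArg (· x) (CFC.sqrt_mul_sqrt_self R)
  have hQQ : ∀ x, Q (Q x) = x - R x := fun x => congrArg (· x) (CFC.sqrt_mul_sqrt_self (1 - R))
  have hcomm : Commute P Q := by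
    have c1 : Commute P (1 - R) :=
      ((Commute.refl R).cfcₙ_nnreal _ : Commute P R) |>.symm |> fun c =>
        ((Commute.one_left P).sub_left c).symm
    exact (c1.symm.cfcₙ_nnreal _ : Commute Q P).symm
  have hPQ : ∀ x, P (Q x) = Q (P x) := fun x => congrArg (· x) hcomm.eq
  have hPs := ((nonneg_iff_isPositive P).mp hP0)
  have hQs := ((nonneg_iff_isPositive Q).mp hQ0)
  have hPi : Function.Injective P := fun x y hxy => h.injective (by rw [← hPP, ← hPP, hxy])
  set g : Submodule ℂ (H × H) := LinearMap.range (P.prod Q).toLinearMap with hg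
  have hmem : ∀ φ ψ, (φ, ψ) ∈ g ↔ ∃ η, P η = φ ∧ Q η = ψ := fun φ ψ => by
    simp [hg, LinearMap.mem_range, Prod.ext_iff]
  set S := g.toLinearPMap with hS
  have hSg : S.graph = g := by
    refine Submodule.toLinearPMap_graph_eq g ?_
    rintro ⟨φ, ψ⟩ hx h0
    obtain ⟨η, h2, h3⟩ := (hmem φ ψ).mp hx
    simp only at h0 ⊢
    have : η = 0 := hPi (by rw [h2, h0, map_zero])
    rw [← h3, this, map_zero]
  refine ⟨S, ?_, ?_, ?_⟩
  · rw [isSelfAdjoint_iff_graph]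
    constructor
    · have : (S.domain : Set H) = Set.range P := by
        ext φ
        rw [SetLike.mem_coe, LinearPMap.mem_domain_iff, hSg]
        simp only [hmem, Set.mem_range]
        exact ⟨fun ⟨_, η, e, _⟩ => ⟨η, e⟩, fun ⟨η, e⟩ => ⟨_, η, e, rfl⟩⟩
      rw [this]
      exact dense_range_of_isPositive hPs hPi
    · intro φ ψ
      simp only [hSg, hmem]
      constructor
      · rintro ⟨η, rfl, rfl⟩ _ _ ⟨ζ, rfl, rfl⟩
        rw [hQs.inner_left_eq_inner_right, hPs.inner_left_eq_inner_right, hPQ]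
      · intro hφ
        have e : Q φ = P ψ := by
          refine ext_inner_left ℂ fun ζ => ?_
          rw [← hQs.inner_left_eq_inner_right, ← hPs.inner_left_eq_inner_right]
          exact hφ _ _ ⟨ζ, rfl, rfl⟩
        refine ⟨P φ + Q ψ, ?_, ?_⟩
        · rw [map_add, hPP, hPQ, ← e, hQQ]; abel
        · rw [map_add, hQQ, ← hPQ, e, hPP]; abel
  · intro φ
    obtain ⟨η, h2, h3⟩ := (hmem _ _).mp (hSg ▸ S.mem_graph φ)
    rw [← h3, ← h2, hPs.inner_left_eq_inner_right]
    have : 0 ≤ P * Q := hcomm.mul_nonneg hP0 hQ0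
    exact ((nonneg_iff_isPositive _).mp this).re_inner_nonneg_right η
  · refine LinearPMap.eq_of_eq_graph ?_
    ext ⟨φ, ψ⟩
    rw [mem_graph_opSq, h.mem_graph_iff]
    simp only [hSg, hmem, Complex.ofReal_one, one_smul]
    constructor
    · rintro ⟨ξ, ⟨η, rfl, rfl⟩, ζ, h2, rfl⟩
      have : P (Q ζ) = η - R η := by rw [hPQ, h2, hQQ]
      rw [← hPP, map_add, this, hPP]
      abel_nf
    · intro e
      refine ⟨Q (P (ψ + φ)), ⟨P (ψ + φ), by rw [hPP, e], rfl⟩, Q (ψ + φ), hPQ _, ?_⟩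
      rw [hQQ, e]
      abel

theorem isPosSqrt_opSqrt {A : H →ₗ.[ℂ] H} {R : H →L[ℂ] H} (h : IsResolventAt A 1 R)
    (h1 : R ≤ 1) : IsPosSqrt A (opSqrt A) := by
  have := exists_isPosSqrt h h1
  rw [opSqrt, dif_pos this]
  exact this.choose_spec

/-- For a non-negative selfadjoint `X` the operator `X + 1` is bijective: its range is dense and it is
bounded below with respect to the graph norm. -/
theorem exists_isResolventAt_one {X : H →ₗ.[ℂ] H} (hX : IsSelfAdjoint X)
    (h0 : ∀ φ : X.domain, 0 ≤ (inner ℂ (φ : H) (X φ)).re) :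
    ∃ R, IsResolventAt X 1 R ∧ R ≤ 1 := by
  have := completeSpace_graphSpace hX.isClosed
  have hg := (isSelfAdjoint_iff_graph.mp hX).2
  have hpos : ∀ φ η, (φ, η) ∈ X.graph → 0 ≤ (inner ℂ φ η).re := by
    intro φ η h
    rw [LinearPMap.mem_graph_iff] at h
    obtain ⟨x, rfl, rfl⟩ := h
    exact h0 x
  have hpos' : ∀ u : graphSpace X, 0 ≤ (inner ℂ (graphFst X u) (graphSnd X u)).re :=
    fun u => hpos _ _ (graph_fst_snd u)
  have hsymm : ∀ u v : graphSpace X,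
      inner ℂ (graphSnd X u) (graphFst X v) = inner ℂ (graphFst X u) (graphSnd X v) :=
    fun u v => (hg _ _).mp (graph_fst_snd v) _ _ (graph_fst_snd u)
  set L : graphSpace X →L[ℂ] H := graphFst X + graphSnd X with hL
  have hLb : Function.Bijective L := by
    rw [bijective_iff_dense_range_and_antilipschitz]
    constructor
    · rw [Submodule.topologicalClosure_eq_top_iff, Submodule.eq_bot_iff]
      intro y hy
      have hy' : ∀ u, inner ℂ (L u) y = 0 := fun u => (Submodule.mem_orthogonal _ y).mp hy _ ⟨u, rfl⟩
      have hmem : (y, -y) ∈ X.graph := by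
        rw [hg]
        intro a b hab
        have := hy' (graphMk hab)
        rw [hL, add_apply, graphFst_mk, graphSnd_mk, inner_add_left] at this
        rw [inner_neg_right]
        linear_combination this
      have := hpos _ _ hmem
      rw [inner_neg_right, Complex.neg_re, ← RCLike.re_eq_complex_re, inner_self_eq_norm_sq] at this
      have h2 : ‖y‖ ^ 2 ≤ 0 := by linarith
      simpa using le_antisymm h2 (sq_nonneg _)
    · refine ⟨1, L.antilipschitz_of_bound fun u => ?_⟩
      rw [NNReal.coe_one, one_mul]
      refine le_of_sq_le_sq ?_ (norm_nonneg _)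
      rw [hL, add_apply, norm_add_sq (𝕜 := ℂ), norm_sq_graphSpace]
      have := hpos' u
      rw [RCLike.re_eq_complex_re]
      linarith
  set e := ContinuousLinearEquiv.ofBijective L (LinearMap.ker_eq_bot.mpr hLb.1)
    (LinearMap.range_eq_top.mpr hLb.2) with he
  have heL : ∀ u, e.symm (L u) = u := fun u => e.symm_apply_apply u
  set R : H →L[ℂ] H := graphFst X ∘L e.symm.toContinuousLinearMap with hR
  have hRL : ∀ u, R (L u) = graphFst X u := fun u => by simp [hR, heL]
  refine ⟨R, ⟨?_, ?_⟩, ?_⟩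
  · rw [isPositive_def]
    refine ⟨fun x y => ?_, fun x => ?_⟩
    · obtain ⟨u, rfl⟩ := hLb.2 x
      obtain ⟨v, rfl⟩ := hLb.2 y
      rw [coe_coe, hRL, hRL, hL, add_apply, add_apply, inner_add_right, inner_add_left, hsymm]
    · obtain ⟨u, rfl⟩ := hLb.2 x
      rw [reApplyInnerSelf_apply, hRL, hL, add_apply, inner_add_right, map_add,
        inner_self_eq_norm_sq]
      exact add_nonneg (sq_nonneg _) (hpos' u)
  · intro φ η
    rw [Complex.ofReal_one, one_smul]
    constructor
    · intro h
      have := hRL (graphMk h)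
      rwa [hL, add_apply, graphFst_mk, graphSnd_mk, add_comm] at this
    · intro h
      obtain ⟨u, hu⟩ := hLb.2 (η + φ)
      rw [← hu, hRL] at h
      have h2 : graphSnd X u = η := by
        rw [hL, add_apply, h, add_comm] at hu
        exact add_right_cancel hu
      rw [← h, ← h2]
      exact graph_fst_snd u
  · have hsnd : ∀ u, (1 - R) (L u) = graphSnd X u := fun u => by
      rw [sub_apply, hRL, one_apply_eq_self, hL, add_apply, add_sub_cancel_left]
    rw [le_def, isPositive_def]
    refine ⟨fun x y => ?_, fun x => ?_⟩
    · obtain ⟨u, rfl⟩ := hLb.2 x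
      obtain ⟨v, rfl⟩ := hLb.2 y
      rw [coe_coe, hsnd, hsnd, hL, add_apply, add_apply, inner_add_right, inner_add_left, hsymm]
    · obtain ⟨u, rfl⟩ := hLb.2 x
      rw [reApplyInnerSelf_apply, hsnd, hL, add_apply, inner_add_right, map_add,
        inner_self_eq_norm_sq, hsymm]
      exact add_nonneg (hpos' u) (sq_nonneg _)

namespace IsPosSqrt

variable {A S : H →ₗ.[ℂ] H} {R : H →L[ℂ] H} {J : K →L[ℂ] H}

theorem isResolventAt (hS : IsPosSqrt A S) [CompleteSpace (graphSpace S)] :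
    IsResolventAt A 1 (graphFst S ∘L adjoint (graphFst S)) := by
  have := isResolventAt_opSq hS.1
  rwa [hS.2.2] at this

end IsPosSqrt

theorem norm_adjoint_sq (J : K →L[ℂ] H) (η : H) :
    ‖adjoint J η‖ ^ 2 = (inner ℂ η ((J ∘L adjoint J) η)).re := by
  rw [comp_apply, ← adjoint_inner_left, ← RCLike.re_eq_complex_re, inner_self_eq_norm_sq]

namespace IsPosSqrt

variable {A S : H →ₗ.[ℂ] H} {R : H →L[ℂ] H} {J : K →L[ℂ] H}

/-- The form domain of `A` is unique: any injective `J` with `J J† = (A + 1)⁻¹` identifies its source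
isometrically with the graph of `√A`. -/
theorem exists_isometry (hS : IsPosSqrt A S) (h : IsResolventAt A 1 (J ∘L adjoint J))
    (hJ : Function.Injective J) :
    (∀ φ, φ ∈ S.domain ↔ φ ∈ Set.range J) ∧
      ∃ U : K →ₗᵢ[ℂ] graphSpace S, ∀ u, graphFst S (U u) = J u := by
  have := completeSpace_graphSpace hS.1.isClosed
  have e := hS.isResolventAt.unique h
  have hn : ∀ η, ‖adjoint (graphFst S) η‖ = ‖adjoint J η‖ := fun η => by
    rw [← sq_eq_sq₀ (norm_nonneg _) (norm_nonneg _), norm_adjoint_sq, norm_adjoint_sq, e]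
  have h1 := fun u => exists_eq_of_norm_adjoint_le (J := graphFst S) (J' := J) zero_le_one
    (fun η => by rw [hn, one_mul]) u
  have h2 := fun u => exists_eq_of_norm_adjoint_le (J := J) (J' := graphFst S) zero_le_one
    (fun η => by rw [hn, one_mul]) u
  refine ⟨fun φ => ?_, ?_⟩
  · rw [← mem_range_graphFst]
    constructor
    · rintro ⟨u, rfl⟩
      obtain ⟨v, hv, _⟩ := h1 u
      exact ⟨v, hv⟩
    · rintro ⟨u, rfl⟩
      obtain ⟨v, hv, _⟩ := h2 u
      exact ⟨v, hv⟩
  · choose U hU hUn using h2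
    have hinj := graphFst_injective S
    refine ⟨⟨⟨⟨U, fun u v => hinj ?_⟩, fun c u => hinj ?_⟩, fun u => le_antisymm ?_ ?_⟩, hU⟩
    · rw [hU, map_add, map_add, hU, hU]
    · rw [hU, map_smul, RingHom.id_apply, map_smul, hU]
    · simpa using hUn u
    · obtain ⟨v, hv, hvn⟩ := h1 (U u)
      rw [hU] at hv
      rw [hJ hv] at hvn
      simpa using hvn

end IsPosSqrt

theorem graphSnd_eq {N : H →ₗ.[ℂ] H'} (u : graphSpace N) {φ : H} (hφ : φ ∈ N.domain)
    (h : graphFst N u = φ) : graphSnd N u = N ⟨φ, hφ⟩ := by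
  subst h
  exact LinearPMap.mem_graph_snd_inj _ (graph_fst_snd u) (N.mem_graph ⟨_, hφ⟩) rfl

/-- The form domain of a non-negative selfadjoint `A`, read off from a factorization of
`(A + 1)⁻¹`. -/
theorem mem_domain_opSqrt_iff {A : H →ₗ.[ℂ] H} {J : K →L[ℂ] H}
    (h : IsResolventAt A 1 (J ∘L adjoint J)) (h1 : J ∘L adjoint J ≤ 1)
    (hJ : Function.Injective J) (φ : H) : φ ∈ (opSqrt A).domain ↔ φ ∈ Set.range J :=
  ((isPosSqrt_opSqrt h h1).exists_isometry h hJ).1 φ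

theorem inner_opSqrt {A : H →ₗ.[ℂ] H} {J : K →L[ℂ] H}
    (h : IsResolventAt A 1 (J ∘L adjoint J)) (h1 : J ∘L adjoint J ≤ 1)
    (hJ : Function.Injective J) (u v : K) {φ ψ : H} (hu : J u = φ) (hv : J v = ψ)
    (hφ : φ ∈ (opSqrt A).domain) (hψ : ψ ∈ (opSqrt A).domain) :
    inner ℂ (opSqrt A ⟨φ, hφ⟩) (opSqrt A ⟨ψ, hψ⟩) = inner ℂ u v - inner ℂ φ ψ := by
  obtain ⟨U, hU⟩ := ((isPosSqrt_opSqrt h h1).exists_isometry h hJ).2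
  rw [← U.inner_map_map, inner_graphSpace, hU, hU, graphSnd_eq _ hφ ((hU u).trans hu),
    graphSnd_eq _ hψ ((hU v).trans hv), hu, hv]
  ring

/-- A converse of Douglas' lemma for non-negative operators. -/
theorem norm_apply_le_of_exists {R₁ R₂ : H →L[ℂ] H} (h1 : R₁.IsPositive) (h2 : R₂.IsPositive)
    {C : ℝ} (h : ∀ ξ, ∃ ζ, R₁ ζ = R₂ ξ ∧ ‖ζ‖ ≤ C * ‖ξ‖) (η : H) :
    ‖R₂ η‖ ≤ C * ‖R₁ η‖ := by
  obtain ⟨ζ, hζ, hζn⟩ := h (R₂ η)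
  have key : ‖R₂ η‖ * ‖R₂ η‖ ≤ (C * ‖R₁ η‖) * ‖R₂ η‖ := by
    calc ‖R₂ η‖ * ‖R₂ η‖ = ‖inner ℂ (R₂ η) (R₂ η)‖ := by
          rw [inner_self_eq_norm_sq_to_K]; simp [sq]
      _ = ‖inner ℂ (R₁ η) ζ‖ := by
          rw [h2.inner_left_eq_inner_right, ← hζ, ← h1.inner_left_eq_inner_right]
      _ ≤ ‖R₁ η‖ * ‖ζ‖ := norm_inner_le_norm _ _
      _ ≤ ‖R₁ η‖ * (C * ‖R₂ η‖) := by gcongr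
      _ = _ := by ring
  rcases (norm_nonneg (R₂ η)).eq_or_lt with h0 | h0
  · obtain ⟨ζ', hζ', hn'⟩ := h η
    rcases (norm_nonneg η).eq_or_lt with h3 | h3
    · have : η = 0 := norm_eq_zero.mp h3.symm
      simp [this]
    · have : 0 ≤ C := by
        by_contra! hC
        nlinarith [norm_nonneg ζ']
      rw [← h0]; positivity
  · exact le_of_mul_le_mul_right key h0

/-- Heinz' inequality with exponent `1 / 2`. -/
theorem re_inner_le_of_norm_apply_le {R₁ R₂ : H →L[ℂ] H} (h1 : R₁.IsPositive)
    (h2 : R₂.IsPositive) {C : ℝ} (hC : 0 ≤ C) (h : ∀ η, ‖R₂ η‖ ≤ C * ‖R₁ η‖) (η : H) :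
    (inner ℂ η (R₂ η)).re ≤ C * (inner ℂ η (R₁ η)).re := by
  have h1' : ((C : ℂ) • R₁).IsPositive := h1.smul_of_nonneg (by exact_mod_cast hC)
  have hsq : R₂ * R₂ ≤ ((C : ℂ) • R₁) * ((C : ℂ) • R₁) := by
    rw [le_def, isPositive_def]
    have s1 := h1'.inner_left_eq_inner_right
    have s2 := h2.inner_left_eq_inner_right
    refine ⟨fun x y => ?_, fun x => ?_⟩
    · simp only [coe_coe, sub_apply, mul_apply_eq_comp, inner_sub_left, inner_sub_right, s1, s2]
    · rw [reApplyInnerSelf_apply, sub_apply, inner_sub_left, mul_apply_eq_comp, mul_apply_eq_comp,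
        s1, s2, map_sub, inner_self_eq_norm_sq, inner_self_eq_norm_sq, smul_apply, norm_smul]
      have := h x
      rw [Complex.norm_real, Real.norm_of_nonneg hC, sub_nonneg]
      gcongr
  have := CFC.sqrt_le_sqrt _ _ hsq
  rw [CFC.sqrt_mul_self _ ((nonneg_iff_isPositive _).mpr h2),
    CFC.sqrt_mul_self _ ((nonneg_iff_isPositive _).mpr h1'), le_def] at this
  have := this.re_inner_nonneg_right η
  rw [sub_apply, inner_sub_right, map_sub, smul_apply, inner_smul_right] at this
  simpa using this

/-- The form domain of a semibounded `T` is the range of any `J` for which `J J†` is comparable to a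
resolvent of `T`. Since `|T|` and `T` have the same domain and `‖|T| φ‖ = ‖T φ‖`, their resolvents
bound each other in norm, hence as forms by Heinz' inequality; Douglas' lemma turns this into
equality of ranges. -/
theorem mem_formDomain_iff {T : H →ₗ.[ℂ] H} {c : ℝ} {R : H →L[ℂ] H} (h : IsResolventAt T c R)
    {J : K →L[ℂ] H} {C₁ C₂ : ℝ} (hC₁ : 0 ≤ C₁) (hC₂ : 0 ≤ C₂)
    (h1 : ∀ η, ‖adjoint J η‖ ^ 2 ≤ C₁ * (inner ℂ η (R η)).re)
    (h2 : ∀ η, (inner ℂ η (R η)).re ≤ C₂ * ‖adjoint J η‖ ^ 2) (φ : H) :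
    φ ∈ formDomain T ↔ φ ∈ Set.range J := by
  have hT := h.isSelfAdjoint
  have := completeSpace_graphSpace hT.isClosed
  have hsq := isResolventAt_opSq hT
  have hle := graphFst_comp_adjoint_le_one T
  have hX := isPosSqrt_opSqrt hsq hle
  have hXdom := mem_domain_opSqrt_iff hsq hle (graphFst_injective T)
  obtain ⟨RX, hRX, hRX1⟩ := exists_isResolventAt_one hX.1 hX.2.1
  set S := opSqrt (opAbs T) with hSdef
  have hS : IsPosSqrt (opSqrt (opSq T)) S := isPosSqrt_opSqrt hRX hRX1
  have := completeSpace_graphSpace hS.1.isClosed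
  have hSres := hS.isResolventAt.unique hRX
  -- `|T|` and `T` have the same domain and `‖|T| φ‖ = ‖T φ‖`.
  have hnorm : ∀ φ a b, (φ, a) ∈ T.graph → (φ, b) ∈ (opSqrt (opSq T)).graph → ‖a‖ = ‖b‖ := by
    intro φ a b ha hb
    obtain ⟨⟨φ', hφ⟩, rfl, rfl⟩ := (LinearPMap.mem_graph_iff _).mp hb
    have e := inner_opSqrt hsq hle (graphFst_injective T) (graphMk ha) (graphMk ha)
      (φ := φ') (ψ := φ') rfl rfl hφ hφ
    rw [inner_graphSpace, graphFst_mk, graphSnd_mk, add_sub_cancel_left] at e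
    have e' := congrArg Complex.re e
    rw [← RCLike.re_eq_complex_re, inner_self_eq_norm_sq, inner_self_eq_norm_sq] at e'
    exact ((sq_eq_sq₀ (norm_nonneg _) (norm_nonneg _)).mp e').symm
  have hdom : ∀ φ, (∃ a, (φ, a) ∈ T.graph) ↔ ∃ b, (φ, b) ∈ (opSqrt (opSq T)).graph := by
    intro φ
    rw [← LinearPMap.mem_domain_iff, ← LinearPMap.mem_domain_iff, hXdom, mem_range_graphFst]
  have hA : ∀ η, ‖RX η‖ ≤ (‖RX‖ * (1 + |c|) + 1) * ‖R η‖ := by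
    refine norm_apply_le_of_exists h.isPositive hRX.isPositive fun ξ => ?_
    have g1 := hRX.graph_apply ξ
    obtain ⟨a, ha⟩ := (hdom _).mpr ⟨_, g1⟩
    refine ⟨_, (h.mem_graph_iff _ _).mp ha, ?_⟩
    have e := hnorm _ _ _ ha g1
    have b1 := RX.le_opNorm ξ
    calc ‖a + (c : ℂ) • RX ξ‖ ≤ ‖a‖ + ‖(c : ℂ) • RX ξ‖ := norm_add_le _ _
      _ ≤ (‖ξ‖ + ‖RX ξ‖) + |c| * ‖RX ξ‖ := by
          rw [e, norm_smul, Complex.norm_real, Real.norm_eq_abs]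
          gcongr
          simpa using norm_sub_le ξ (RX ξ)
      _ ≤ (‖ξ‖ + ‖RX‖ * ‖ξ‖) + |c| * (‖RX‖ * ‖ξ‖) := by gcongr
      _ = _ := by ring
  have hB : ∀ η, ‖R η‖ ≤ (‖R‖ * (1 + |c|) + 1) * ‖RX η‖ := by
    refine norm_apply_le_of_exists hRX.isPositive h.isPositive fun ξ => ?_
    have g1 := h.graph_apply ξ
    obtain ⟨a, ha⟩ := (hdom _).mp ⟨_, g1⟩
    refine ⟨_, (hRX.mem_graph_iff _ _).mp ha, ?_⟩
    have e := hnorm _ _ _ g1 ha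
    have b1 := R.le_opNorm ξ
    calc ‖a + ((1 : ℝ) : ℂ) • R ξ‖ ≤ ‖a‖ + ‖R ξ‖ := by simpa using norm_add_le _ _
      _ ≤ (‖ξ‖ + |c| * ‖R ξ‖) + ‖R ξ‖ := by
          rw [← e]
          gcongr
          refine (norm_sub_le _ _).trans ?_
          rw [norm_smul, Complex.norm_real, Real.norm_eq_abs]
      _ ≤ (‖ξ‖ + |c| * (‖R‖ * ‖ξ‖)) + ‖R‖ * ‖ξ‖ := by gcongr
      _ = _ := by ring
  set a := ‖RX‖ * (1 + |c|) + 1 with ha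
  set b := ‖R‖ * (1 + |c|) + 1 with hb
  have ha0 : 0 ≤ a := by positivity
  have hb0 : 0 ≤ b := by positivity
  have hA' := re_inner_le_of_norm_apply_le h.isPositive hRX.isPositive ha0 hA
  have hB' := re_inner_le_of_norm_apply_le hRX.isPositive h.isPositive hb0 hB
  have hSn : ∀ η, ‖adjoint (graphFst S) η‖ ^ 2 = (inner ℂ η (RX η)).re := fun η => by
    rw [norm_adjoint_sq]
    exact congrArg (fun r : H →L[ℂ] H => (inner ℂ η (r η)).re) hSres
  change φ ∈ S.domain ↔ _
  rw [← mem_range_graphFst]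
  constructor
  · rintro ⟨u, rfl⟩
    obtain ⟨v, hv, _⟩ := exists_eq_of_norm_adjoint_le (J := graphFst S) (J' := J)
      (Real.sqrt_nonneg (a * C₂)) (fun η => by
        refine le_of_sq_le_sq ?_ (by positivity)
        rw [mul_pow, Real.sq_sqrt (by positivity), hSn, mul_assoc]
        exact (hA' η).trans (mul_le_mul_of_nonneg_left (h2 η) ha0)) u
    exact ⟨v, hv⟩
  · rintro ⟨u, rfl⟩
    obtain ⟨v, hv, _⟩ := exists_eq_of_norm_adjoint_le (J := J) (J' := graphFst S)
      (Real.sqrt_nonneg (C₁ * b)) (fun η => by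
        refine le_of_sq_le_sq ?_ (by positivity)
        rw [mul_pow, Real.sq_sqrt (by positivity), hSn, mul_assoc]
        exact (h1 η).trans (mul_le_mul_of_nonneg_left (hB' η) hC₁)) u
    exact ⟨v, hv⟩

/-- The operator `W` on the form domain `K` that represents the form
`⟨u, v⟩ + C ⟨J u, J v⟩ - ⟨β u, β v⟩`. -/
def perturbedGram (J : K →L[ℂ] H) (β : K →L[ℂ] H') (C : ℝ) : K →L[ℂ] K :=
  1 + (C : ℂ) • (adjoint J ∘L J) - adjoint β ∘L β

section perturbed

variable {J : K →L[ℂ] H} {β : K →L[ℂ] H'} {C α : ℝ}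

theorem inner_perturbedGram (u v : K) :
    inner ℂ u (perturbedGram J β C v)
      = inner ℂ u v + C * inner ℂ (J u) (J v) - inner ℂ (β u) (β v) := by
  rw [perturbedGram, sub_apply, add_apply, smul_apply, comp_apply, comp_apply, inner_sub_right,
    inner_add_right, inner_smul_right, adjoint_inner_right, adjoint_inner_right, one_apply_eq_self]

theorem inner_perturbedGram_comm (u v : K) :
    inner ℂ (perturbedGram J β C u) v = inner ℂ u (perturbedGram J β C v) := by
  rw [← inner_conj_symm, inner_perturbedGram, inner_perturbedGram]
  simp [inner_conj_symm]

theorem re_inner_perturbedGram (u : K) :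
    (inner ℂ u (perturbedGram J β C u)).re = ‖u‖ ^ 2 + C * ‖J u‖ ^ 2 - ‖β u‖ ^ 2 := by
  rw [inner_perturbedGram, Complex.sub_re, Complex.add_re, Complex.re_ofReal_mul,
    ← RCLike.re_eq_complex_re, inner_self_eq_norm_sq, inner_self_eq_norm_sq,
    inner_self_eq_norm_sq]

variable (h : ∀ u, ‖β u‖ ^ 2 ≤ α * (‖u‖ ^ 2 - ‖J u‖ ^ 2) + C * ‖J u‖ ^ 2) (hα0 : 0 ≤ α)
include h hα0

/-- The perturbed form is coercive on `K`, as `α < 1`. -/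
theorem le_re_inner_perturbedGram (u : K) :
    (1 - α) * ‖u‖ ^ 2 ≤ (inner ℂ u (perturbedGram J β C u)).re := by
  rw [re_inner_perturbedGram]
  nlinarith [h u, mul_nonneg hα0 (sq_nonneg ‖J u‖)]

theorem isUnit_perturbedGram (hα1 : α < 1) : IsUnit (perturbedGram J β C) := by
  refine isUnit_of_forall_le_norm_inner_map _ (c := (1 - α).toNNReal)
    (by simpa using hα1) fun u => ?_
  rw [inner_perturbedGram_comm, mul_comm, Real.coe_toNNReal _ (by linarith)]
  exact (le_re_inner_perturbedGram h hα0 u).trans (Complex.re_le_norm _)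

theorem perturbedGram_inverse_apply (hα1 : α < 1) (u : K) :
    perturbedGram J β C (Ring.inverse (perturbedGram J β C) u) = u :=
  congrArg (· u) (Ring.mul_inverse_cancel _ (isUnit_perturbedGram h hα0 hα1))

theorem inverse_perturbedGram_apply (hα1 : α < 1) (u : K) :
    Ring.inverse (perturbedGram J β C) (perturbedGram J β C u) = u :=
  congrArg (· u) (Ring.inverse_mul_cancel _ (isUnit_perturbedGram h hα0 hα1))

end perturbed

/-- The bounded operator `J W⁻¹ J†` on `H`, where `W` represents the form
`⟨u, v⟩ + C ⟨J u, J v⟩ - ⟨β u, β v⟩` on `K`. The use of `Ring.inverse` makes it `0` when `W` is not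
invertible. -/
def perturbedResolvent (J : K →L[ℂ] H) (β : K →L[ℂ] H') (C : ℝ) : H →L[ℂ] H :=
  J ∘L Ring.inverse (perturbedGram J β C) ∘L adjoint J

section perturbed

variable {J : K →L[ℂ] H} {β : K →L[ℂ] H'} {C α : ℝ}
variable (h : ∀ u, ‖β u‖ ^ 2 ≤ α * (‖u‖ ^ 2 - ‖J u‖ ^ 2) + C * ‖J u‖ ^ 2) (hα0 : 0 ≤ α)
  (hα1 : α < 1)
include h hα0 hα1

theorem exists_perturbedResolvent_eq (η : H) :
    ∃ y, perturbedResolvent J β C η = J y ∧ perturbedGram J β C y = adjoint J η :=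
  ⟨_, rfl, perturbedGram_inverse_apply h hα0 hα1 _⟩

theorem isPositive_perturbedResolvent : (perturbedResolvent J β C).IsPositive := by
  rw [isPositive_def]
  refine ⟨fun x y => ?_, fun x => ?_⟩
  · obtain ⟨u, hu, hu'⟩ := exists_perturbedResolvent_eq h hα0 hα1 x
    obtain ⟨v, hv, hv'⟩ := exists_perturbedResolvent_eq h hα0 hα1 y
    rw [coe_coe, hu, hv, ← adjoint_inner_right, ← adjoint_inner_left J, ← hu', ← hv',
      inner_perturbedGram_comm]
  · obtain ⟨u, hu, hu'⟩ := exists_perturbedResolvent_eq h hα0 hα1 x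
    rw [reApplyInnerSelf_apply, hu, ← adjoint_inner_right, ← hu']
    refine le_trans ?_ (le_re_inner_perturbedGram h hα0 u)
    have : 0 ≤ 1 - α := by linarith
    positivity

theorem norm_adjoint_sq_le_perturbedResolvent (η : H) :
    ‖adjoint J η‖ ^ 2 ≤ ‖perturbedGram J β C‖ ^ 2 / (1 - α)
      * (inner ℂ η (perturbedResolvent J β C η)).re := by
  obtain ⟨u, hu, hu'⟩ := exists_perturbedResolvent_eq h hα0 hα1 η
  have h1 : 0 < 1 - α := by linarith
  rw [hu, ← adjoint_inner_left, ← hu', inner_perturbedGram_comm]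
  have h2 := le_re_inner_perturbedGram h hα0 u
  calc ‖perturbedGram J β C u‖ ^ 2 ≤ (‖perturbedGram J β C‖ * ‖u‖) ^ 2 := by
        gcongr; exact le_opNorm _ _
    _ = ‖perturbedGram J β C‖ ^ 2 / (1 - α) * ((1 - α) * ‖u‖ ^ 2) := by field_simp
    _ ≤ _ := by gcongr

theorem perturbedResolvent_le_norm_adjoint_sq (η : H) :
    (inner ℂ η (perturbedResolvent J β C η)).re ≤ (1 - α)⁻¹ * ‖adjoint J η‖ ^ 2 := by
  obtain ⟨u, hu, hu'⟩ := exists_perturbedResolvent_eq h hα0 hα1 η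
  have h1 : 0 < 1 - α := by linarith
  have h2 := le_re_inner_perturbedGram h hα0 u
  rw [hu, ← adjoint_inner_left, ← hu', inner_perturbedGram_comm]
  set t := (inner ℂ u (perturbedGram J β C u)).re with ht
  have h3 : t ≤ ‖u‖ * ‖perturbedGram J β C u‖ :=
    (Complex.re_le_norm _).trans (norm_inner_le_norm _ _)
  have h4 : (1 - α) * ‖u‖ ≤ ‖perturbedGram J β C u‖ := by
    rcases (norm_nonneg u).eq_or_lt with h0 | h0
    · rw [← h0]; simp
    · refine le_of_mul_le_mul_right ?_ h0
      nlinarith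
  rw [inv_mul_eq_div, le_div_iff₀ h1]
  calc t * (1 - α) ≤ (‖u‖ * ‖perturbedGram J β C u‖) * (1 - α) := by gcongr
    _ = ((1 - α) * ‖u‖) * ‖perturbedGram J β C u‖ := by ring
    _ ≤ ‖perturbedGram J β C u‖ * ‖perturbedGram J β C u‖ := by gcongr
    _ = _ := by ring

/-- The KLMN theorem: if `K` is the form domain of `A` and `β` represents `√B` on it, then
`A - B + C + 1` is the inverse of `J W⁻¹ J†`. -/
theorem isResolventAt_formSub {A B : H →ₗ.[ℂ] H} (hJ : Function.Injective J)
    (hJd : Dense (Set.range J))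
    (hA : ∀ φ, φ ∈ (opSqrt A).domain ↔ φ ∈ Set.range J)
    (hAi : ∀ u v (hu : J u ∈ (opSqrt A).domain) (hv : J v ∈ (opSqrt A).domain),
      inner ℂ (opSqrt A ⟨J u, hu⟩) (opSqrt A ⟨J v, hv⟩) = inner ℂ u v - inner ℂ (J u) (J v))
    (hB : ∀ u, J u ∈ (opSqrt B).domain)
    (hBi : ∀ u v, inner ℂ (opSqrt B ⟨J u, hB u⟩) (opSqrt B ⟨J v, hB v⟩) = inner ℂ (β u) (β v)) :
    IsResolventAt (formSub A B) (C + 1) (perturbedResolvent J β C) := by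
  have hinj : ∀ η, perturbedResolvent J β C η = 0 → η = 0 := fun η hη => by
    obtain ⟨u, hu, hu'⟩ := exists_perturbedResolvent_eq h hα0 hα1 η
    have u0 : u = 0 := hJ (by rw [← hu, hη, map_zero])
    rw [u0, map_zero] at hu'
    refine hJd.eq_zero_of_inner_right ℂ ?_
    rintro _ ⟨v, rfl⟩
    rw [← adjoint_inner_right, ← hu', inner_zero_right]
  have key : ∀ φ η, (φ, η) ∈ formSubGraph A B ↔
      perturbedResolvent J β C (η + ((C + 1 : ℝ) : ℂ) • φ) = φ := by
    intro φ η
    -- membership in the graph says that the Gram operator maps `u` to `J† (η + (C + 1) φ)`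
    have step : ∀ u, J u = φ → ((∀ ψ (kA : ψ ∈ (opSqrt A).domain) (kB : ψ ∈ (opSqrt B).domain)
          (hA' : φ ∈ (opSqrt A).domain) (hB' : φ ∈ (opSqrt B).domain),
          inner ℂ (opSqrt A ⟨ψ, kA⟩) (opSqrt A ⟨φ, hA'⟩)
            - inner ℂ (opSqrt B ⟨ψ, kB⟩) (opSqrt B ⟨φ, hB'⟩) = inner ℂ ψ η) ↔
        perturbedGram J β C u = adjoint J (η + ((C + 1 : ℝ) : ℂ) • φ)) := by
      rintro u rfl
      have e : ∀ v, inner ℂ v (perturbedGram J β C u)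
          - inner ℂ v (adjoint J (η + ((C + 1 : ℝ) : ℂ) • J u))
          = inner ℂ v u - inner ℂ (J v) (J u) - inner ℂ (β v) (β u) - inner ℂ (J v) η := by
        intro v
        rw [inner_perturbedGram, adjoint_inner_right, inner_add_right, inner_smul_right]
        push_cast
        ring
      constructor
      · intro H
        refine ext_inner_left ℂ fun v => ?_
        rw [← sub_eq_zero, e]
        have := H (J v) ((hA _).mpr ⟨v, rfl⟩) (hB v) ((hA _).mpr ⟨u, rfl⟩) (hB u)
        rw [hAi, hBi] at this
        rw [this, sub_self]
      · intro H ψ kA kB hA' hB'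
        obtain ⟨v, rfl⟩ := (hA ψ).mp kA
        have := e v
        rw [H, sub_self, eq_comm, sub_eq_zero] at this
        rw [hAi, hBi, this]
    constructor
    · rintro ⟨hA', hB', H⟩
      obtain ⟨u, hu⟩ := (hA φ).mp hA'
      have := (step u hu).mp fun ψ kA kB _ _ => H ψ kA kB
      rw [perturbedResolvent, comp_apply, comp_apply, ← this,
        inverse_perturbedGram_apply h hα0 hα1, hu]
    · intro H
      obtain ⟨u, hu, hu'⟩ := exists_perturbedResolvent_eq h hα0 hα1 (η + ((C + 1 : ℝ) : ℂ) • φ)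
      have hφ : J u = φ := hu.symm.trans H
      have h2 := (step u hφ).mpr hu'
      exact ⟨(hA φ).mpr ⟨u, hφ⟩, hφ ▸ hB u, fun ψ kA kB => h2 ψ kA kB _ _⟩
  refine ⟨isPositive_perturbedResolvent h hα0 hα1, fun φ η => ?_⟩
  rw [formSub, Submodule.toLinearPMap_graph_eq, key]
  rintro ⟨φ, η⟩ hx h0
  simp only at h0
  rw [key, h0, smul_zero, add_zero] at hx
  exact hinj η hx

end perturbed

end AbstractForms

/-! ### Discrete spectrum and compact resolvents -/

section SpectralTheory

variable {H : Type*} [NormedAddCommGroup H] [InnerProductSpace ℂ H] [CompleteSpace H]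

open ContinuousLinearMap Module.End

theorem mem_eigenspace_iff_graph {T : H →ₗ.[ℂ] H} {z : ℂ} {v : H} :
    v ∈ SparseForm.eigenspace T z ↔ (v, z • v) ∈ T.graph := by
  rw [SparseForm.eigenspace, Submodule.mem_map, LinearPMap.mem_graph_iff]
  constructor
  · rintro ⟨x, hx, rfl⟩
    exact ⟨x, rfl, sub_eq_zero.mp hx⟩
  · rintro ⟨x, rfl, hx⟩
    exact ⟨x, sub_eq_zero.mpr hx, rfl⟩

namespace IsResolventAt

variable {T : H →ₗ.[ℂ] H} {c : ℝ} {R : H →L[ℂ] H}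

theorem mem_eigenspace_iff (h : IsResolventAt T c R) {z : ℂ} {v : H} :
    v ∈ SparseForm.eigenspace T z ↔ (z + c) • R v = v := by
  rw [mem_eigenspace_iff_graph, h.mem_graph_iff, ← add_smul, map_smul]

theorem eigenspace_eq (h : IsResolventAt T c R) {z : ℂ} (hz : z + c ≠ 0) :
    SparseForm.eigenspace T z = Module.End.eigenspace R.toLinearMap (z + c)⁻¹ := by
  ext v
  rw [h.mem_eigenspace_iff, Module.End.mem_eigenspace_iff, coe_coe, eq_inv_smul_iff₀ hz]

/-- `T - z = (1 - (z + c) R) (T + c)`. -/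
theorem isResolventPoint_iff (h : IsResolventAt T c R) (z : ℂ) :
    IsResolventPoint T z ↔ IsUnit (1 - (z + c) • R) := by
  have hgr : ∀ φ ψ (hφ : φ ∈ T.domain), T ⟨φ, hφ⟩ = ψ ↔ R (ψ + (c : ℂ) • φ) = φ := by
    intro φ ψ hφ
    rw [← h.mem_graph_iff]
    constructor
    · rintro rfl
      exact T.mem_graph ⟨φ, hφ⟩
    · intro hg
      exact LinearPMap.mem_graph_snd_inj _ (T.mem_graph ⟨φ, hφ⟩) hg rfl
  constructor
  · rintro ⟨Rz, h1, h2⟩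
    have e1 : ∀ η, R (η + (z + c) • Rz η) = Rz η := by
      intro η
      obtain ⟨hm, he⟩ := h1 η
      rw [sub_eq_iff_eq_add, hgr] at he
      rw [add_smul, ← add_assoc]
      exact he
    have e2 : ∀ η, Rz (η - (z + c) • R η) = R η := by
      intro η
      have hm : R η ∈ T.domain := h.mem_domain_iff.mpr ⟨η, rfl⟩
      have := h2 ⟨R η, hm⟩
      rw [(hgr _ (η - (c : ℂ) • R η) hm).mpr (by simp)] at this
      rwa [add_comm z, add_smul, ← sub_sub]
    refine ⟨⟨1 - (z + c) • R, 1 + (z + c) • Rz, ?_, ?_⟩, rfl⟩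
    · ext η
      have := e1 η
      simp only [mul_apply_eq_comp, sub_apply, add_apply, one_apply_eq_self, smul_apply]
      rw [this]
      abel
    · ext η
      have := e2 η
      simp only [mul_apply_eq_comp, sub_apply, add_apply, one_apply_eq_self, smul_apply]
      rw [this]
      abel
  · rintro ⟨U, hU⟩
    have e1 : ∀ η, U.inv η - (z + c) • R (U.inv η) = η := by
      intro η
      have := congrArg (· η) U.val_inv
      rwa [hU] at this
    have e2 : ∀ η, U.inv (η - (z + c) • R η) = η := by
      intro η
      have := congrArg (· η) U.inv_val
      rwa [hU] at this
    refine ⟨R ∘L U.inv, fun η => ⟨h.mem_domain_iff.mpr ⟨_, rfl⟩, ?_⟩, ?_⟩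
    · rw [(hgr _ (U.inv η - (c : ℂ) • R (U.inv η)) _).mpr (by simp)]
      conv_rhs => rw [← e1 η]
      rw [comp_apply, add_smul]
      abel
    · rintro ⟨φ, hφ⟩
      obtain ⟨ξ, rfl⟩ := h.mem_domain_iff.mp hφ
      rw [(hgr _ (ξ - (c : ℂ) • R ξ) _).mpr (by simp), comp_apply, sub_sub, ← add_smul,
        add_comm (c : ℂ), e2]

theorem mem_opSpectrum_iff (h : IsResolventAt T c R) {z : ℂ} (hz : z + c ≠ 0) :
    z ∈ opSpectrum T ↔ (z + c)⁻¹ ∈ spectrum ℂ R := by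
  rw [opSpectrum, Set.mem_ofPred_eq, h.isResolventPoint_iff, spectrum.mem_iff, not_iff_not]
  have : algebraMap ℂ (H →L[ℂ] H) (z + c)⁻¹ - R
      = (Units.mk0 _ (inv_ne_zero hz)) • (1 - (z + c) • R) := by
    rw [Units.smul_mk0, smul_sub, smul_smul, inv_mul_cancel₀ hz, one_smul,
      Algebra.algebraMap_eq_smul_one]
  rw [this, isUnit_smul_iff]

theorem add_ne_zero_of_mem_opSpectrum (h : IsResolventAt T c R) {z : ℂ} (hz : z ∈ opSpectrum T) :
    z + c ≠ 0 := by
  intro h0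
  rw [opSpectrum, Set.mem_ofPred_eq, h.isResolventPoint_iff, h0] at hz
  simp at hz

end IsResolventAt

/-- Nonzero points of the spectrum of a compact non-negative operator are isolated. With `P` the
projection to the eigenspace at `μ`, the point `μ` is in the open resolvent set of the compact
operator `R + P`, and away from `μ` the eigenvalues of `R` are eigenvalues of `R + P`. -/
theorem exists_nhds_notMem_spectrum {R : H →L[ℂ] H} (hR : R.IsPositive)
    (hc : IsCompactOperator R) {μ : ℂ} (hμ : μ ≠ 0) :
    ∀ᶠ ν in 𝓝 μ, ν ≠ μ → ν ∉ spectrum ℂ R := by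
  set E := Module.End.eigenspace R.toLinearMap μ with hE
  have : FiniteDimensional ℂ E := finite_dimensional_eigenspace hc μ hμ
  set P := E.starProjection with hP
  have hPc : IsCompactOperator P :=
    (isCompactOperator_of_locallyCompactSpace_dom E.orthogonalProjectionOnto).clm_comp E.subtypeL
  have hRE : ∀ v ∈ E, R v = μ • v := fun v hv => Module.End.mem_eigenspace_iff.mp hv
  have hne : ¬ HasEigenvalue (R + P).toLinearMap μ := by
    intro hev
    obtain ⟨v, hv⟩ := hev.exists_hasEigenvector
    refine hv.2 ?_
    have e : R v + P v = μ • v := Module.End.mem_eigenspace_iff.mp hv.1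
    -- test the eigenvalue equation with an eigenvector of `R`
    have hPv : P v = 0 := by
      have hmem : P v ∈ E := Submodule.starProjection_apply_mem E v
      rw [← inner_self_eq_zero (𝕜 := ℂ)]
      have h1 : inner ℂ (P v) (R v) = inner ℂ (P v) (μ • v) := by
        rw [← hR.inner_left_eq_inner_right, hRE _ hmem, inner_smul_left, inner_smul_right]
        by_cases h0 : P v = 0
        · simp [h0]
        · have : HasEigenvalue R.toLinearMap μ :=
            Module.End.hasEigenvalue_of_hasEigenvector ⟨hmem, h0⟩
          rw [hR.isSymmetric.conj_eigenvalue_eq_self this]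
      have h2 := congrArg (inner ℂ (P v)) e
      rw [inner_add_right, h1] at h2
      exact add_left_cancel (h2.trans (add_zero _).symm)
    rw [hPv, add_zero] at e
    have : v ∈ E := Module.End.mem_eigenspace_iff.mpr e
    rwa [hP, Submodule.starProjection_eq_self_iff.mpr this] at hPv
  have hres := (IsCompactOperator.hasEigenvalue_or_mem_resolventSet (T := R + P)
    (hc.add hPc) hμ).resolve_left hne
  have hopen := (spectrum.isOpen_resolventSet (𝕜 := ℂ) (R + P)).mem_nhds hres
  filter_upwards [hopen, isOpen_ne.mem_nhds hμ] with ν hν hν0 hne' hspec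
  rw [← hc.hasEigenvalue_iff_mem_spectrum hν0] at hspec
  obtain ⟨v, hv⟩ := hspec.exists_hasEigenvector
  have hRv : R v = ν • v := Module.End.mem_eigenspace_iff.mp hv.1
  have hPv : P v = 0 := by
    rw [hP, Submodule.starProjection_apply_eq_zero_iff, Submodule.mem_orthogonal]
    intro w hw
    exact hR.isSymmetric.orthogonalFamily_eigenspaces (Ne.symm hne') ⟨w, hw⟩ ⟨v, hv.1⟩
  have : HasEigenvalue (R + P).toLinearMap ν := by
    refine Module.End.hasEigenvalue_of_hasEigenvector ⟨Module.End.mem_eigenspace_iff.mpr ?_, hv.2⟩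
    change R v + P v = _
    rw [hPv, add_zero, hRv]
  rw [IsCompactOperator.hasEigenvalue_iff_mem_spectrum (T := R + P) (hc.add hPc) hν0] at this
  exact this hν

theorem hasPurelyDiscreteSpectrum_of_isCompactOperator {T : H →ₗ.[ℂ] H} {c : ℝ} {R : H →L[ℂ] H}
    (h : IsResolventAt T c R) (hc : IsCompactOperator R) : HasPurelyDiscreteSpectrum T := by
  rw [HasPurelyDiscreteSpectrum, essSpectrum, Set.sdiff_eq_empty]
  intro z hz
  have hz0 := h.add_ne_zero_of_mem_opSpectrum hz
  have hz0' := inv_ne_zero hz0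
  refine ⟨hz, ?_, ?_, ?_⟩
  · have h1 := exists_nhds_notMem_spectrum h.isPositive hc hz0'
    have hcont : Filter.Tendsto (fun w : ℂ => (w + c)⁻¹) (𝓝 z) (𝓝 (z + c)⁻¹) := by
      apply ContinuousAt.tendsto (f := fun w : ℂ => (w + c)⁻¹)
      exact ContinuousAt.inv₀ (by fun_prop) hz0
    refine ⟨_, hcont.eventually h1, ?_⟩
    ext w
    simp only [Set.mem_inter_iff, Set.mem_singleton_iff]
    constructor
    · rintro ⟨hw, hws⟩
      by_contra hne
      have hw0 := h.add_ne_zero_of_mem_opSpectrum hws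
      refine hw (fun e => hne ?_) ((h.mem_opSpectrum_iff hw0).mp hws)
      exact add_right_cancel (inv_injective e)
    · rintro rfl
      exact ⟨fun e => absurd rfl e, hz⟩
  · rw [h.eigenspace_eq hz0]
    rw [h.mem_opSpectrum_iff hz0, ← hc.hasEigenvalue_iff_mem_spectrum hz0'] at hz
    exact hz
  · rw [h.eigenspace_eq hz0]
    exact finite_dimensional_eigenspace hc _ hz0'

theorem isCompactOperator_of_mem_finiteDimensional {Q : H →L[ℂ] H} (F : Submodule ℂ H)
    [FiniteDimensional ℂ F] (hF : ∀ x, Q x ∈ F) : IsCompactOperator Q :=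
  (isCompactOperator_of_locallyCompactSpace_dom (Q.codRestrict F hF)).clm_comp F.subtypeL

/-- A selfadjoint operator is compact if the nonzero points of its spectrum are isolated and its
nonzero eigenvalues have finite multiplicity: its truncations to the spectrum outside
`(-δ, δ)` have finite rank and converge to it. -/
theorem isCompactOperator_of_isolated {R : H →L[ℂ] H} (hR : IsSelfAdjoint R)
    (hiso : ∀ x ∈ spectrum ℝ R, x ≠ 0 → ∀ᶠ y in 𝓝 x, y ∈ spectrum ℝ R → y = x)
    (hfin : ∀ x : ℝ, x ∈ spectrum ℝ R → x ≠ 0 →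
      FiniteDimensional ℂ (Module.End.eigenspace R.toLinearMap (x : ℂ))) :
    IsCompactOperator R := by
  have hclosed := isClosed_setOfPred_isCompactOperator (σ₁₂ := RingHom.id ℂ) (M₁ := H) (M₂ := H)
  change R ∈ {f : H →L[ℂ] H | IsCompactOperator f}
  rw [← hclosed.closure_eq, Metric.mem_closure_iff]
  intro ε hε
  set δ := ε / 2 with hδ
  have hδ0 : 0 < δ := by positivity
  set σ := spectrum ℝ R with hσ
  have hfinite : (σ ∩ {x | δ ≤ |x|}).Finite := by
    have hcomp : IsCompact (σ ∩ {x | δ ≤ |x|}) :=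
      (spectrum.isCompact R).inter_right (isClosed_le continuous_const continuous_abs)
    refine hcomp.finite ?_
    rw [isDiscrete_iff_discreteTopology, discreteTopology_subtype_iff']
    rintro x ⟨hx, hxδ⟩
    have hx0 : x ≠ 0 := by rintro rfl; simp at hxδ; linarith
    obtain ⟨U, hU, hUo, hxU⟩ := eventually_nhds_iff.mp (hiso x hx hx0)
    refine ⟨U, hUo, ?_⟩
    ext y
    simp only [Set.mem_inter_iff, Set.mem_singleton_iff]
    constructor
    · rintro ⟨h1, h2, _⟩
      exact hU y h1 h2
    · rintro rfl
      exact ⟨hxU, hx, hxδ⟩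
  set F := hfinite.toFinset with hF
  have hcont1 : ∀ x ∈ F, ContinuousOn (fun t : ℝ => if t = x then x else 0) σ := by
    intro x hx y hy
    rw [hF, Set.Finite.mem_toFinset] at hx
    by_cases hyx : y = x
    · have hx0 : x ≠ 0 := by rintro rfl; simp at hx; linarith [hx.2]
      subst hyx
      refine (continuousWithinAt_const (b := y)).congr_of_eventuallyEq ?_ (by simp)
      filter_upwards [self_mem_nhdsWithin, nhdsWithin_le_nhds (hiso y hx.1 hx0)] with t h1 h2
      rw [if_pos (h2 h1)]
    · refine (continuousWithinAt_const (b := (0 : ℝ))).congr_of_eventuallyEq ?_ (by simp [hyx])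
      filter_upwards [nhdsWithin_le_nhds (isOpen_ne.mem_nhds hyx)] with t h1
      rw [if_neg h1]
  set Q := fun x : ℝ => cfc (fun t : ℝ => if t = x then x else 0) R with hQ
  have hQc : ∀ x ∈ F, IsCompactOperator (Q x) := by
    intro x hx
    have hx' := hx
    rw [hF, Set.Finite.mem_toFinset] at hx'
    have hx0 : x ≠ 0 := by rintro rfl; simp at hx'; linarith [hx'.2]
    have := hfin x hx'.1 hx0
    refine isCompactOperator_of_mem_finiteDimensional
      (Module.End.eigenspace R.toLinearMap (x : ℂ)) fun v => ?_
    rw [Module.End.mem_eigenspace_iff]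
    have e : R * Q x = x • Q x := by
      conv_lhs => rw [← cfc_id ℝ R, hQ]
      rw [← cfc_mul _ _ R continuousOn_id (hcont1 x hx), hQ, ← cfc_const_mul _ _ R (hcont1 x hx)]
      congr 1
      ext t
      by_cases ht : t = x <;> simp [ht]
    have := congrArg (· v) e
    simpa using this
  refine ⟨∑ x ∈ F, Q x, ?_, ?_⟩
  · have : ∀ s : Finset ℝ, s ⊆ F → IsCompactOperator ⇑(∑ x ∈ s, Q x) := by
      intro s
      induction s using Finset.induction_on with
      | empty => intro _; simpa using isCompactOperator_zero
      | insert a s ha ih =>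
        intro hs
        rw [Finset.sum_insert ha]
        exact (hQc a (hs (Finset.mem_insert_self _ _))).add
          (ih ((Finset.subset_insert _ _).trans hs))
    exact this F subset_rfl
  · have hcs : ContinuousOn (fun t : ℝ => ∑ x ∈ F, if t = x then x else 0) σ :=
      continuousOn_finsetSum F hcont1
    have e : R - ∑ x ∈ F, Q x = cfc (fun t : ℝ => t - ∑ x ∈ F, if t = x then x else 0) R := by
      rw [cfc_sub (fun t => t) _ R continuousOn_id hcs, cfc_id' ℝ R, hQ, ← cfc_sum _ _ _ hcont1]
      congr 2
      ext t
      simp only [Finset.sum_apply]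
    rw [dist_eq_norm, e]
    refine lt_of_le_of_lt (norm_cfc_le hδ0.le fun t ht => ?_) (by linarith : δ < ε)
    rw [Finset.sum_ite_eq]
    by_cases htF : t ∈ F
    · simp [htF, hδ0.le]
    · rw [if_neg htF, sub_zero, Real.norm_eq_abs]
      rw [hF, Set.Finite.mem_toFinset] at htF
      by_contra! hlt
      exact htF ⟨ht, hlt.le⟩

theorem isCompactOperator_of_hasPurelyDiscreteSpectrum {T : H →ₗ.[ℂ] H} {c : ℝ}
    {R : H →L[ℂ] H} (h : IsResolventAt T c R) (hT : HasPurelyDiscreteSpectrum T) :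
    IsCompactOperator R := by
  rw [HasPurelyDiscreteSpectrum, essSpectrum, Set.sdiff_eq_empty] at hT
  have hspec : ∀ x : ℝ, x ∈ spectrum ℝ R → x ≠ 0 → ((x⁻¹ - c : ℝ) : ℂ) ∈ opSpectrum T := by
    intro x hx hx0
    have h1 : (((x⁻¹ - c : ℝ) : ℂ) + c) = (x : ℂ)⁻¹ := by push_cast; ring
    rw [h.mem_opSpectrum_iff (by rw [h1]; simpa using hx0), h1, inv_inv]
    exact (spectrum.algebraMap_mem_iff ℂ (r := x)).mpr hx
  refine isCompactOperator_of_isolated h.isPositive.isSelfAdjoint (fun x hx hx0 => ?_)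
    fun x hx hx0 => ?_
  · obtain ⟨_, ⟨U, hU, hUe⟩, _, _⟩ := hT (hspec x hx hx0)
    have hcont : Filter.Tendsto (fun y : ℝ => ((y⁻¹ - c : ℝ) : ℂ)) (𝓝 x) (𝓝 ((x⁻¹ - c : ℝ) : ℂ)) :=
      (Complex.continuous_ofReal.tendsto _).comp
        ((tendsto_inv₀ hx0).sub_const c)
    filter_upwards [hcont.eventually hU, isOpen_ne.mem_nhds hx0] with y hy hy0 hys
    have : ((y⁻¹ - c : ℝ) : ℂ) ∈ U ∩ opSpectrum T := ⟨hy, hspec y hys hy0⟩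
    rw [hUe, Set.mem_singleton_iff] at this
    have := Complex.ofReal_injective this
    exact inv_injective (sub_left_injective this)
  · obtain ⟨_, _, _, hf⟩ := hT (hspec x hx hx0)
    have h1 : (((x⁻¹ - c : ℝ) : ℂ) + c) = (x : ℂ)⁻¹ := by push_cast; ring
    rwa [h.eigenspace_eq (by rw [h1]; simpa using hx0), h1, inv_inv] at hf

end SpectralTheory

/-! ### Variational bounds for eigenvalues -/

section Variational

variable {H : Type*} [NormedAddCommGroup H] [InnerProductSpace ℂ H] [CompleteSpace H]
variable {H' : Type*} [NormedAddCommGroup H'] [InnerProductSpace ℂ H'] [CompleteSpace H']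
variable {K : Type*} [NormedAddCommGroup K] [InnerProductSpace ℂ K] [CompleteSpace K]

open ContinuousLinearMap

theorem re_inner_sum_smul_le {ι : Type*} (s : Finset ι) (v : ι → H)
    (hv : ∀ i ∈ s, ∀ j ∈ s, i ≠ j → inner ℂ (v i) (v j) = 0) (c : ι → ℝ) (M : ℝ)
    (hc : ∀ i ∈ s, v i ≠ 0 → c i ≤ M) :
    (inner ℂ (∑ i ∈ s, v i) (∑ i ∈ s, (c i : ℂ) • v i)).re ≤ M * ‖∑ i ∈ s, v i‖ ^ 2 := by
  have key : ∀ c : ι → ℝ, (inner ℂ (∑ i ∈ s, v i) (∑ i ∈ s, (c i : ℂ) • v i)).re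
      = ∑ i ∈ s, c i * ‖v i‖ ^ 2 := by
    intro c
    rw [sum_inner, Complex.re_sum]
    refine Finset.sum_congr rfl fun i hi => ?_
    rw [inner_sum, Finset.sum_eq_single_of_mem i hi]
    · rw [inner_smul_right, Complex.re_ofReal_mul, ← RCLike.re_eq_complex_re,
        inner_self_eq_norm_sq]
    · intro j hj hji
      rw [inner_smul_right, hv i hi j hj hji.symm, mul_zero]
  have h1 := key fun _ => 1
  simp only [Complex.ofReal_one, one_smul, one_mul] at h1
  rw [← RCLike.re_eq_complex_re, inner_self_eq_norm_sq] at h1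
  rw [key, h1, Finset.mul_sum]
  refine Finset.sum_le_sum fun i hi => ?_
  by_cases h0 : v i = 0
  · simp [h0]
  · exact mul_le_mul_of_nonneg_right (hc i hi h0) (sq_nonneg _)

/-- The span of the eigenvectors of `T` to real eigenvalues at most `s`. -/
def lowSpace (T : H →ₗ.[ℂ] H) (s : ℝ) : Submodule ℂ H :=
  ⨆ t : {t : ℝ // t ≤ s}, eigenspace T ((t : ℝ) : ℂ)

theorem exists_mem_graph_of_mem_lowSpace {T : H →ₗ.[ℂ] H} (hT : IsSelfAdjoint T) {s : ℝ} {f : H}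
    (hf : f ∈ lowSpace T s) :
    ∃ η, (f, η) ∈ T.graph ∧ (inner ℂ f η).re ≤ s * ‖f‖ ^ 2 := by
  obtain ⟨w, hw, rfl⟩ := (Submodule.mem_iSup_iff_exists_finsupp _ _).mp hf
  have hg := (isSelfAdjoint_iff_graph.mp hT).2
  have hw' : ∀ i, (w i, ((i : ℝ) : ℂ) • w i) ∈ T.graph := fun i =>
    mem_eigenspace_iff_graph.mp (hw i)
  refine ⟨∑ i ∈ w.support, ((i : ℝ) : ℂ) • w i, ?_, ?_⟩
  · have := T.graph.sum_mem fun i (_ : i ∈ w.support) => hw' i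
    convert this using 1
    ext
    · simp [Finsupp.sum, Prod.fst_sum]
    · simp [Prod.snd_sum]
  · refine re_inner_sum_smul_le w.support (fun i => w i) (fun i _ j _ hij => ?_) (fun i => (i : ℝ)) s
      fun i _ _ => i.2
    have := (hg _ _).mp (hw' j) _ _ (hw' i)
    rw [inner_smul_left, inner_smul_right, Complex.conj_ofReal] at this
    have h2 : (((i : ℝ) : ℂ) - ((j : ℝ) : ℂ)) * inner ℂ (w i) (w j) = 0 := by
      rw [sub_mul, this, sub_self]
    refine (mul_eq_zero.mp h2).resolve_left fun h0 => hij (Subtype.ext ?_)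
    exact_mod_cast sub_eq_zero.mp h0

/-- A vector orthogonal to the low eigenvectors of `T` is in the closed span of the eigenvectors of the
compact operator `R` to eigenvalues below `(s + c)⁻¹`. -/
theorem re_inner_le_of_mem_orthogonal_lowSpace {T : H →ₗ.[ℂ] H} {c : ℝ} {R : H →L[ℂ] H}
    (h : IsResolventAt T c R) (hc : IsCompactOperator R) {s : ℝ} (hs : 0 < s + c) {f : H}
    (hf : f ∈ (lowSpace T s)ᗮ) : (inner ℂ f (R f)).re ≤ (s + c)⁻¹ * ‖f‖ ^ 2 := by
  set μ := (s + c)⁻¹ with hμ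
  have hμ0 : 0 < μ := inv_pos.mpr hs
  set E := fun ν : ℂ => Module.End.eigenspace R.toLinearMap ν with hE
  have hsymm := h.isPositive.isSymmetric
  have horth : ∀ ν ν', ν ≠ ν' → ∀ x ∈ E ν, ∀ y ∈ E ν', inner ℂ x y = 0 :=
    fun ν ν' hne x hx y hy => hsymm.orthogonalFamily_eigenspaces hne ⟨x, hx⟩ ⟨y, hy⟩
  have hreal : ∀ ν, ∀ x ∈ E ν, x ≠ 0 → (ν.re : ℂ) = ν := fun ν x hx hx0 =>
    Complex.conj_eq_iff_re.mp (hsymm.conj_eigenvalue_eq_self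
      (Module.End.hasEigenvalue_of_hasEigenvector ⟨hx, hx0⟩))
  set G : Submodule ℂ H := ⨆ ν : {ν : ℂ // ν.re < μ}, E ν with hG
  -- eigenvectors of `R` to eigenvalues `≥ μ` lie in `lowSpace T s`
  have hlow : ∀ ν : ℂ, ¬ ν.re < μ → E ν ≤ lowSpace T s := by
    intro ν hν x hx
    by_cases hx0 : x = 0
    · rw [hx0]; exact zero_mem _
    have hr := hreal ν x hx hx0
    have hν0 : 0 < ν.re := hμ0.trans_le (not_lt.mp hν)
    have hle : ν.re⁻¹ - c ≤ s := by
      have := inv_anti₀ hμ0 (not_lt.mp hν)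
      rw [hμ, inv_inv] at this
      linarith
    refine Submodule.mem_iSup_of_mem ⟨ν.re⁻¹ - c, hle⟩ ?_
    have e : (((ν.re⁻¹ - c : ℝ) : ℂ) + c) = (ν.re : ℂ)⁻¹ := by push_cast; ring
    rw [h.mem_eigenspace_iff, e, inv_smul_eq_iff₀ (by exact_mod_cast hν0.ne'), hr]
    exact Module.End.mem_eigenspace_iff.mp hx
  have hfG : f ∈ G.topologicalClosure := by
    have : CompleteSpace G.topologicalClosure := G.isClosed_topologicalClosure.completeSpace_coe
    rw [← Submodule.starProjection_eq_self_iff, eq_comm, ← sub_eq_zero]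
    set g := G.topologicalClosure.starProjection f with hg
    have hgG : g ∈ G.topologicalClosure := Submodule.starProjection_apply_mem _ f
    have hbot := orthogonalComplement_iSup_eigenspaces_eq_bot hc hsymm
    rw [← Submodule.mem_bot ℂ, ← hbot, ← Submodule.iInf_orthogonal, Submodule.mem_iInf]
    intro ν
    by_cases hν : ν.re < μ
    · have hle : E ν ≤ G.topologicalClosure :=
        (le_iSup (fun ν : {ν : ℂ // ν.re < μ} => E ν) ⟨ν, hν⟩).trans G.le_topologicalClosure
      exact Submodule.orthogonal_le hle (Submodule.sub_starProjection_mem_orthogonal f)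
    · refine sub_mem (Submodule.orthogonal_le (hlow ν hν) hf) ?_
      have : G.topologicalClosure ≤ (E ν)ᗮ := by
        refine G.topologicalClosure_minimal (iSup_le fun ν' x hx => ?_) (Submodule.isClosed_orthogonal _)
        rw [Submodule.mem_orthogonal]
        exact fun y hy => horth _ _ (fun e => hν (by rw [e]; exact ν'.2)) y hy x hx
      exact this hgG
  have hclosed : IsClosed {x : H | (inner ℂ x (R x)).re ≤ μ * ‖x‖ ^ 2} := by
    refine isClosed_le ?_ (by fun_prop)
    exact Complex.continuous_re.comp (continuous_id.inner R.continuous)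
  refine closure_minimal (fun x hx => ?_) hclosed hfG
  obtain ⟨w, hw, rfl⟩ := (Submodule.mem_iSup_iff_exists_finsupp _ _).mp hx
  have e : R (w.sum fun _ x => x) = ∑ i ∈ w.support, (((i : ℂ).re : ℝ) : ℂ) • w i := by
    rw [Finsupp.sum, map_sum]
    refine Finset.sum_congr rfl fun i _ => ?_
    by_cases h0 : w i = 0
    · simp [h0]
    · rw [hreal _ _ (hw i) h0]
      exact Module.End.mem_eigenspace_iff.mp (hw i)
  rw [Set.mem_ofPred_eq, e]
  exact re_inner_sum_smul_le w.support (fun i => w i)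
    (fun i _ j _ hij => horth _ _ (fun e => hij (Subtype.ext e)) _ (hw i) _ (hw j)) _ μ
    fun i _ _ => i.2.le

theorem exists_ne_zero_mem_orthogonal {n : ℕ} {v : Fin (n + 1) → H} (hv : LinearIndependent ℂ v)
    (E : Submodule ℂ H) [FiniteDimensional ℂ E] (hE : Module.finrank ℂ E ≤ n) :
    ∃ f ∈ Submodule.span ℂ (Set.range v), f ≠ 0 ∧ f ∈ Eᗮ := by
  set F := Submodule.span ℂ (Set.range v) with hF
  have : FiniteDimensional ℂ F := FiniteDimensional.span_of_finite ℂ (Set.finite_range v)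
  have hdim : Module.finrank ℂ E < Module.finrank ℂ F := by
    rw [hF, finrank_span_eq_card hv, Fintype.card_fin]
    omega
  have hker := LinearMap.ker_ne_bot_of_finrank_lt
    (f := E.orthogonalProjectionOnto.toLinearMap ∘ₗ F.subtype) hdim
  obtain ⟨x, hx, hx0⟩ := Submodule.exists_mem_ne_zero_of_ne_bot hker
  refine ⟨x, x.2, by simpa using hx0, ?_⟩
  rw [← Submodule.orthogonalProjectionOnto_eq_zero_iff]
  exact hx

/-- A spanning set of which no `n + 1` elements are linearly independent spans a space of dimension
at most `n`. -/
theorem finrank_span_le_of_forall_not_linearIndependent {n : ℕ} (U : Set H)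
    (hU : ∀ w : Fin (n + 1) → H, (∀ i, w i ∈ U) → ¬ LinearIndependent ℂ w) :
    FiniteDimensional ℂ (Submodule.span ℂ U) ∧ Module.finrank ℂ (Submodule.span ℂ U) ≤ n := by
  obtain ⟨b, hbU, hspan, hb⟩ := exists_linearIndependent ℂ U
  have hcard : b.encard ≤ n := by
    by_contra! hlt
    have h2 : ((n + 1 : ℕ) : ℕ∞) ≤ b.encard := by
      push_cast
      exact Order.add_one_le_of_lt hlt
    obtain ⟨t, htb, htc⟩ := Set.exists_subset_encard_eq h2
    have htf : t.Finite := Set.finite_of_encard_eq_coe htc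
    have : Fintype t := htf.fintype
    have hc : Fintype.card t = n + 1 := by
      rw [Set.encard_eq_coe_toFinset_card, Nat.cast_inj, Set.toFinset_card] at htc
      exact htc
    have e := (Fintype.equivFinOfCardEq hc).symm
    refine hU (fun i => (e i : H)) (fun i => hbU (htb (e i).2)) ?_
    exact (LinearIndepOn.mono (v := id) hb htb).linearIndependent.comp _ e.injective
  have hbf : b.Finite := Set.finite_of_encard_le_coe hcard
  rw [← hspan]
  refine ⟨FiniteDimensional.span_of_finite ℂ hbf, ?_⟩
  have : Fintype b := hbf.fintype
  rw [finrank_span_set_eq_card hb]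
  rw [Set.encard_eq_coe_toFinset_card] at hcard
  exact_mod_cast hcard

/-- The max-min principle for the compact operator `R`, stated for `T`: an `(n + 1)`-dimensional space
on which the form of `R` exceeds `(t + c)⁻¹` forces `n + 1` eigenvalues of `T` up to `t`. -/
theorem exists_linearIndependent_eigenvectors {T : H →ₗ.[ℂ] H} {c : ℝ} {R : H →L[ℂ] H}
    (h : IsResolventAt T c R) (hc : IsCompactOperator R) {t : ℝ} (ht : 0 < t + c) {n : ℕ}
    {v : Fin (n + 1) → H} (hv : LinearIndependent ℂ v)
    (hlow : ∀ f ∈ Submodule.span ℂ (Set.range v), f ≠ 0 →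
      (t + c)⁻¹ * ‖f‖ ^ 2 < (inner ℂ f (R f)).re) :
    ∃ w : Fin (n + 1) → H, LinearIndependent ℂ w ∧
      ∀ i, ∃ s : ℝ, s ≤ t ∧ w i ∈ eigenspace T (s : ℂ) := by
  by_contra hcon
  push Not at hcon
  have hU := finrank_span_le_of_forall_not_linearIndependent (n := n)
    {x : H | ∃ s : ℝ, s ≤ t ∧ x ∈ eigenspace T (s : ℂ)} fun w hw hli => by
      obtain ⟨i, hi⟩ := hcon w hli
      obtain ⟨s, hs, hs'⟩ := hw i
      exact hi s hs hs'
  have hle : lowSpace T t ≤ Submodule.span ℂ {x : H | ∃ s : ℝ, s ≤ t ∧ x ∈ eigenspace T (s : ℂ)} :=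
    iSup_le fun s x hx => Submodule.subset_span ⟨s, s.2, hx⟩
  have := hU.1
  obtain ⟨f, hf, hf0, hfo⟩ := exists_ne_zero_mem_orthogonal hv _ hU.2
  exact absurd (hlow f hf hf0) (not_lt.mpr
    (re_inner_le_of_mem_orthogonal_lowSpace h hc ht (Submodule.orthogonal_le hle hfo)))

section perturbed

variable {J : K →L[ℂ] H} {β : K →L[ℂ] H'} {C α : ℝ}
variable (h : ∀ u, ‖β u‖ ^ 2 ≤ α * (‖u‖ ^ 2 - ‖J u‖ ^ 2) + C * ‖J u‖ ^ 2) (hα0 : 0 ≤ α)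
  (hα1 : α < 1)
include h hα0 hα1

/-- Positivity of the perturbed form at `u - s W⁻¹ J† η`. -/
theorem two_mul_re_inner_sub_le (u : K) (η : H) (s : ℝ) :
    2 * s * (inner ℂ (J u) η).re - s ^ 2 * (inner ℂ η (perturbedResolvent J β C η)).re
      ≤ (inner ℂ u (perturbedGram J β C u)).re := by
  obtain ⟨y, hy, hy'⟩ := exists_perturbedResolvent_eq h hα0 hα1 η
  have h0 : 0 ≤ (inner ℂ (u - (s : ℂ) • y) (perturbedGram J β C (u - (s : ℂ) • y))).re := by
    refine le_trans ?_ (le_re_inner_perturbedGram h hα0 _)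
    have : 0 ≤ 1 - α := by linarith
    positivity
  have e1 : inner ℂ u (perturbedGram J β C y) = inner ℂ (J u) η := by
    rw [hy', adjoint_inner_right]
  have e2 : inner ℂ y (perturbedGram J β C u) = conj (inner ℂ (J u) η) := by
    rw [← inner_perturbedGram_comm, hy', adjoint_inner_left, inner_conj_symm]
  have e3 : inner ℂ y (perturbedGram J β C y) = inner ℂ (perturbedResolvent J β C η) η := by
    rw [hy', adjoint_inner_right, hy]
  have e4 : inner ℂ (perturbedResolvent J β C η) η = inner ℂ η (perturbedResolvent J β C η) :=
    (isPositive_perturbedResolvent h hα0 hα1).inner_left_eq_inner_right η η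
  rw [map_sub, map_smul, inner_sub_left, inner_sub_right, inner_sub_right, inner_smul_left,
    inner_smul_left, inner_smul_right, inner_smul_right, e1, e2, e3, e4, Complex.conj_ofReal] at h0
  simp only [Complex.sub_re, Complex.re_ofReal_mul, Complex.conj_re] at h0
  nlinarith

/-- The variational lower bound for the resolvent: if the form at `u` is at most `m ‖J u‖²`, then
`⟨J u, R (J u)⟩ ≥ m⁻¹ ‖J u‖²`. -/
theorem le_re_inner_perturbedResolvent {m : ℝ} (hm : 0 < m) (u : K)
    (hu : (inner ℂ u (perturbedGram J β C u)).re ≤ m * ‖J u‖ ^ 2) :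
    m⁻¹ * ‖J u‖ ^ 2 ≤ (inner ℂ (J u) (perturbedResolvent J β C (J u))).re := by
  have := two_mul_re_inner_sub_le h hα0 hα1 u (J u) m
  rw [← RCLike.re_eq_complex_re, inner_self_eq_norm_sq, RCLike.re_eq_complex_re] at this
  have h2 : m * ‖J u‖ ^ 2 ≤ m * (m * (inner ℂ (J u) (perturbedResolvent J β C (J u))).re) := by
    nlinarith
  rw [inv_mul_le_iff₀ hm]
  exact le_of_mul_le_mul_left h2 hm

end perturbed

end Variational

/-! ### Square summable functions and multiplication operators -/

section SquareSummable

variable {V I : Type*}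

/-- The complex Hilbert space `ℓ²(V)`. -/
abbrev L2 (V : Type*) := lp (fun _ : V => ℂ) 2

theorem memℓp_two_of_sum_le {f : V → ℂ} {C : ℝ} (h : ∀ s : Finset V, ∑ x ∈ s, ‖f x‖ ^ 2 ≤ C) :
    Memℓp f 2 :=
  memℓp_gen' (C := C) (by simpa using h)

theorem L2.sum_le (φ : L2 V) (s : Finset V) : ∑ x ∈ s, ‖φ x‖ ^ 2 ≤ ‖φ‖ ^ 2 := by
  simpa using lp.sum_rpow_le_norm_rpow (p := 2) (by norm_num) φ s

theorem L2.norm_sq_le {φ : L2 V} {C : ℝ} (h : ∀ s : Finset V, ∑ x ∈ s, ‖φ x‖ ^ 2 ≤ C) :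
    ‖φ‖ ^ 2 ≤ C := by
  have hC : 0 ≤ C := by simpa using h ∅
  have := lp.norm_le_of_forall_sum_le (p := 2) (f := φ) (C := √C) (by norm_num)
    (Real.sqrt_nonneg C) (by simpa [Real.sq_sqrt hC] using h)
  calc ‖φ‖ ^ 2 ≤ √C ^ 2 := by gcongr
    _ = C := Real.sq_sqrt hC

theorem L2.continuous_coe : Continuous fun φ : L2 V => (φ : V → ℂ) :=
  (lp.uniformContinuous_coe (p := 2)).continuous

theorem L2.continuous_apply (x : V) : Continuous fun φ : L2 V => φ x :=
  (_root_.continuous_apply x).comp L2.continuous_coe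

theorem L2.tendsto_cofinite (φ : L2 V) : Filter.Tendsto (fun x => ‖φ x‖) Filter.cofinite (𝓝 0) := by
  have h := (lp.memℓp φ).summable (by norm_num)
  have h2 := h.tendsto_cofinite_zero
  simp only [ENNReal.toReal_ofNat, Real.rpow_ofNat] at h2
  have := h2.sqrt
  simpa using this

open Classical in
/-- The unit vector of `ℓ²(V)` at `x`. -/
def delta (x : V) : L2 V := lp.single 2 x (1 : ℂ)

theorem delta_apply [DecidableEq V] (x y : V) : delta x y = if y = x then 1 else 0 := by
  classical
  simp only [delta, lp.single_apply, Pi.single_apply]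
  congr

theorem inner_delta_left (x : V) (φ : L2 V) : inner ℂ (delta x) φ = φ x := by
  classical
  rw [delta, lp.inner_single_left]
  simp

theorem orthonormal_delta : Orthonormal ℂ (delta : V → L2 V) := by
  classical
  rw [orthonormal_iff_ite]
  intro x y
  rw [inner_delta_left, delta_apply]

theorem norm_delta (x : V) : ‖delta x‖ = 1 := orthonormal_delta.1 x

/-- The embedding of the finitely supported functions into `ℓ²(V)`. -/
def toL2 : (V →₀ ℂ) →ₗ[ℂ] L2 V := Finsupp.linearCombination ℂ delta

@[simp] theorem toL2_apply (f : V →₀ ℂ) (x : V) : toL2 f x = f x := by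
  classical
  rw [toL2, Finsupp.linearCombination_apply, Finsupp.sum, lp.coeFn_sum, Finset.sum_apply]
  simp only [lp.coeFn_smul, Pi.smul_apply, delta_apply, smul_eq_mul, mul_ite, mul_one, mul_zero]
  rw [Finset.sum_ite_eq]
  split_ifs with h
  · rfl
  · simpa [eq_comm] using h

theorem toL2_single (x : V) : toL2 (Finsupp.single x 1) = delta x := by
  simp [toL2, Finsupp.linearCombination_single]

theorem normSq_eq (f : V →₀ ℂ) : normSq f = ‖toL2 f‖ ^ 2 := by
  apply le_antisymm
  · have := L2.sum_le (toL2 f) f.support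
    simpa [normSq] using this
  · refine L2.norm_sq_le fun s => ?_
    classical
    have h1 : ∑ x ∈ s, ‖toL2 f x‖ ^ 2 ≤ ∑ x ∈ s ∪ f.support, ‖toL2 f x‖ ^ 2 :=
      Finset.sum_le_sum_of_subset_of_nonneg Finset.subset_union_left fun _ _ _ => by positivity
    refine h1.trans (le_of_eq ?_)
    rw [normSq]
    simp only [toL2_apply]
    refine (Finset.sum_subset Finset.subset_union_right fun x _ hx => ?_).symm
    simp [Finsupp.notMem_support_iff.mp hx]

/-- The operator from `ℓ²(V)` to `ℓ²(I)` with maximal domain that acts as `L`; for `I = V` it is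
`maxOp L` by definition. -/
def maximalOp (L : (V → ℂ) →ₗ[ℂ] (I → ℂ)) : L2 V →ₗ.[ℂ] L2 I where
  domain :=
    { carrier := {φ | Memℓp (L (φ : V → ℂ)) 2}
      add_mem' := by
        intro φ ψ hφ hψ
        simp only [Set.mem_ofPred_eq, lp.coeFn_add, map_add] at *
        exact hφ.add hψ
      zero_mem' := by
        simp only [Set.mem_ofPred_eq, lp.coeFn_zero, map_zero]
        exact zero_memℓp
      smul_mem' := by
        intro c φ hφ
        simp only [Set.mem_ofPred_eq, lp.coeFn_smul, map_smul] at *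
        exact hφ.const_smul c }
  toFun :=
    { toFun := fun φ => ⟨L ((φ : L2 V) : V → ℂ), φ.2⟩
      map_add' := by
        intro φ ψ
        ext1
        exact map_add L _ _
      map_smul' := by
        intro c φ
        ext1
        exact map_smul L c _ }

theorem mem_graph_maximalOp {L : (V → ℂ) →ₗ[ℂ] (I → ℂ)} {φ : L2 V} {η : L2 I} :
    (φ, η) ∈ (maximalOp L).graph ↔ (η : I → ℂ) = L φ := by
  rw [LinearPMap.mem_graph_iff]
  constructor
  · rintro ⟨x, rfl, rfl⟩
    rfl
  · intro h
    have hm : Memℓp (L φ) 2 := h ▸ lp.memℓp η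
    exact ⟨⟨φ, hm⟩, rfl, lp.ext h.symm⟩

theorem mem_graph_maxOp {L : (V → ℂ) →ₗ[ℂ] (V → ℂ)} {φ η : L2 V} :
    (φ, η) ∈ (maxOp L).graph ↔ (η : V → ℂ) = L φ := mem_graph_maximalOp

theorem mem_domain_maximalOp {L : (V → ℂ) →ₗ[ℂ] (I → ℂ)} {φ : L2 V} :
    φ ∈ (maximalOp L).domain ↔ Memℓp (L φ) 2 := Iff.rfl

theorem isClosed_maximalOp {L : (V → ℂ) →ₗ[ℂ] (I → ℂ)} (hL : Continuous L) :
    (maximalOp L).IsClosed := by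
  have : ((maximalOp L).graph : Set (L2 V × L2 I)) = {p | (p.2 : I → ℂ) = L p.1} := by
    ext p
    exact mem_graph_maximalOp
  rw [LinearPMap.IsClosed, this]
  exact isClosed_eq (L2.continuous_coe.comp continuous_snd)
    (hL.comp (L2.continuous_coe.comp continuous_fst))

variable {K : Type*} [NormedAddCommGroup K] [InnerProductSpace ℂ K] [CompleteSpace K]

/-- By the closed graph theorem, multiplication by a function after a bounded operator is bounded
as soon as it is everywhere defined. -/
theorem exists_mul_comp (J : K →L[ℂ] L2 V) (w : V → ℝ)
    (h : ∀ u, Memℓp (fun x => (w x : ℂ) * J u x) 2) :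
    ∃ β : K →L[ℂ] L2 V, ∀ u x, β u x = w x * J u x := by
  set g : K →ₗ[ℂ] L2 V :=
    { toFun := fun u => ⟨fun x => (w x : ℂ) * J u x, h u⟩
      map_add' := fun u v => by
        refine lp.ext (funext fun x => ?_)
        change (w x : ℂ) * J (u + v) x = w x * J u x + w x * J v x
        rw [map_add, lp.coeFn_add, Pi.add_apply, mul_add]
      map_smul' := fun c u => by
        refine lp.ext (funext fun x => ?_)
        change (w x : ℂ) * J (c • u) x = c * (w x * J u x)
        rw [map_smul, lp.coeFn_smul, Pi.smul_apply, smul_eq_mul, mul_left_comm] } with hg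
  have hgx : ∀ u x, g u x = w x * J u x := fun _ _ => rfl
  have hcl : IsClosed (g.graph : Set (K × L2 V)) := by
    have : (g.graph : Set (K × L2 V)) = ⋂ x, {p | p.2 x = w x * J p.1 x} := by
      ext ⟨u, φ⟩
      simp only [SetLike.mem_coe, LinearMap.mem_graph_iff, Set.mem_iInter, Set.mem_ofPred_eq]
      constructor
      · rintro rfl x
        exact hgx u x
      · intro hx
        exact lp.ext (funext hx)
    rw [this]
    refine isClosed_iInter fun x => isClosed_eq ?_ ?_
    · exact (L2.continuous_apply x).comp continuous_snd
    · exact continuous_const.mul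
        ((L2.continuous_apply x).comp (J.continuous.comp continuous_fst))
  exact ⟨⟨g, LinearMap.continuous_of_isClosed_graph g hcl⟩, hgx⟩

theorem memℓp_mul_of_bounded {w : V → ℝ} {C : ℝ} (hw : ∀ x, |w x| ≤ C) (φ : L2 V) :
    Memℓp (fun x => (w x : ℂ) * φ x) 2 := by
  refine memℓp_two_of_sum_le (C := C ^ 2 * ‖φ‖ ^ 2) fun s => ?_
  calc ∑ x ∈ s, ‖(w x : ℂ) * φ x‖ ^ 2 ≤ ∑ x ∈ s, C ^ 2 * ‖φ x‖ ^ 2 := by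
        refine Finset.sum_le_sum fun x _ => ?_
        rw [norm_mul, mul_pow, Complex.norm_real, Real.norm_eq_abs]
        have := hw x
        gcongr
    _ = C ^ 2 * ∑ x ∈ s, ‖φ x‖ ^ 2 := (Finset.mul_sum _ _ _).symm
    _ ≤ _ := by gcongr; exact L2.sum_le φ s

open Classical in
/-- Multiplication by a bounded real function on `ℓ²(V)`; `0` if the function is unbounded. -/
def mulCLM (w : V → ℝ) : L2 V →L[ℂ] L2 V :=
  if h : ∃ C, ∀ x, |w x| ≤ C then
    (exists_mul_comp (ContinuousLinearMap.id ℂ (L2 V)) w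
      fun φ => memℓp_mul_of_bounded h.choose_spec φ).choose
  else 0

theorem mulCLM_apply {w : V → ℝ} {C : ℝ} (hw : ∀ x, |w x| ≤ C) (φ : L2 V) (x : V) :
    mulCLM w φ x = w x * φ x := by
  have h : ∃ C, ∀ x, |w x| ≤ C := ⟨C, hw⟩
  rw [mulCLM, dif_pos h]
  exact (exists_mul_comp (ContinuousLinearMap.id ℂ (L2 V)) w
    fun φ => memℓp_mul_of_bounded h.choose_spec φ).choose_spec φ x

theorem norm_mulCLM_le {w : V → ℝ} {C : ℝ} (hC : 0 ≤ C) (hw : ∀ x, |w x| ≤ C) :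
    ‖mulCLM w‖ ≤ C := by
  refine ContinuousLinearMap.opNorm_le_bound _ hC fun φ => ?_
  refine le_of_sq_le_sq ?_ (by positivity)
  refine L2.norm_sq_le fun s => ?_
  calc ∑ x ∈ s, ‖mulCLM w φ x‖ ^ 2 ≤ ∑ x ∈ s, C ^ 2 * ‖φ x‖ ^ 2 := by
        refine Finset.sum_le_sum fun x _ => ?_
        rw [mulCLM_apply hw, norm_mul, mul_pow, Complex.norm_real, Real.norm_eq_abs]
        have := hw x
        gcongr
    _ = C ^ 2 * ∑ x ∈ s, ‖φ x‖ ^ 2 := (Finset.mul_sum _ _ _).symm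
    _ ≤ C ^ 2 * ‖φ‖ ^ 2 := by gcongr; exact L2.sum_le φ s
    _ = _ := by ring

open ContinuousLinearMap

theorem adjoint_mulCLM {w : V → ℝ} {C : ℝ} (hw : ∀ x, |w x| ≤ C) :
    adjoint (mulCLM w) = mulCLM w := by
  refine ContinuousLinearMap.ext fun φ => ext_inner_left ℂ fun ψ => ?_
  rw [adjoint_inner_right, lp.inner_eq_tsum, lp.inner_eq_tsum]
  refine tsum_congr fun x => ?_
  rw [mulCLM_apply hw, mulCLM_apply hw]
  simp only [RCLike.inner_apply, map_mul, Complex.conj_ofReal]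
  ring

theorem isCompactOperator_mulCLM {w : V → ℝ} {C : ℝ} (hw : ∀ x, |w x| ≤ C)
    (h0 : ∀ ε > 0, {x | ε ≤ |w x|}.Finite) : IsCompactOperator (mulCLM w) := by
  classical
  have hclosed := isClosed_setOfPred_isCompactOperator (σ₁₂ := RingHom.id ℂ) (M₁ := L2 V)
    (M₂ := L2 V)
  change mulCLM w ∈ {f : L2 V →L[ℂ] L2 V | IsCompactOperator f}
  rw [← hclosed.closure_eq, Metric.mem_closure_iff]
  intro ε hε
  set F := (h0 (ε / 2) (by positivity)).toFinset with hF
  have hFm : ∀ x, x ∈ F ↔ ε / 2 ≤ |w x| := fun x => by simp [hF]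
  set w1 : V → ℝ := fun x => if x ∈ F then w x else 0 with hw1
  set w2 : V → ℝ := fun x => if x ∈ F then 0 else w x with hw2
  have hw1b : ∀ x, |w1 x| ≤ C := fun x => by
    by_cases hx : x ∈ F
    · simpa [hw1, hx] using hw x
    · simpa [hw1, hx] using (abs_nonneg _).trans (hw x)
  have hw2b : ∀ x, |w2 x| ≤ ε / 2 := fun x => by
    by_cases hx : x ∈ F
    · simpa [hw2, hx] using (by positivity : 0 ≤ ε / 2)
    · simpa [hw2, hx] using (lt_of_not_ge ((hFm x).not.mp hx)).le
  refine ⟨mulCLM w1, ?_, ?_⟩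
  · have : FiniteDimensional ℂ (Submodule.span ℂ ((F.image delta : Finset (L2 V)) : Set (L2 V))) :=
      FiniteDimensional.span_finset ℂ _
    refine isCompactOperator_of_mem_finiteDimensional
      (Submodule.span ℂ ((F.image delta : Finset (L2 V)) : Set (L2 V))) fun φ => ?_
    have e : mulCLM w1 φ = ∑ x ∈ F, ((w x : ℂ) * φ x) • delta x := by
      refine lp.ext (funext fun y => ?_)
      rw [mulCLM_apply hw1b, lp.coeFn_sum, Finset.sum_apply]
      simp only [lp.coeFn_smul, Pi.smul_apply, delta_apply, smul_eq_mul, mul_ite, mul_one,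
        mul_zero, Finset.sum_ite_eq, hw1]
      split_ifs <;> simp
    rw [e]
    refine Submodule.sum_mem _ fun x hx => Submodule.smul_mem _ _ (Submodule.subset_span ?_)
    simpa using ⟨x, hx, rfl⟩
  · have e : mulCLM w - mulCLM w1 = mulCLM w2 := by
      refine ContinuousLinearMap.ext fun φ => lp.ext (funext fun x => ?_)
      rw [sub_apply, lp.coeFn_sub, Pi.sub_apply, mulCLM_apply hw, mulCLM_apply hw1b,
        mulCLM_apply hw2b]
      simp only [hw1, hw2]
      split_ifs <;> simp
    rw [dist_eq_norm, e]
    exact (norm_mulCLM_le (by positivity) hw2b).trans_lt (by linarith)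

section mulOp

variable {g : V → ℝ} {c : ℝ} (hg : ∀ x, 1 ≤ g x + c)
include hg

theorem abs_inv_sqrt_le (x : V) : |(√(g x + c))⁻¹| ≤ 1 := by
  rw [abs_of_nonneg (by positivity)]
  refine inv_le_one_of_one_le₀ ?_
  rw [Real.one_le_sqrt]
  exact hg x

theorem mulCLM_inv_sqrt_comp (φ : L2 V) (x : V) :
    (mulCLM (fun x => (√(g x + c))⁻¹) ∘L adjoint (mulCLM fun x => (√(g x + c))⁻¹)) φ x
      = ((g x + c)⁻¹ : ℝ) * φ x := by
  have h0 : 0 ≤ g x + c := zero_le_one.trans (hg x)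
  rw [adjoint_mulCLM (abs_inv_sqrt_le hg), comp_apply, mulCLM_apply (abs_inv_sqrt_le hg),
    mulCLM_apply (abs_inv_sqrt_le hg), ← mul_assoc, ← Complex.ofReal_mul, ← mul_inv,
    Real.mul_self_sqrt h0]

/-- The resolvent of a multiplication operator, factorized through its form domain. -/
theorem isResolventAt_mulOp :
    IsResolventAt (mulOp g) c
      (mulCLM (fun x => (√(g x + c))⁻¹) ∘L adjoint (mulCLM fun x => (√(g x + c))⁻¹)) where
  isPositive := isPositive_self_comp_adjoint _
  mem_graph_iff φ η := by
    have h0 : ∀ x, (((g x + c : ℝ)) : ℂ) ≠ 0 := fun x => by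
      have := hg x
      exact_mod_cast (by linarith : 0 < g x + c).ne'
    rw [mulOp, mem_graph_maxOp]
    constructor
    · intro h
      refine lp.ext (funext fun x => ?_)
      rw [mulCLM_inv_sqrt_comp hg, Complex.ofReal_inv, inv_mul_eq_iff_eq_mul₀ (h0 x)]
      rw [lp.coeFn_add, lp.coeFn_smul, Pi.add_apply, h]
      simp [mulFun, add_mul]
    · intro h
      refine funext fun x => ?_
      have := congrArg (fun ψ : L2 V => ψ x) h
      simp only at this
      rw [mulCLM_inv_sqrt_comp hg, Complex.ofReal_inv, inv_mul_eq_iff_eq_mul₀ (h0 x),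
        lp.coeFn_add, lp.coeFn_smul, Pi.add_apply] at this
      simp only [Pi.smul_apply, smul_eq_mul, Complex.ofReal_add, add_mul] at this
      exact add_right_cancel this

theorem mulCLM_inv_sqrt_injective : Function.Injective (mulCLM fun x => (√(g x + c))⁻¹) := by
  rw [injective_iff_map_eq_zero]
  intro φ h
  refine lp.ext (funext fun x => ?_)
  have := congrArg (fun ψ : L2 V => ψ x) h
  simp only [mulCLM_apply (abs_inv_sqrt_le hg)] at this
  have h0 : 0 < √(g x + c) := Real.sqrt_pos.mpr (by linarith [hg x])
  simpa [h0.ne'] using this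

theorem mem_range_mulCLM_inv_sqrt (φ : L2 V) :
    φ ∈ Set.range (mulCLM fun x => (√(g x + c))⁻¹) ↔
      Memℓp (fun x => ((√(g x + c) : ℝ) : ℂ) * φ x) 2 := by
  have h0 : ∀ x, ((√(g x + c) : ℝ) : ℂ) ≠ 0 := fun x => by
    exact_mod_cast (Real.sqrt_pos.mpr (by linarith [hg x] : 0 < g x + c)).ne'
  constructor
  · rintro ⟨ψ, rfl⟩
    have : (fun x => ((√(g x + c) : ℝ) : ℂ) * mulCLM (fun x => (√(g x + c))⁻¹) ψ x) = ψ := by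
      funext x
      rw [mulCLM_apply (abs_inv_sqrt_le hg), Complex.ofReal_inv, mul_inv_cancel_left₀ (h0 x)]
    rw [this]
    exact lp.memℓp ψ
  · intro h
    refine ⟨⟨_, h⟩, lp.ext (funext fun x => ?_)⟩
    rw [mulCLM_apply (abs_inv_sqrt_le hg), Complex.ofReal_inv]
    exact inv_mul_cancel_left₀ (h0 x) _

theorem mem_formDomain_mulOp (φ : L2 V) :
    φ ∈ formDomain (mulOp g) ↔ Memℓp (fun x => ((√(g x + c) : ℝ) : ℂ) * φ x) 2 := by
  rw [mem_formDomain_iff (isResolventAt_mulOp hg) zero_le_one zero_le_one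
    (J := mulCLM fun x => (√(g x + c))⁻¹) (fun η => ?_) (fun η => ?_),
    mem_range_mulCLM_inv_sqrt hg]
  · rw [one_mul, norm_adjoint_sq]
  · rw [one_mul, norm_adjoint_sq]

end mulOp

theorem mulCLM_inv_sqrt_comp_le_one {b : V → ℝ} (hb : ∀ x, 0 ≤ b x) :
    mulCLM (fun x => (√(b x + 1))⁻¹) ∘L adjoint (mulCLM fun x => (√(b x + 1))⁻¹) ≤ 1 := by
  have hg : ∀ x, 1 ≤ b x + 1 := fun x => by linarith [hb x]
  exact comp_adjoint_le_one (norm_mulCLM_le zero_le_one (abs_inv_sqrt_le hg))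

/-- The square root of the multiplication operator by `b ≥ 0` is, as a form, multiplication
by `√b`. -/
theorem mulOp_opSqrt {b : V → ℝ} (hb : ∀ x, 0 ≤ b x) (J : K →L[ℂ] L2 V) (β : K →L[ℂ] L2 V)
    (hβ : ∀ u x, β u x = √(b x) * J u x) :
    ∃ h : ∀ u, J u ∈ (opSqrt (mulOp b)).domain, ∀ u v,
      inner ℂ (opSqrt (mulOp b) ⟨J u, h u⟩) (opSqrt (mulOp b) ⟨J v, h v⟩)
        = inner ℂ (β u) (β v) := by
  have hg : ∀ x, 1 ≤ b x + 1 := fun x => by linarith [hb x]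
  have hres := isResolventAt_mulOp hg
  have hle := mulCLM_inv_sqrt_comp_le_one hb
  have hinj := mulCLM_inv_sqrt_injective hg
  set A := mulCLM fun x => (√(b x + 1))⁻¹ with hA
  have hmem : ∀ u, J u ∈ Set.range A := fun u => by
    rw [mem_range_mulCLM_inv_sqrt hg]
    refine memℓp_two_of_sum_le (C := ‖β u‖ ^ 2 + ‖J u‖ ^ 2) fun s => ?_
    calc ∑ x ∈ s, ‖((√(b x + 1) : ℝ) : ℂ) * J u x‖ ^ 2
        = ∑ x ∈ s, ‖β u x‖ ^ 2 + ∑ x ∈ s, ‖J u x‖ ^ 2 := by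
          rw [← Finset.sum_add_distrib]
          refine Finset.sum_congr rfl fun x _ => ?_
          rw [hβ, norm_mul, norm_mul, mul_pow, mul_pow, Complex.norm_real, Complex.norm_real,
            Real.norm_eq_abs, Real.norm_eq_abs, sq_abs, sq_abs, Real.sq_sqrt (hb x),
            Real.sq_sqrt (by linarith [hb x])]
          ring
      _ ≤ _ := add_le_add (L2.sum_le _ s) (L2.sum_le _ s)
  refine ⟨fun u => (mem_domain_opSqrt_iff hres hle hinj _).mpr (hmem u), fun u v => ?_⟩
  obtain ⟨u', hu'⟩ := hmem u
  obtain ⟨v', hv'⟩ := hmem v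
  rw [inner_opSqrt hres hle hinj u' v' hu' hv', sub_eq_iff_eq_add]
  have hx : ∀ x, ((√(b x + 1) : ℝ) : ℂ) * ((√(b x + 1) : ℝ) : ℂ) = b x + 1 := fun x => by
    rw [← Complex.ofReal_mul, Real.mul_self_sqrt (by linarith [hb x])]
    push_cast
    rfl
  have hx0 : ∀ x, ((√(b x + 1) : ℝ) : ℂ) ≠ 0 := fun x => by
    exact_mod_cast (Real.sqrt_pos.mpr (by linarith [hb x] : 0 < b x + 1)).ne'
  have hb2 : ∀ x, ((√(b x) : ℝ) : ℂ) * ((√(b x) : ℝ) : ℂ) = b x := fun x => by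
    rw [← Complex.ofReal_mul, Real.mul_self_sqrt (hb x)]
  have hval : ∀ (u' : L2 V) (u : K), A u' = J u → ∀ x, u' x = (√(b x + 1) : ℝ) * J u x := by
    intro u' u h x
    rw [← h, hA, mulCLM_apply (abs_inv_sqrt_le hg), Complex.ofReal_inv,
      mul_inv_cancel_left₀ (hx0 x)]
  refine (lp.hasSum_inner (𝕜 := ℂ) (G := fun _ : V => ℂ) u' v').unique ?_
  have := (lp.hasSum_inner (𝕜 := ℂ) (G := fun _ : V => ℂ) (β u) (β v)).add
    (lp.hasSum_inner (𝕜 := ℂ) (G := fun _ : V => ℂ) (J u) (J v))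
  convert this using 2 with x
  rw [hval u' u hu' x, hval v' v hv' x, hβ, hβ]
  simp only [RCLike.inner_apply, map_mul, Complex.conj_ofReal]
  linear_combination (J v x * conj (J u x)) * hx x - (J v x * conj (J u x)) * hb2 x

end SquareSummable

/-! ### The gradient form and the selfadjointness of `Δ + p` -/

section FreeOperator

variable {V : Type*} (G : SimpleGraph V) [G.LocallyFinite]

open ContinuousLinearMap

theorem schrodingerFun_apply (q : V → ℝ) (f : V → ℂ) (x : V) :
    schrodingerFun G q f x = (degAdd G q x : ℂ) * f x - ∑ y ∈ G.neighborFinset x, f y := by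
  simp only [schrodingerFun, LinearMap.coe_mk, AddHom.coe_mk, Finset.sum_sub_distrib,
    Finset.sum_const, SimpleGraph.card_neighborFinset_eq_degree, degAdd]
  push_cast
  rw [nsmul_eq_mul]
  ring

open Classical in
/-- The weighted gradient: on the diagonal it is multiplication by `√p`, on an edge the difference
quotient with the factor `1 / √2` that makes up for the two orientations of the edge. Its square
is the form of `Δ + p`. -/
def gradFun (p : V → ℝ) : (V → ℂ) →ₗ[ℂ] (V × V → ℂ) where
  toFun f := fun e => if e.1 = e.2 then (√(p e.1) : ℂ) * f e.1
    else if G.Adj e.1 e.2 then ((√2)⁻¹ : ℝ) * (f e.1 - f e.2) else 0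
  map_add' f h := by
    ext e
    simp only [Pi.add_apply]
    split_ifs <;> ring
  map_smul' c f := by
    ext e
    simp only [Pi.smul_apply, smul_eq_mul, RingHom.id_apply]
    split_ifs <;> ring

variable {G} {p : V → ℝ}

theorem gradFun_diag (f : V → ℂ) (x : V) : gradFun G p f (x, x) = √(p x) * f x := by
  simp [gradFun]

theorem gradFun_adj (f : V → ℂ) {x y : V} (h : G.Adj x y) :
    gradFun G p f (x, y) = ((√2)⁻¹ : ℝ) * (f x - f y) := by
  simp [gradFun, h, h.ne]

theorem continuous_gradFun : Continuous (gradFun G p) := by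
  classical
  refine continuous_pi fun e => ?_
  simp only [gradFun, LinearMap.coe_mk, AddHom.coe_mk]
  split_ifs <;> fun_prop

variable (G p)

/-- The gradient as a closed operator from `ℓ²(V)` to `ℓ²(V × V)` with maximal domain. -/
def gradOp : L2 V →ₗ.[ℂ] L2 (V × V) := maximalOp (gradFun G p)

instance : CompleteSpace (graphSpace (gradOp G p)) :=
  completeSpace_graphSpace (isClosed_maximalOp continuous_gradFun)

variable {G p}

theorem graphSnd_gradOp (u : graphSpace (gradOp G p)) :
    (graphSnd (gradOp G p) u : V × V → ℂ) = gradFun G p (graphFst (gradOp G p) u) :=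
  mem_graph_maximalOp.mp (graph_fst_snd u)

open Classical in
/-- The pairs on which the gradient of a function supported at `x` can be nonzero. -/
def starPairs (G : SimpleGraph V) [G.LocallyFinite] (x : V) : Finset (V × V) :=
  insert (x, x) ((G.neighborFinset x).image (fun y => (x, y)) ∪
    (G.neighborFinset x).image fun y => (y, x))

theorem sum_starPairs {M : Type*} [AddCommMonoid M] (F : V × V → M) (x : V) :
    ∑ e ∈ starPairs G x, F e
      = F (x, x) + ∑ y ∈ G.neighborFinset x, F (x, y) + ∑ y ∈ G.neighborFinset x, F (y, x) := by
  classical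
  have hne : ∀ y ∈ G.neighborFinset x, y ≠ x := fun y hy => by
    rw [SimpleGraph.mem_neighborFinset] at hy
    exact hy.ne'
  rw [starPairs, Finset.sum_insert, Finset.sum_union, Finset.sum_image, Finset.sum_image, add_assoc]
  · intro a _ b _ h
    exact congrArg Prod.fst h
  · intro a _ b _ h
    exact congrArg Prod.snd h
  · rw [Finset.disjoint_left]
    rintro _ h1 h2
    obtain ⟨a, ha, rfl⟩ := Finset.mem_image.mp h1
    obtain ⟨b, hb, e⟩ := Finset.mem_image.mp h2
    exact hne b hb (congrArg Prod.fst e)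
  · intro h
    rcases Finset.mem_union.mp h with h | h
    · obtain ⟨a, ha, e⟩ := Finset.mem_image.mp h
      exact hne a ha (congrArg Prod.snd e)
    · obtain ⟨a, ha, e⟩ := Finset.mem_image.mp h
      exact hne a ha (congrArg Prod.fst e)

theorem gradFun_delta_eq_zero {x : V} {e : V × V} (he : e ∉ starPairs G x) :
    gradFun G p (delta x) e = 0 := by
  classical
  obtain ⟨a, b⟩ := e
  simp only [starPairs, Finset.mem_insert, Finset.mem_union, Finset.mem_image,
    SimpleGraph.mem_neighborFinset, Prod.mk.injEq, not_or, not_exists, not_and] at he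
  obtain ⟨h1, h2, h3⟩ := he
  simp only [gradFun, LinearMap.coe_mk, AddHom.coe_mk, delta_apply]
  by_cases hab : a = b
  · subst hab
    have : a ≠ x := fun e => h1 e e
    rw [if_pos rfl, if_neg this, mul_zero]
  · rw [if_neg hab]
    by_cases h4 : G.Adj a b
    · have ha : a ≠ x := by
        rintro rfl
        exact h2 b h4 rfl rfl
      have hb : b ≠ x := by
        rintro rfl
        exact h3 a h4.symm rfl rfl
      rw [if_pos h4, if_neg ha, if_neg hb, sub_zero, mul_zero]
    · rw [if_neg h4]

theorem memℓp_gradFun_delta (x : V) : Memℓp (gradFun G p (delta x)) 2 := by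
  refine Memℓp.of_exponent_ge (memℓp_zero ?_) (zero_le (a := (2 : ENNReal)))
  refine (starPairs G x).finite_toSet.subset fun e he => ?_
  by_contra h
  exact he (gradFun_delta_eq_zero h)

variable (G p) in
/-- The unit vector at `x` as an element of the form domain. -/
def liftDelta (x : V) : graphSpace (gradOp G p) :=
  graphMk (φ := delta x) (η := ⟨_, memℓp_gradFun_delta x⟩) (mem_graph_maximalOp.mpr rfl)

theorem graphFst_liftDelta (x : V) : graphFst (gradOp G p) (liftDelta G p x) = delta x := rfl

theorem graphSnd_liftDelta (x : V) (e : V × V) :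
    graphSnd (gradOp G p) (liftDelta G p x) e = gradFun G p (delta x) e := rfl

variable (G p) in
/-- The embedding of the finitely supported functions into the form domain. -/
def lift : (V →₀ ℂ) →ₗ[ℂ] graphSpace (gradOp G p) := Finsupp.linearCombination ℂ (liftDelta G p)

@[simp] theorem graphFst_lift (f : V →₀ ℂ) : graphFst (gradOp G p) (lift G p f) = toL2 f := by
  rw [lift, toL2, Finsupp.linearCombination_apply, Finsupp.linearCombination_apply, Finsupp.sum,
    map_sum]
  simp only [map_smul]
  rfl

theorem lift_single (x : V) : lift G p (Finsupp.single x 1) = liftDelta G p x := by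
  simp [lift, Finsupp.linearCombination_single]

/-- Green's formula: pairing with the unit vector at `x` in the form domain evaluates
`(Δ + p + 1) u` at `x`. -/
theorem inner_liftDelta (hp : ∀ x, 0 ≤ p x) (x : V) (u : graphSpace (gradOp G p)) :
    inner ℂ (liftDelta G p x) u = graphFst (gradOp G p) u x
      + schrodingerFun G p (graphFst (gradOp G p) u) x := by
  classical
  have h2 : ((√2)⁻¹ : ℂ) * ((√2)⁻¹ : ℂ) = 1 / 2 := by
    rw [← mul_inv, ← Complex.ofReal_mul, Real.mul_self_sqrt (by norm_num)]
    norm_num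
  have hpp : ((√(p x) : ℝ) : ℂ) * (√(p x) : ℝ) = p x := by
    rw [← Complex.ofReal_mul, Real.mul_self_sqrt (hp x)]
  rw [inner_graphSpace, graphFst_liftDelta, inner_delta_left, lp.inner_eq_tsum]
  congr 1
  set φ := graphFst (gradOp G p) u with hφ
  have hsum : ∀ e ∉ starPairs G x, inner ℂ (gradFun G p (delta x) e)
      (graphSnd (gradOp G p) u e) = 0 := fun e he => by
    rw [gradFun_delta_eq_zero he, inner_zero_left]
  simp only [graphSnd_liftDelta]
  rw [tsum_eq_sum hsum, sum_starPairs, graphSnd_gradOp]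
  have e1 : inner ℂ (gradFun G p (delta x) (x, x)) (gradFun G p φ (x, x)) = p x * φ x := by
    rw [gradFun_diag, gradFun_diag, delta_apply, if_pos rfl]
    simp only [RCLike.inner_apply, Complex.conj_ofReal, mul_one]
    linear_combination φ x * hpp
  have e2 : ∀ y ∈ G.neighborFinset x,
      inner ℂ (gradFun G p (delta x) (x, y)) (gradFun G p φ (x, y)) = 1 / 2 * (φ x - φ y) := by
    intro y hy
    rw [SimpleGraph.mem_neighborFinset] at hy
    rw [gradFun_adj _ hy, gradFun_adj _ hy, delta_apply, delta_apply, if_pos rfl, if_neg hy.ne']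
    simp only [RCLike.inner_apply, Complex.conj_ofReal, sub_zero, mul_one]
    push_cast
    linear_combination (φ x - φ y) * h2
  have e3 : ∀ y ∈ G.neighborFinset x,
      inner ℂ (gradFun G p (delta x) (y, x)) (gradFun G p φ (y, x)) = 1 / 2 * (φ x - φ y) := by
    intro y hy
    rw [SimpleGraph.mem_neighborFinset] at hy
    rw [gradFun_adj _ hy.symm, gradFun_adj _ hy.symm, delta_apply, delta_apply, if_pos rfl,
      if_neg hy.ne']
    simp only [RCLike.inner_apply, Complex.conj_ofReal, zero_sub, map_neg, mul_neg, mul_one]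
    push_cast
    linear_combination (φ x - φ y) * h2
  rw [e1, Finset.sum_congr rfl e2, Finset.sum_congr rfl e3, ← Finset.mul_sum]
  simp only [schrodingerFun, LinearMap.coe_mk, AddHom.coe_mk]
  ring

/-- Solutions of `(Δ + p + 1) φ = 0` in `ℓ²(V)` vanish: `|φ|` attains its maximum, and there the
equation gives `(deg + p + 1) |φ| ≤ deg |φ|`. -/
theorem eq_zero_of_schrodingerFun_add_eq_zero (hp : ∀ x, 0 ≤ p x) (φ : L2 V)
    (h : ∀ x, φ x + schrodingerFun G p φ x = 0) : φ = 0 := by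
  by_contra hne
  obtain ⟨x₀, hx₀⟩ : ∃ x, φ x ≠ 0 := by
    by_contra! hall
    exact hne (lp.ext (funext hall))
  have hfin : {x | ‖φ x₀‖ ≤ ‖φ x‖}.Finite := by
    have := (L2.tendsto_cofinite φ).eventually (gt_mem_nhds (norm_pos_iff.mpr hx₀))
    rw [Filter.eventually_cofinite] at this
    simpa using this
  obtain ⟨x, hx, hmax⟩ := hfin.exists_maximalFor (fun x => ‖φ x‖) _ ⟨x₀, (le_rfl : ‖φ x₀‖ ≤ ‖φ x₀‖)⟩
  have hmax' : ∀ y, ‖φ y‖ ≤ ‖φ x‖ := fun y => by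
    rcases le_total (‖φ x‖) (‖φ y‖) with h1 | h1
    · exact hmax (le_trans hx h1 : ‖φ x₀‖ ≤ ‖φ y‖) h1
    · exact h1
  have hpos : 0 < ‖φ x‖ := (norm_pos_iff.mpr hx₀).trans_le hx
  have e := h x
  rw [schrodingerFun_apply] at e
  have e2 : ((degAdd G p x + 1 : ℝ) : ℂ) * φ x = ∑ y ∈ G.neighborFinset x, φ y := by
    push_cast
    linear_combination e
  have h3 : (degAdd G p x + 1) * ‖φ x‖ ≤ G.degree x * ‖φ x‖ := by
    have h0 : 0 ≤ degAdd G p x + 1 := by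
      have := hp x
      rw [degAdd]
      positivity
    calc (degAdd G p x + 1) * ‖φ x‖ = ‖((degAdd G p x + 1 : ℝ) : ℂ) * φ x‖ := by
          rw [norm_mul, Complex.norm_real, Real.norm_of_nonneg h0]
      _ ≤ ∑ y ∈ G.neighborFinset x, ‖φ y‖ := by rw [e2]; exact norm_sum_le _ _
      _ ≤ ∑ _y ∈ G.neighborFinset x, ‖φ x‖ := Finset.sum_le_sum fun y _ => hmax' y
      _ = _ := by simp
  have := hp x
  rw [degAdd] at h3
  nlinarith

/-- The finitely supported functions are dense in the maximal form domain: by Green's formula, a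
vector orthogonal to them solves `(Δ + p + 1) u = 0`. -/
theorem dense_range_lift (hp : ∀ x, 0 ≤ p x) : DenseRange (lift G p) := by
  have : (LinearMap.range (lift G p)).topologicalClosure = ⊤ := by
    rw [Submodule.topologicalClosure_eq_top_iff, Submodule.eq_bot_iff]
    intro u hu
    apply graphFst_injective (N := gradOp G p)
    rw [map_zero]
    refine eq_zero_of_schrodingerFun_add_eq_zero (G := G) hp _ fun x => ?_
    rw [← inner_liftDelta hp, ← lift_single]
    exact (Submodule.mem_orthogonal _ u).mp hu _ ⟨_, rfl⟩
  have h2 := Submodule.dense_iff_topologicalClosure_eq_top.mpr this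
  exact h2

variable (G p) in
theorem dense_range_graphFst : Dense (Set.range (graphFst (gradOp G p))) := by
  have : (LinearMap.range (graphFst (gradOp G p)).toLinearMap).topologicalClosure = ⊤ := by
    rw [Submodule.topologicalClosure_eq_top_iff, Submodule.eq_bot_iff]
    intro φ hφ
    refine lp.ext (funext fun x => ?_)
    have h := (Submodule.mem_orthogonal _ φ).mp hφ (delta x) ⟨liftDelta G p x, rfl⟩
    rwa [inner_delta_left] at h
  exact Submodule.dense_iff_topologicalClosure_eq_top.mpr this

/-- The maximal operator `Δ + p` with `p ≥ 0` is the selfadjoint operator of the gradient form. -/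
theorem isResolventAt_maxOp (hp : ∀ x, 0 ≤ p x) :
    IsResolventAt (maxOp (schrodingerFun G p)) 1
      (graphFst (gradOp G p) ∘L adjoint (graphFst (gradOp G p))) where
  isPositive := isPositive_self_comp_adjoint _
  mem_graph_iff φ η := by
    rw [mem_graph_maxOp, Complex.ofReal_one, one_smul, comp_apply]
    generalize hu : adjoint (graphFst (gradOp G p)) (η + φ) = u
    generalize hA : graphFst (gradOp G p) u = A
    have key : ∀ x, η x + φ x = A x + schrodingerFun G p A x := fun x => by
      rw [← hA, ← inner_liftDelta hp, ← hu, adjoint_inner_right, graphFst_liftDelta,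
        inner_delta_left]
      rfl
    constructor
    · intro h
      rw [← sub_eq_zero]
      refine eq_zero_of_schrodingerFun_add_eq_zero (G := G) hp _ fun x => ?_
      have e : (A - φ) x = A x - φ x := rfl
      have e2 : schrodingerFun G p (A - φ : L2 V) x
          = schrodingerFun G p A x - schrodingerFun G p φ x := by
        rw [lp.coeFn_sub, map_sub]
        rfl
      rw [e, e2, ← congrFun h x]
      linear_combination -(key x)
    · intro h
      funext x
      have := key x
      rw [h, add_comm] at this
      exact (add_left_cancel this)

theorem quadForm_eq_sum_of_subset {L : (V → ℂ) →ₗ[ℂ] (V → ℂ)} {f : V →₀ ℂ} {s : Finset V}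
    (hs : f.support ⊆ s) : quadForm L f = ∑ x ∈ s, (conj (f x) * L f x).re := by
  rw [quadForm]
  refine Finset.sum_subset hs fun x _ hx => ?_
  simp [Finsupp.notMem_support_iff.mp hx]

/-- On finitely supported functions the graph norm of the gradient is the form of `Δ + p + 1`. -/
theorem norm_sq_lift (hp : ∀ x, 0 ≤ p x) (f : V →₀ ℂ) :
    ‖lift G p f‖ ^ 2 = quadForm (schrodingerFun G p) f + normSq f := by
  have e : (toL2 f : V → ℂ) = f := funext fun y => toL2_apply f y
  rw [norm_sq_eq_re_inner (𝕜 := ℂ)]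
  conv_lhs =>
    enter [2, 2]
    rw [lift, Finsupp.linearCombination_apply, Finsupp.sum]
  rw [sum_inner, map_sum, quadForm, normSq, ← Finset.sum_add_distrib]
  refine Finset.sum_congr rfl fun x _ => ?_
  rw [inner_smul_left, inner_liftDelta hp, graphFst_lift, mul_add, map_add, e, add_comm]
  congr 1
  rw [RCLike.conj_mul]
  norm_cast

theorem quadForm_mulFun (g : V → ℝ) (f : V →₀ ℂ) :
    quadForm (mulFun g) f = ∑ x ∈ f.support, g x * ‖f x‖ ^ 2 := by
  refine Finset.sum_congr rfl fun x _ => ?_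
  simp only [mulFun, LinearMap.coe_mk, AddHom.coe_mk]
  rw [mul_left_comm, Complex.re_ofReal_mul, RCLike.conj_mul]
  norm_cast

theorem qPos_nonneg (q : V → ℝ) (x : V) : 0 ≤ qPos q x := le_max_right _ _

theorem qNeg_nonneg (q : V → ℝ) (x : V) : 0 ≤ qNeg q x := le_max_right _ _

theorem qPos_sub_qNeg (q : V → ℝ) (x : V) : qPos q x - qNeg q x = q x := by
  rw [qPos, qNeg]
  rcases le_total 0 (q x) with h | h
  · rw [max_eq_left h, max_eq_right (by linarith)]; ring
  · rw [max_eq_right h, max_eq_left (by linarith)]; ring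

theorem quadForm_schrodingerFun_eq (q : V → ℝ) (f : V →₀ ℂ) :
    quadForm (schrodingerFun G q) f
      = quadForm (schrodingerFun G (qPos q)) f - quadForm (mulFun (qNeg q)) f := by
  rw [quadForm, quadForm, quadForm, ← Finset.sum_sub_distrib]
  refine Finset.sum_congr rfl fun x _ => ?_
  rw [← Complex.sub_re, ← mul_sub]
  congr 2
  simp only [schrodingerFun, mulFun, LinearMap.coe_mk, AddHom.coe_mk]
  rw [← qPos_sub_qNeg q x]
  push_cast
  ring

/-- The form of `Δ + q` in terms of `deg + q` and the adjacency form. -/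
theorem quadForm_schrodingerFun_eq_sub_adj (q : V → ℝ) (f : V →₀ ℂ) :
    quadForm (schrodingerFun G q) f = quadForm (mulFun (degAdd G q)) f
      - ∑ x ∈ f.support, ∑ y ∈ G.neighborFinset x, (conj (f x) * f y).re := by
  rw [quadForm, quadForm, ← Finset.sum_sub_distrib]
  refine Finset.sum_congr rfl fun x _ => ?_
  rw [schrodingerFun_apply, mul_sub, Complex.sub_re, Finset.mul_sum, Complex.re_sum]
  rfl

/-- An inequality between forms extends from the finitely supported functions to the whole form
domain. -/
theorem sum_mul_norm_sq_le_of_lift (hp : ∀ x, 0 ≤ p x) {w : V → ℝ} (hw : ∀ x, 0 ≤ w x)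
    {Φ : graphSpace (gradOp G p) → ℝ} (hΦ : Continuous Φ)
    (h : ∀ f : V →₀ ℂ, quadForm (mulFun w) f ≤ Φ (lift G p f)) (u : graphSpace (gradOp G p))
    (s : Finset V) : ∑ x ∈ s, w x * ‖graphFst (gradOp G p) u x‖ ^ 2 ≤ Φ u := by
  classical
  have hcl : IsClosed {u : graphSpace (gradOp G p) |
      ∑ x ∈ s, w x * ‖graphFst (gradOp G p) u x‖ ^ 2 ≤ Φ u} := by
    refine isClosed_le (continuous_finsetSum _ fun x _ => continuous_const.mul ?_) hΦ
    exact (((L2.continuous_apply x).comp (graphFst (gradOp G p)).continuous).norm.pow 2)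
  refine (dense_range_lift hp).induction_on (p := fun u =>
    ∑ x ∈ s, w x * ‖graphFst (gradOp G p) u x‖ ^ 2 ≤ Φ u) u hcl fun f => ?_
  refine le_trans ?_ (h f)
  rw [quadForm_mulFun]
  simp only [graphFst_lift, toL2_apply]
  calc ∑ x ∈ s, w x * ‖f x‖ ^ 2 ≤ ∑ x ∈ s ∪ f.support, w x * ‖f x‖ ^ 2 :=
        Finset.sum_le_sum_of_subset_of_nonneg Finset.subset_union_left fun x _ _ =>
          mul_nonneg (hw x) (sq_nonneg _)
    _ = ∑ x ∈ f.support, w x * ‖f x‖ ^ 2 := by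
        refine (Finset.sum_subset Finset.subset_union_right fun x _ hx => ?_).symm
        simp [Finsupp.notMem_support_iff.mp hx]

end FreeOperator

/-! ### Sparseness and form inequalities -/

section Sparseness

variable {V : Type*} {G : SimpleGraph V} [G.LocallyFinite] {q : V → ℝ}

open Classical in
theorem two_mul_edgeCount (W : Finset V) :
    2 * edgeCount G W = ∑ x ∈ W, (((G.neighborFinset x).filter fun y => y ∈ W).card : ℝ) := by
  rw [edgeCount, mul_div_cancel₀ _ two_ne_zero, Finset.card_filter, Finset.sum_product]
  push_cast
  refine Finset.sum_congr rfl fun x _ => ?_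
  rw [Finset.card_filter]
  push_cast
  rw [← Finset.sum_filter, ← Finset.sum_filter]
  refine Finset.sum_congr ?_ fun _ _ => rfl
  ext y
  simp [and_comm]

open Classical in
theorem two_mul_edgeCount_add_boundaryCount (W : Finset V) :
    2 * edgeCount G W + boundaryCount G W = ∑ x ∈ W, (G.degree x : ℝ) := by
  rw [two_mul_edgeCount, boundaryCount, ← Finset.sum_add_distrib]
  refine Finset.sum_congr rfl fun x _ => ?_
  rw [← Nat.cast_add, Finset.card_filter_add_card_filter_not,
    SimpleGraph.card_neighborFinset_eq_degree]

/-- The functional version of sparseness, with `a (∑ (h(x) - h(y))₊ + ∑ q₊ h)` in place of the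
boundary term. All terms are additive under the layer cake decomposition of `h`; the induction
removes the bottom layer `t 1_X`, where `t` is the minimum of `h` on `X`. -/
theorem IsSparse.sum_min_le {a k : ℝ} (hS : IsSparse G q a k) (X : Finset V) :
    ∀ h : V → ℝ, (∀ x, 0 ≤ h x) → (∀ x ∉ X, h x = 0) →
    ∑ x ∈ X, ∑ y ∈ G.neighborFinset x, min (h x) (h y) ≤ k * ∑ x ∈ X, h x
      + a * (∑ x ∈ X, ∑ y ∈ G.neighborFinset x, max (h x - h y) 0 + ∑ x ∈ X, qPos q x * h x) := by
  classical
  induction X using Finset.strongInduction with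
  | H X ih =>
  intro h h0 hX
  rcases X.eq_empty_or_nonempty with rfl | hne
  · simp
  -- `h - t` on `X` vanishes at `x₀`, so the induction hypothesis applies to `X` without `x₀`
  obtain ⟨x₀, hx₀, hmin⟩ := X.exists_min_image h hne
  set t := h x₀ with ht
  set h' : V → ℝ := fun x => if x ∈ X then h x - t else 0 with hh'
  have hin : ∀ x ∈ X, h' x = h x - t := fun x hx => if_pos hx
  have hout : ∀ x ∉ X, h' x = 0 := fun x hx => if_neg hx
  have h'0 : ∀ x, 0 ≤ h' x := fun x => by
    by_cases hx : x ∈ X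
    · rw [hin x hx]
      linarith [hmin x hx]
    · rw [hout x hx]
  have h'x₀ : h' x₀ = 0 := by rw [hin x₀ hx₀, sub_self]
  have key := ih (X.erase x₀) (Finset.erase_ssubset hx₀) h' h'0 fun x hx => by
    by_cases hxX : x ∈ X
    · by_cases e : x = x₀
      · rw [e, h'x₀]
      · exact absurd (Finset.mem_erase.mpr ⟨e, hxX⟩) hx
    · exact hout x hxX
  rw [Finset.sum_erase, Finset.sum_erase, Finset.sum_erase, Finset.sum_erase] at key
  · have hs := hS X
    have ht0 : 0 ≤ t := h0 x₀
    have e1 : ∑ x ∈ X, ∑ y ∈ G.neighborFinset x, min (h x) (h y)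
        = t * (2 * edgeCount G X) + ∑ x ∈ X, ∑ y ∈ G.neighborFinset x, min (h' x) (h' y) := by
      rw [two_mul_edgeCount, Finset.mul_sum, ← Finset.sum_add_distrib]
      refine Finset.sum_congr rfl fun x hx => ?_
      rw [Finset.card_filter]
      push_cast
      rw [Finset.mul_sum, ← Finset.sum_add_distrib]
      refine Finset.sum_congr rfl fun y _ => ?_
      by_cases hy : y ∈ X
      · rw [if_pos hy, hin x hx, hin y hy, min_sub_sub_right]
        ring
      · rw [if_neg hy, hX y hy, hout y hy, min_eq_right (h0 x), min_eq_right (h'0 x)]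
        ring
    have e2 : ∑ x ∈ X, ∑ y ∈ G.neighborFinset x, max (h x - h y) 0
        = t * boundaryCount G X + ∑ x ∈ X, ∑ y ∈ G.neighborFinset x, max (h' x - h' y) 0 := by
      rw [boundaryCount, Finset.mul_sum, ← Finset.sum_add_distrib]
      refine Finset.sum_congr rfl fun x hx => ?_
      rw [Finset.card_filter]
      push_cast
      rw [Finset.mul_sum, ← Finset.sum_add_distrib]
      refine Finset.sum_congr rfl fun y _ => ?_
      by_cases hy : y ∈ X
      · rw [if_neg (not_not.mpr hy), hin x hx, hin y hy, sub_sub_sub_cancel_right]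
        ring
      · have := h'0 x
        rw [if_pos hy, hX y hy, hout y hy, sub_zero, sub_zero, max_eq_left (h0 x),
          max_eq_left (h'0 x), hin x hx]
        ring
    have e3 : ∑ x ∈ X, h x = t * X.card + ∑ x ∈ X, h' x := by
      rw [Finset.sum_congr rfl hin, Finset.sum_sub_distrib, Finset.sum_const, nsmul_eq_mul]
      ring
    have e4 : ∑ x ∈ X, qPos q x * h x = t * ∑ x ∈ X, qPos q x + ∑ x ∈ X, qPos q x * h' x := by
      rw [Finset.mul_sum, ← Finset.sum_add_distrib]
      refine Finset.sum_congr rfl fun x hx => ?_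
      rw [hin x hx]
      ring
    rw [e1, e2, e3, e4]
    nlinarith [mul_le_mul_of_nonneg_left hs ht0]
  · rw [h'x₀, mul_zero]
  · refine Finset.sum_eq_zero fun y _ => ?_
    rw [h'x₀, max_eq_right (by linarith [h'0 y])]
  · exact h'x₀
  · refine Finset.sum_eq_zero fun y _ => ?_
    rw [h'x₀, min_eq_left (h'0 y)]

theorem sum_norm_gradFun_sq_le {p : V → ℝ} (hp : ∀ x, 0 ≤ p x) (f : V →₀ ℂ)
    (F : Finset (V × V)) :
    ∑ e ∈ F, ‖gradFun G p f e‖ ^ 2 ≤ quadForm (schrodingerFun G p) f := by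
  have e : (toL2 f : V → ℂ) = f := funext fun y => toL2_apply f y
  have h := L2.sum_le (graphSnd (gradOp G p) (lift G p f)) F
  have h2 := norm_sq_graphSpace (lift G p f)
  rw [norm_sq_lift hp, graphFst_lift, ← normSq_eq] at h2
  rw [graphSnd_gradOp, graphFst_lift, e] at h
  linarith

/-- The part of the gradient on the diagonal and on the oriented edges that start in `S`. -/
theorem sum_add_half_sum_le {p : V → ℝ} (hp : ∀ x, 0 ≤ p x) (f : V →₀ ℂ) (S : Finset V) :
    ∑ x ∈ S, p x * ‖f x‖ ^ 2 + 1 / 2 * ∑ x ∈ S, ∑ y ∈ G.neighborFinset x, ‖f x - f y‖ ^ 2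
      ≤ quadForm (schrodingerFun G p) f := by
  classical
  have hinj : Function.Injective fun e : (_ : V) × V => (e.1, e.2) := by
    rintro ⟨a, b⟩ ⟨c, d⟩ h
    obtain ⟨rfl, rfl⟩ := Prod.mk.inj h
    rfl
  refine le_trans (le_of_eq ?_) (sum_norm_gradFun_sq_le hp f
    ((S.sigma fun x => insert x (G.neighborFinset x)).map ⟨_, hinj⟩))
  rw [Finset.sum_map, Finset.sum_sigma, Finset.mul_sum, ← Finset.sum_add_distrib]
  refine Finset.sum_congr rfl fun x _ => ?_
  rw [Finset.sum_insert (by simp), Finset.mul_sum]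
  congr 1
  · simp only [Function.Embedding.coeFn_mk]
    rw [gradFun_diag, norm_mul, mul_pow, Complex.norm_real, Real.norm_eq_abs, sq_abs,
      Real.sq_sqrt (hp x)]
  · refine Finset.sum_congr rfl fun y hy => ?_
    rw [SimpleGraph.mem_neighborFinset] at hy
    simp only [Function.Embedding.coeFn_mk]
    rw [gradFun_adj _ hy, norm_mul, mul_pow, Complex.norm_real, Real.norm_eq_abs, sq_abs, inv_pow,
      Real.sq_sqrt (by norm_num), one_div]

/-- Sparseness makes the form of `deg + q₊` bounded by the form of `Δ + q₊`: it is applied to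
`h = |f|²`, for which `∑ (h(x) - h(y))₊` is estimated by Cauchy-Schwarz. -/
theorem IsSparse.quadForm_degAdd_le {a k : ℝ} (hS : IsSparse G q a k) (ha : 0 ≤ a)
    (f : V →₀ ℂ) :
    quadForm (mulFun (degAdd G (qPos q))) f
      ≤ 8 * (1 + a) ^ 2 * quadForm (schrodingerFun G (qPos q)) f + 2 * k * normSq f := by
  have hc := hS.sum_min_le f.support (fun x => ‖f x‖ ^ 2) (fun x => sq_nonneg _) fun x hx => by
    simp [Finsupp.notMem_support_iff.mp hx]
  have hE := sum_add_half_sum_le (G := G) (qPos_nonneg q) f f.support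
  rw [quadForm_mulFun, normSq]
  set S := f.support
  set N := ∑ x ∈ S, ‖f x‖ ^ 2
  set P := ∑ x ∈ S, ∑ y ∈ G.neighborFinset x, max (‖f x‖ ^ 2 - ‖f y‖ ^ 2) 0
  set M := ∑ x ∈ S, ∑ y ∈ G.neighborFinset x, min (‖f x‖ ^ 2) (‖f y‖ ^ 2)
  set Q := ∑ x ∈ S, qPos q x * ‖f x‖ ^ 2
  set D := ∑ x ∈ S, ∑ y ∈ G.neighborFinset x, ‖f x - f y‖ ^ 2
  have hdeg : ∑ x ∈ S, (G.degree x : ℝ) * ‖f x‖ ^ 2 = M + P := by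
    rw [← Finset.sum_add_distrib]
    refine Finset.sum_congr rfl fun x _ => ?_
    rw [← Finset.sum_add_distrib, ← SimpleGraph.card_neighborFinset_eq_degree, ← nsmul_eq_mul,
      ← Finset.sum_const]
    refine Finset.sum_congr rfl fun y _ => ?_
    rcases le_total (‖f x‖ ^ 2) (‖f y‖ ^ 2) with h | h
    · rw [min_eq_left h, max_eq_right (by linarith), add_zero]
    · rw [min_eq_right h, max_eq_left (by linarith)]
      ring
  have hsplit : ∑ x ∈ S, degAdd G (qPos q) x * ‖f x‖ ^ 2 = M + P + Q := by
    rw [← hdeg, ← Finset.sum_add_distrib]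
    refine Finset.sum_congr rfl fun x _ => ?_
    rw [degAdd]
    ring
  -- `(h(x) - h(y))₊ ≤ s |f(x) - f(y)|² + h(x) / s` with `s = 2 (1 + a)`, which leaves half of the
  -- degree term to be absorbed
  have hP : (1 + a) * P ≤ 2 * (1 + a) ^ 2 * D + 1 / 2 * (M + P) := by
    rw [← hdeg, Finset.mul_sum, Finset.mul_sum, Finset.mul_sum, ← Finset.sum_add_distrib]
    refine Finset.sum_le_sum fun x _ => ?_
    rw [Finset.mul_sum, Finset.mul_sum, ← SimpleGraph.card_neighborFinset_eq_degree,
      ← nsmul_eq_mul (_ : ℕ), ← Finset.sum_const, Finset.mul_sum, ← Finset.sum_add_distrib]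
    refine Finset.sum_le_sum fun y _ => ?_
    rcases le_total (‖f x‖ ^ 2) (‖f y‖ ^ 2) with h | h
    · rw [max_eq_right (by linarith), mul_zero]
      positivity
    · rw [max_eq_left (by linarith)]
      have hxy : ‖f y‖ ≤ ‖f x‖ := (sq_le_sq₀ (norm_nonneg _) (norm_nonneg _)).mp h
      have hd := norm_sub_norm_le (f x) (f y)
      have h1 : ‖f x‖ ^ 2 - ‖f y‖ ^ 2 ≤ ‖f x - f y‖ * (2 * ‖f x‖) := by
        nlinarith [norm_nonneg (f x), norm_nonneg (f y), norm_nonneg (f x - f y)]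
      have h2 := mul_le_mul_of_nonneg_left h1 (by linarith : 0 ≤ 1 + a)
      nlinarith [sq_nonneg (2 * (1 + a) * ‖f x - f y‖ - ‖f x‖)]
  have hQ : 0 ≤ Q := Finset.sum_nonneg fun x _ => mul_nonneg (qPos_nonneg q x) (sq_nonneg _)
  rw [hsplit]
  have h8 := mul_le_mul_of_nonneg_left hE (by positivity : 0 ≤ 8 * (1 + a) ^ 2)
  nlinarith [mul_nonneg ha hQ, mul_nonneg (mul_nonneg ha ha) hQ]

theorem normSq_nonneg (f : V →₀ ℂ) : 0 ≤ normSq f := Finset.sum_nonneg fun _ _ => sq_nonneg _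

theorem quadForm_degAdd_le_qPos (f : V →₀ ℂ) :
    quadForm (mulFun (degAdd G q)) f ≤ quadForm (mulFun (degAdd G (qPos q))) f := by
  rw [quadForm_mulFun, quadForm_mulFun]
  refine Finset.sum_le_sum fun x _ => mul_le_mul_of_nonneg_right ?_ (sq_nonneg _)
  rw [degAdd, degAdd]
  exact add_le_add_right (le_max_left _ _) _

theorem IsSparse.exists_lowerBound {a k α : ℝ} (hS : IsSparse G q a k) (ha : 0 ≤ a) (hk : 0 ≤ k)
    (hα0 : 0 < α) (hα1 : α < 1) (hq : MemK G α q) :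
    ∃ a k : ℝ, 0 < a ∧ a < 1 ∧ 0 ≤ k ∧ LowerBound G q a k := by
  obtain ⟨C, hC, hq⟩ := hq
  set κ := (1 - α) / (8 * (1 + a) ^ 2) with hκ
  have h8 : 0 < 8 * (1 + a) ^ 2 := by positivity
  have hκ0 : 0 < κ := div_pos (by linarith) h8
  have hκ1 : κ < 1 := by
    rw [hκ, div_lt_one h8]
    nlinarith
  refine ⟨1 - κ, 2 * k * κ + C, by linarith, by linarith, by positivity, fun f => ?_⟩
  have h1 := hS.quadForm_degAdd_le ha f
  have h2 := quadForm_degAdd_le_qPos (G := G) (q := q) f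
  have h3 := mul_le_mul_of_nonneg_left (h2.trans h1) hκ0.le
  have e : κ * (8 * (1 + a) ^ 2) = 1 - α := div_mul_cancel₀ _ h8.ne'
  rw [quadForm_schrodingerFun_eq]
  have h4 := hq f
  have h5 : κ * (8 * (1 + a) ^ 2 * quadForm (schrodingerFun G (qPos q)) f + 2 * k * normSq f)
      = (1 - α) * quadForm (schrodingerFun G (qPos q)) f + 2 * k * κ * normSq f := by
    rw [← e]
    ring
  rw [h5] at h3
  nlinarith

open Classical in
/-- The lower bound for the indicator function of `W` is the sparseness inequality for `W`. -/
theorem LowerBound.isSparse {a k : ℝ} (h : LowerBound G q a k) (ha : 0 ≤ a) (ha1 : a < 1) :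
    IsSparse G q (a / (1 - a)) (k / (1 - a)) := by
  intro W
  have hW := h (Finsupp.indicator W fun _ _ => 1)
  have hs : (Finsupp.indicator W fun _ _ => (1 : ℂ)).support ⊆ W :=
    Finsupp.support_indicator_subset _ _
  have hf : ∀ x, (Finsupp.indicator W fun _ _ => (1 : ℂ)) x = if x ∈ W then 1 else 0 := fun x => by
    simp [Finsupp.indicator_apply]
  have e1 : quadForm (mulFun (degAdd G q)) (Finsupp.indicator W fun _ _ => (1 : ℂ))
      = ∑ x ∈ W, degAdd G q x := by
    rw [quadForm_eq_sum_of_subset hs]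
    refine Finset.sum_congr rfl fun x hx => ?_
    simp [mulFun, hf, hx]
  have e2 : normSq (Finsupp.indicator W fun _ _ => (1 : ℂ)) = W.card := by
    rw [normSq, Finset.sum_subset hs, Finset.card_eq_sum_ones]
    · push_cast
      refine Finset.sum_congr rfl fun x hx => ?_
      simp [hf, hx]
    · intro x _ hx
      simp [Finsupp.notMem_support_iff.mp hx]
  have e3 : quadForm (schrodingerFun G q) (Finsupp.indicator W fun _ _ => (1 : ℂ))
      = ∑ x ∈ W, degAdd G q x - 2 * edgeCount G W := by
    rw [quadForm_eq_sum_of_subset hs, two_mul_edgeCount, ← Finset.sum_sub_distrib]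
    refine Finset.sum_congr rfl fun x hx => ?_
    rw [schrodingerFun_apply]
    simp only [hf, hx, if_true, map_one, one_mul, mul_one, Complex.sub_re, Complex.ofReal_re]
    rw [Finset.card_filter, Complex.re_sum]
    push_cast
    congr 1
    refine Finset.sum_congr rfl fun y _ => ?_
    split_ifs <;> simp
  have e4 : ∑ x ∈ W, degAdd G q x ≤ 2 * edgeCount G W + boundaryCount G W + ∑ x ∈ W, qPos q x := by
    rw [two_mul_edgeCount_add_boundaryCount, ← Finset.sum_add_distrib]
    exact Finset.sum_le_sum fun x _ => add_le_add_right (le_max_left _ _) _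
  rw [e1, e2, e3] at hW
  have h1a : 0 < 1 - a := by linarith
  have e5 : k / (1 - a) * (W.card : ℝ) + a / (1 - a) * (boundaryCount G W + ∑ x ∈ W, qPos q x)
      = (k * W.card + a * (boundaryCount G W + ∑ x ∈ W, qPos q x)) / (1 - a) := by
    ring
  rw [e5, le_div_iff₀ h1a]
  nlinarith [mul_le_mul_of_nonneg_left e4 ha]

/-- The lower bound for `|f|` gives the upper bound for `f`, with the same constants: passing from `f`
to `|f|` does not change the form of `deg + q`, and the adjacency form of `f` is at least the negative
of that of `|f|`. -/
theorem LowerBound.upperBound {a k : ℝ} (h : LowerBound G q a k) : UpperBound G q a k := by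
  intro f
  set f' : V →₀ ℂ := f.mapRange (fun z => (‖z‖ : ℂ)) (by simp) with hf'
  have hf : ∀ x, f' x = ‖f x‖ := fun x => rfl
  have hs : f'.support = f.support := by
    ext x
    simp [hf]
  have h' := h f'
  rw [quadForm_schrodingerFun_eq_sub_adj, quadForm_mulFun, normSq, hs] at h'
  rw [quadForm_schrodingerFun_eq_sub_adj, quadForm_mulFun, normSq]
  simp only [hf, Complex.norm_real, norm_norm] at h'
  have hadj : -∑ x ∈ f.support, ∑ y ∈ G.neighborFinset x, (conj (f x) * f y).re
      ≤ ∑ x ∈ f.support, ∑ y ∈ G.neighborFinset x, (conj (‖f x‖ : ℂ) * (‖f y‖ : ℂ)).re := by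
    rw [← Finset.sum_neg_distrib]
    refine Finset.sum_le_sum fun x _ => ?_
    rw [← Finset.sum_neg_distrib]
    refine Finset.sum_le_sum fun y _ => ?_
    rw [Complex.conj_ofReal, ← Complex.ofReal_mul, Complex.ofReal_re]
    calc -(conj (f x) * f y).re ≤ ‖conj (f x) * f y‖ :=
          (neg_le_abs _).trans (Complex.abs_re_le_norm _)
      _ = _ := by rw [norm_mul, RCLike.norm_conj]
  linarith

end Sparseness

/-! ### The form of `Δ + q` -/

section SchrodingerForm

open ContinuousLinearMap

variable {V : Type*} (G : SimpleGraph V) [G.LocallyFinite] (q : V → ℝ)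

/-- The embedding of the form domain of `Δ + q₊`, with its graph norm, into `ℓ²(V)`. -/
abbrev formEmb : graphSpace (gradOp G (qPos q)) →L[ℂ] L2 V := graphFst (gradOp G (qPos q))

/-- The operator `√q₋` on the form domain of `Δ + q₊`, together with what follows from
`q₋ ≤ α (Δ + q₊) + C` with `C ≥ 0` and `0 < α < 1`; the bound `deg + q + C + 1 ≥ 1` is the case of a
unit vector. -/
structure NegPart (α C : ℝ) where
  toCLM : graphSpace (gradOp G (qPos q)) →L[ℂ] L2 V
  apply : ∀ u x, toCLM u x = √(qNeg q x) * formEmb G q u x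
  bound : ∀ u, ‖toCLM u‖ ^ 2 ≤ α * (‖u‖ ^ 2 - ‖formEmb G q u‖ ^ 2) + C * ‖formEmb G q u‖ ^ 2
  nonneg : 0 ≤ C
  pos : 0 < α
  lt_one : α < 1
  one_le : ∀ x, 1 ≤ degAdd G q x + (C + 1)

variable {G q}

theorem quadForm_mulFun_single (w : V → ℝ) (x : V) :
    quadForm (mulFun w) (Finsupp.single x 1) = w x := by
  rw [quadForm_eq_sum_of_subset (s := {x}) Finsupp.support_single_subset]
  simp [mulFun]

theorem normSq_single (x : V) : normSq (Finsupp.single x 1) = 1 := by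
  rw [normSq, Finset.sum_subset (s₂ := {x}) Finsupp.support_single_subset]
  · simp
  · intro y _ hy
    simp [Finsupp.notMem_support_iff.mp hy]

theorem quadForm_schrodingerFun_single (p : V → ℝ) (x : V) :
    quadForm (schrodingerFun G p) (Finsupp.single x 1) = degAdd G p x := by
  rw [quadForm_eq_sum_of_subset (s := {x}) Finsupp.support_single_subset, Finset.sum_singleton,
    schrodingerFun_apply, Finset.sum_eq_zero]
  · simp
  · intro y hy
    rw [SimpleGraph.mem_neighborFinset] at hy
    exact Finsupp.single_eq_of_ne hy.ne'

theorem norm_sq_eq_quadForm_mulFun {w : V → ℝ} (hw : ∀ x, 0 ≤ w x) {ψ : L2 V} {f : V →₀ ℂ}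
    (h : ∀ x, ψ x = √(w x) * f x) : ‖ψ‖ ^ 2 = quadForm (mulFun w) f := by
  classical
  have e : ∀ x, ‖ψ x‖ ^ 2 = w x * ‖f x‖ ^ 2 := fun x => by
    rw [h, norm_mul, mul_pow, Complex.norm_real, Real.norm_eq_abs, sq_abs, Real.sq_sqrt (hw x)]
  rw [quadForm_mulFun]
  refine le_antisymm (L2.norm_sq_le fun s => ?_) ?_
  · simp only [e]
    calc ∑ x ∈ s, w x * ‖f x‖ ^ 2 ≤ ∑ x ∈ s ∪ f.support, w x * ‖f x‖ ^ 2 :=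
          Finset.sum_le_sum_of_subset_of_nonneg Finset.subset_union_left fun x _ _ =>
            mul_nonneg (hw x) (sq_nonneg _)
      _ = ∑ x ∈ f.support, w x * ‖f x‖ ^ 2 := by
          refine (Finset.sum_subset Finset.subset_union_right fun x _ hx => ?_).symm
          simp [Finsupp.notMem_support_iff.mp hx]
  · have := L2.sum_le ψ f.support
    simpa only [e] using this

/-- The form bound on `q₋` extends to the whole form domain of `Δ + q₊`. -/
theorem MemK.exists_negPart {α : ℝ} (hα0 : 0 < α) (hα1 : α < 1) (hq : MemK G α q) :
    ∃ C, Nonempty (NegPart G q α C) := by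
  obtain ⟨C, hC, hq⟩ := hq
  have hs : ∀ u s, ∑ x ∈ s, qNeg q x * ‖formEmb G q u x‖ ^ 2
      ≤ α * (‖u‖ ^ 2 - ‖formEmb G q u‖ ^ 2) + C * ‖formEmb G q u‖ ^ 2 := by
    refine sum_mul_norm_sq_le_of_lift (qPos_nonneg q) (qNeg_nonneg q) (by fun_prop) fun f => ?_
    rw [norm_sq_lift (qPos_nonneg q), graphFst_lift, ← normSq_eq, add_sub_cancel_right]
    exact hq f
  have hn : ∀ (u : graphSpace (gradOp G (qPos q))) (x : V),
      ‖((√(qNeg q x) : ℝ) : ℂ) * formEmb G q u x‖ ^ 2 = qNeg q x * ‖formEmb G q u x‖ ^ 2 :=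
    fun u x => by
      rw [norm_mul, mul_pow, Complex.norm_real, Real.norm_eq_abs, sq_abs,
        Real.sq_sqrt (qNeg_nonneg q x)]
  obtain ⟨β, hβ⟩ := exists_mul_comp (formEmb G q) (fun x => √(qNeg q x)) fun u =>
    memℓp_two_of_sum_le fun s => by
      simp only [hn]
      exact hs u s
  refine ⟨C, ⟨⟨β, hβ, fun u => L2.norm_sq_le fun s => ?_, hC, hα0, hα1, fun x => ?_⟩⟩⟩
  · simp only [hβ, hn]
    exact hs u s
  · have h := hq (Finsupp.single x 1)
    rw [quadForm_mulFun_single, normSq_single, quadForm_schrodingerFun_single] at h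
    have h2 := qPos_sub_qNeg q x
    have h3 := qPos_nonneg q x
    rw [degAdd] at h ⊢
    have h4 : (0 : ℝ) ≤ G.degree x + qPos q x := by positivity
    nlinarith

theorem quadForm_mulFun_affine (g : V → ℝ) (r c : ℝ) (f : V →₀ ℂ) :
    quadForm (mulFun fun x => r * (g x + c)) f = r * (quadForm (mulFun g) f + c * normSq f) := by
  rw [quadForm_mulFun, quadForm_mulFun, normSq, Finset.mul_sum, ← Finset.sum_add_distrib,
    Finset.mul_sum]
  refine Finset.sum_congr rfl fun x _ => ?_
  ring

namespace NegPart

variable {α C : ℝ} (D : NegPart G q α C)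
include D

/-- The bounded operator on the form domain that represents the form of `Δ + q + C + 1`. -/
abbrev gram : graphSpace (gradOp G (qPos q)) →L[ℂ] graphSpace (gradOp G (qPos q)) :=
  perturbedGram (formEmb G q) D.toCLM C

/-- The resolvent of `Δ + q` at `-(C + 1)`. -/
abbrev resolvent : L2 V →L[ℂ] L2 V := perturbedResolvent (formEmb G q) D.toCLM C

theorem isResolventAt : IsResolventAt (schrodingerOp G q) (C + 1) D.resolvent := by
  have hA := isResolventAt_maxOp (G := G) (qPos_nonneg q)
  have h1 := graphFst_comp_adjoint_le_one (gradOp G (qPos q))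
  have hJ := graphFst_injective (gradOp G (qPos q))
  obtain ⟨hB, hBi⟩ := mulOp_opSqrt (qNeg_nonneg q) (formEmb G q) D.toCLM D.apply
  exact isResolventAt_formSub D.bound D.pos.le D.lt_one hJ (dense_range_graphFst G (qPos q))
    (mem_domain_opSqrt_iff hA h1 hJ) (fun u v hu hv => inner_opSqrt hA h1 hJ u v rfl rfl hu hv)
    hB hBi

/-- The form domain of `Δ + q` is that of `Δ + q₊`. -/
theorem mem_formDomain_iff (φ : L2 V) :
    φ ∈ formDomain (schrodingerOp G q) ↔ φ ∈ Set.range (formEmb G q) := by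
  have h1α : 0 < 1 - α := by linarith [D.lt_one]
  exact SparseForm.mem_formDomain_iff D.isResolventAt (by positivity) (by positivity)
    (norm_adjoint_sq_le_perturbedResolvent D.bound D.pos.le D.lt_one)
    (perturbedResolvent_le_norm_adjoint_sq D.bound D.pos.le D.lt_one) φ

theorem norm_sq_toCLM_lift (f : V →₀ ℂ) :
    ‖D.toCLM (lift G (qPos q) f)‖ ^ 2 = quadForm (mulFun (qNeg q)) f :=
  norm_sq_eq_quadForm_mulFun (qNeg_nonneg q) fun x => by rw [D.apply, graphFst_lift, toL2_apply]

theorem re_inner_gram_lift (f : V →₀ ℂ) :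
    (inner ℂ (lift G (qPos q) f) (D.gram (lift G (qPos q) f))).re
      = quadForm (schrodingerFun G q) f + (C + 1) * normSq f := by
  rw [re_inner_perturbedGram, D.norm_sq_toCLM_lift, graphFst_lift, ← normSq_eq,
    norm_sq_lift (qPos_nonneg q), quadForm_schrodingerFun_eq q]
  ring

theorem re_inner_gram_liftDelta (x : V) :
    (inner ℂ (liftDelta G (qPos q) x) (D.gram (liftDelta G (qPos q) x))).re
      = degAdd G q x + (C + 1) := by
  rw [← lift_single, D.re_inner_gram_lift, quadForm_schrodingerFun_single, normSq_single, mul_one]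

theorem one_sub_mul_quadForm_le (f : V →₀ ℂ) :
    (1 - α) * quadForm (schrodingerFun G (qPos q)) f
      ≤ quadForm (schrodingerFun G q) f + C * normSq f := by
  have h := D.bound (lift G (qPos q) f)
  rw [D.norm_sq_toCLM_lift, norm_sq_lift (qPos_nonneg q), graphFst_lift, ← normSq_eq,
    add_sub_cancel_right] at h
  rw [quadForm_schrodingerFun_eq q]
  linarith

theorem zero_le_degAdd (x : V) : 0 ≤ degAdd G q x + (C + 1) := by linarith [D.one_le x]

/-- The lower bound on the whole form domain. -/
theorem sum_le_of_lowerBound {a k : ℝ} (h : LowerBound G q a k) (ha : a < 1)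
    (u : graphSpace (gradOp G (qPos q))) (s : Finset V) :
    ∑ x ∈ s, (1 - a) * (degAdd G q x + (C + 1)) * ‖formEmb G q u x‖ ^ 2
      ≤ (inner ℂ u (D.gram u)).re + (k - a * (C + 1)) * ‖formEmb G q u‖ ^ 2 := by
  have h1a : 0 ≤ 1 - a := by linarith
  have hcont : Continuous fun u : graphSpace (gradOp G (qPos q)) =>
      (inner ℂ u (D.gram u)).re + (k - a * (C + 1)) * ‖formEmb G q u‖ ^ 2 := by
    have h1 : Continuous fun u : graphSpace (gradOp G (qPos q)) => inner ℂ u (D.gram u) :=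
      continuous_id.inner D.gram.continuous
    exact (Complex.continuous_re.comp h1).add (by fun_prop)
  refine sum_mul_norm_sq_le_of_lift (w := fun x => (1 - a) * (degAdd G q x + (C + 1)))
    (qPos_nonneg q) (fun x => mul_nonneg h1a (D.zero_le_degAdd x)) hcont (fun f => ?_) u s
  rw [quadForm_mulFun_affine, D.re_inner_gram_lift, graphFst_lift, ← normSq_eq]
  linarith [h f]

theorem exists_sqrt_degAdd_comp
    (h : ∀ u, Memℓp (fun x => ((√(degAdd G q x + (C + 1)) : ℝ) : ℂ) * formEmb G q u x) 2) :
    ∃ γ : graphSpace (gradOp G (qPos q)) →L[ℂ] L2 V,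
      ∀ u x, γ u x = √(degAdd G q x + (C + 1)) * formEmb G q u x :=
  exists_mul_comp (formEmb G q) (fun x => √(degAdd G q x + (C + 1))) h

theorem memℓp_sqrt_degAdd {a k : ℝ} (h : LowerBound G q a k) (ha : a < 1)
    (u : graphSpace (gradOp G (qPos q))) :
    Memℓp (fun x => ((√(degAdd G q x + (C + 1)) : ℝ) : ℂ) * formEmb G q u x) 2 := by
  have h1a : 0 < 1 - a := by linarith
  refine memℓp_two_of_sum_le (C := ((inner ℂ u (D.gram u)).re
    + (k - a * (C + 1)) * ‖formEmb G q u‖ ^ 2) / (1 - a)) fun s => ?_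
  rw [le_div_iff₀ h1a]
  refine le_trans (le_of_eq ?_) (D.sum_le_of_lowerBound h ha u s)
  rw [Finset.sum_mul]
  refine Finset.sum_congr rfl fun x _ => ?_
  rw [norm_mul, mul_pow, Complex.norm_real, Real.norm_eq_abs, sq_abs,
    Real.sq_sqrt (D.zero_le_degAdd x)]
  ring

/-- The upper bound puts the form domain of `deg + q` into that of `Δ + q₊`. -/
theorem memℓp_gradFun {a k : ℝ} (h : UpperBound G q a k) (ha : 0 ≤ a) (hk : 0 ≤ k) {φ ψ : L2 V}
    (hψ : ∀ x, ψ x = √(degAdd G q x + (C + 1)) * φ x) : Memℓp (gradFun G (qPos q) φ) 2 := by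
  classical
  have h1α : 0 < 1 - α := by linarith [D.lt_one]
  have hC := D.nonneg
  refine memℓp_two_of_sum_le (C := (1 + a + k + C) * ‖ψ‖ ^ 2 / (1 - α)) fun F => ?_
  -- on finitely many edges the gradient only sees a finitely supported truncation
  set W : Finset V := F.image Prod.fst ∪ F.image Prod.snd with hW
  set f : V →₀ ℂ := Finsupp.indicator W fun x _ => φ x with hf
  have hfW : ∀ x ∈ W, f x = φ x := fun x hx => by simp [hf, Finsupp.indicator_apply, hx]
  have hs : f.support ⊆ W := Finsupp.support_indicator_subset _ _
  have e1 : ∑ e ∈ F, ‖gradFun G (qPos q) φ e‖ ^ 2 = ∑ e ∈ F, ‖gradFun G (qPos q) f e‖ ^ 2 := by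
    refine Finset.sum_congr rfl fun e he => ?_
    have h1 : e.1 ∈ W := Finset.mem_union_left _ (Finset.mem_image_of_mem _ he)
    have h2 : e.2 ∈ W := Finset.mem_union_right _ (Finset.mem_image_of_mem _ he)
    simp only [gradFun, LinearMap.coe_mk, AddHom.coe_mk, hfW _ h1, hfW _ h2]
  have e2 : quadForm (mulFun (degAdd G q)) f + (C + 1) * normSq f ≤ ‖ψ‖ ^ 2 := by
    have := quadForm_mulFun_affine (degAdd G q) 1 (C + 1) f
    rw [one_mul] at this
    rw [← this, quadForm_mulFun]
    refine le_trans (le_of_eq ?_) (L2.sum_le ψ f.support)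
    refine Finset.sum_congr rfl fun x hx => ?_
    rw [hψ, norm_mul, mul_pow, Complex.norm_real, Real.norm_eq_abs, sq_abs,
      Real.sq_sqrt (D.zero_le_degAdd x), hfW x (hs hx), one_mul]
  have e3 : normSq f ≤ quadForm (mulFun (degAdd G q)) f + (C + 1) * normSq f := by
    have := quadForm_mulFun_affine (degAdd G q) 1 (C + 1) f
    rw [one_mul] at this
    rw [← this, quadForm_mulFun, normSq]
    refine Finset.sum_le_sum fun x _ => ?_
    have := D.one_le x
    nlinarith [sq_nonneg ‖f x‖]
  rw [e1, le_div_iff₀ h1α]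
  have h4 := sum_norm_gradFun_sq_le (G := G) (qPos_nonneg q) f F
  have h5 := D.one_sub_mul_quadForm_le f
  have h6 := h f
  have hN := normSq_nonneg f
  nlinarith [mul_le_mul_of_nonneg_right h4 h1α.le, mul_nonneg ha hN, mul_nonneg ha hC,
    mul_nonneg (mul_nonneg ha hC) hN, mul_le_mul_of_nonneg_left e3 hk,
    mul_le_mul_of_nonneg_left e3 hC, mul_le_mul_of_nonneg_left e2 hk,
    mul_le_mul_of_nonneg_left e2 hC, mul_le_mul_of_nonneg_left e2 ha, mul_nonneg hC hN]

theorem formDomain_eq_of_lowerBound {a k : ℝ} (h : LowerBound G q a k) (ha : 0 ≤ a) (ha1 : a < 1)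
    (hk : 0 ≤ k) : formDomain (schrodingerOp G q) = formDomain (mulOp (degAdd G q)) := by
  ext φ
  rw [D.mem_formDomain_iff, mem_formDomain_mulOp D.one_le]
  constructor
  · rintro ⟨u, rfl⟩
    exact D.memℓp_sqrt_degAdd h ha1 u
  · intro hφ
    rw [mem_range_graphFst]
    exact mem_domain_maximalOp.mpr
      (D.memℓp_gradFun h.upperBound ha hk (ψ := ⟨_, hφ⟩) fun x => rfl)

/-- If the form domain of `Δ + q` is contained in that of `deg + q`, then `√(deg + q + C + 1)` is a
bounded operator on it by the closed graph theorem, and its norm gives the constant `a`. -/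
theorem exists_lowerBound_of_formDomain_eq
    (h : formDomain (schrodingerOp G q) = formDomain (mulOp (degAdd G q))) :
    ∃ a k : ℝ, 0 < a ∧ a < 1 ∧ 0 ≤ k ∧ LowerBound G q a k := by
  have h1α : 0 < 1 - α := by linarith [D.lt_one]
  have hC := D.nonneg
  obtain ⟨γ, hγ⟩ := D.exists_sqrt_degAdd_comp fun u => by
    rw [← mem_formDomain_mulOp D.one_le, ← h, D.mem_formDomain_iff]
    exact ⟨u, rfl⟩
  -- the summand `2` ensures `0 < 1 - M⁻¹`
  set M := ‖γ‖ ^ 2 / (1 - α) + 2 with hM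
  have hM2 : 2 ≤ M := by
    have : 0 ≤ ‖γ‖ ^ 2 / (1 - α) := by positivity
    linarith
  have hM0 : 0 < M := by linarith
  have hM1 : M⁻¹ ≤ 2⁻¹ := inv_anti₀ (by norm_num) hM2
  have hMp : 0 < M⁻¹ := inv_pos.mpr hM0
  refine ⟨1 - M⁻¹, C + 1, by linarith, by linarith, by linarith, fun f => ?_⟩
  have e1 : ‖γ (lift G (qPos q) f)‖ ^ 2
      = quadForm (mulFun (degAdd G q)) f + (C + 1) * normSq f := by
    rw [norm_sq_eq_quadForm_mulFun (w := fun x => 1 * (degAdd G q x + (C + 1))) (f := f)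
      (fun x => by rw [one_mul]; exact D.zero_le_degAdd x), quadForm_mulFun_affine, one_mul]
    intro x
    rw [hγ, graphFst_lift, toL2_apply, one_mul]
  have e2 := le_re_inner_perturbedGram D.bound D.pos.le (lift G (qPos q) f)
  rw [D.re_inner_gram_lift] at e2
  set u := lift G (qPos q) f
  set X := quadForm (schrodingerFun G q) f + (C + 1) * normSq f with hX
  have hX0 : 0 ≤ X := le_trans (by positivity) e2
  have e3 : ‖γ u‖ ^ 2 ≤ M * X := by
    have h1 : ‖γ u‖ ^ 2 ≤ ‖γ‖ ^ 2 * ‖u‖ ^ 2 := by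
      rw [← mul_pow]
      exact pow_le_pow_left₀ (norm_nonneg _) (γ.le_opNorm u) 2
    have h2 : ‖u‖ ^ 2 ≤ X / (1 - α) := by
      rw [le_div_iff₀ h1α]
      linarith
    calc ‖γ u‖ ^ 2 ≤ ‖γ‖ ^ 2 * (X / (1 - α)) :=
          h1.trans (mul_le_mul_of_nonneg_left h2 (sq_nonneg _))
      _ = ‖γ‖ ^ 2 / (1 - α) * X := by ring
      _ ≤ M * X := mul_le_mul_of_nonneg_right (by linarith) hX0
  have e4 := mul_le_mul_of_nonneg_left e3 hMp.le
  rw [← mul_assoc, inv_mul_cancel₀ hM0.ne', one_mul, e1] at e4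
  have hN := normSq_nonneg f
  have : 0 ≤ M⁻¹ * ((C + 1) * normSq f) := by positivity
  rw [sub_sub_cancel]
  linarith

/-! ### Discreteness of the spectrum -/

theorem le_re_inner_resolvent_delta (x : V) :
    (degAdd G q x + (C + 1))⁻¹ ≤ (inner ℂ (delta x) (D.resolvent (delta x))).re := by
  have h := le_re_inner_perturbedResolvent D.bound D.pos.le D.lt_one
    (m := degAdd G q x + (C + 1)) (by linarith [D.one_le x]) (liftDelta G (qPos q) x) (by
      rw [D.re_inner_gram_liftDelta, graphFst_liftDelta, norm_delta, one_pow, mul_one])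
  rwa [graphFst_liftDelta, norm_delta, one_pow, mul_one] at h

/-- If `deg + q ≤ B` on an infinite set, then the unit vectors there tend weakly to zero, but the
resolvent does not map them to a norm null sequence. -/
theorem finite_of_isCompactOperator (h : IsCompactOperator D.resolvent) (B : ℝ) :
    {x | degAdd G q x ≤ B}.Finite := by
  by_contra hinf
  set x : ℕ → V := fun n => ((Set.Infinite.natEmbedding _ hinf n : {x | degAdd G q x ≤ B}) : V)
  have hxB : ∀ n, degAdd G q (x n) ≤ B := fun n =>
    (Set.Infinite.natEmbedding _ hinf n : {x | degAdd G q x ≤ B}).2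
  have hxi : Function.Injective x :=
    Subtype.val_injective.comp (Set.Infinite.natEmbedding _ hinf).injective
  have hcomp := h.isCompact_closure_image_closedBall (1 : ℝ)
  -- along a subsequence the images converge in norm to some `y`, and `y` vanishes at infinity
  obtain ⟨y, -, θ, hθ, hy⟩ := hcomp.tendsto_subseq (x := fun n => D.resolvent (delta (x n)))
    fun n => subset_closure ⟨delta (x n), by simp [norm_delta], rfl⟩
  have h1 : Filter.Tendsto (fun n => ‖D.resolvent (delta (x (θ n))) - y‖ + ‖y (x (θ n))‖)
      Filter.atTop (𝓝 0) := by
    have h2 := (L2.tendsto_cofinite y).comp (hxi.comp hθ.injective).tendsto_cofinite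
    rw [Nat.cofinite_eq_atTop] at h2
    have h3 := (tendsto_iff_norm_sub_tendsto_zero.mp hy).add h2
    rw [add_zero] at h3
    exact h3
  have hBp : 0 < (B + (C + 1))⁻¹ :=
    inv_pos.mpr (by linarith [D.one_le (x 0), hxB 0])
  obtain ⟨n, hn⟩ := (h1.eventually (gt_mem_nhds hBp)).exists
  have h4 := D.le_re_inner_resolvent_delta (x (θ n))
  have h5 : (B + (C + 1))⁻¹ ≤ (degAdd G q (x (θ n)) + (C + 1))⁻¹ :=
    inv_anti₀ (by linarith [D.one_le (x (θ n))]) (by linarith [hxB (θ n)])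
  have h6 : (inner ℂ (delta (x (θ n))) (D.resolvent (delta (x (θ n))))).re
      ≤ ‖D.resolvent (delta (x (θ n))) - y‖ + ‖y (x (θ n))‖ := by
    have e : inner ℂ (delta (x (θ n))) (D.resolvent (delta (x (θ n))))
        = inner ℂ (delta (x (θ n))) (D.resolvent (delta (x (θ n))) - y) + y (x (θ n)) := by
      rw [inner_sub_right, inner_delta_left _ y, sub_add_cancel]
    rw [e, Complex.add_re]
    refine add_le_add ((Complex.re_le_norm _).trans ((norm_inner_le_norm _ _).trans ?_))
      (Complex.re_le_norm _)
    rw [norm_delta, one_mul]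
  linarith

theorem isCompactOperator_mulCLM_inv_sqrt (hfin : ∀ B, {x | degAdd G q x ≤ B}.Finite) :
    IsCompactOperator (mulCLM fun x => (√(degAdd G q x + (C + 1)))⁻¹) := by
  refine isCompactOperator_mulCLM (abs_inv_sqrt_le D.one_le) fun ε hε => ?_
  refine (hfin ((ε ^ 2)⁻¹)).subset fun x hx => ?_
  have hx' : ε ≤ |(√(degAdd G q x + (C + 1)))⁻¹| := hx
  have hp : 0 < degAdd G q x + (C + 1) := by linarith [D.one_le x]
  have hsq := pow_le_pow_left₀ hε.le hx' 2
  rw [sq_abs, inv_pow, Real.sq_sqrt hp.le] at hsq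
  have := (le_inv_comm₀ (by positivity) hp).mp hsq
  change degAdd G q x ≤ _
  linarith [D.nonneg]

/-- The lower bound factorizes the embedding of the form domain through the compact multiplication by
`(deg + q + C + 1)^{-1/2}`. -/
theorem isCompactOperator_resolvent {a k : ℝ} (h : LowerBound G q a k) (ha : a < 1)
    (hfin : ∀ B, {x | degAdd G q x ≤ B}.Finite) : IsCompactOperator D.resolvent := by
  obtain ⟨γ, hγ⟩ := D.exists_sqrt_degAdd_comp (D.memℓp_sqrt_degAdd h ha)
  have hJ : formEmb G q = (mulCLM fun x => (√(degAdd G q x + (C + 1)))⁻¹) ∘L γ := by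
    refine ContinuousLinearMap.ext fun u => lp.ext (funext fun x => ?_)
    have hp : (√(degAdd G q x + (C + 1)) : ℂ) ≠ 0 := by
      have := D.one_le x
      exact_mod_cast (Real.sqrt_pos.mpr (by linarith)).ne'
    rw [comp_apply, mulCLM_apply (abs_inv_sqrt_le D.one_le), hγ, Complex.ofReal_inv,
      inv_mul_cancel_left₀ hp]
  have hJc : IsCompactOperator (formEmb G q) := by
    rw [hJ]
    exact (D.isCompactOperator_mulCLM_inv_sqrt hfin).comp_clm γ
  exact hJc.comp_clm (Ring.inverse D.gram ∘L adjoint (formEmb G q))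

end NegPart

theorem liminfAtInfinity_eq_top_iff {g : V → ℝ} :
    liminfAtInfinity g = ⊤ ↔ ∀ B, {x | g x ≤ B}.Finite := by
  rw [liminfAtInfinity]
  constructor
  · intro h B
    obtain ⟨W, hW⟩ := iSup_eq_top.mp h (B : EReal) (EReal.coe_lt_top B)
    refine W.finite_toSet.subset fun x hx => ?_
    by_contra hxW
    have h1 := hW.trans_le (iInf_le _ (⟨x, hxW⟩ : {x : V // x ∉ W}))
    exact absurd (EReal.coe_lt_coe_iff.mp h1) (not_lt.mpr hx)
  · intro h
    rw [EReal.eq_top_iff_forall_lt]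
    intro B
    refine lt_of_lt_of_le (b := ((B + 1 : ℝ) : EReal))
      (EReal.coe_lt_coe_iff.mpr (by linarith)) ?_
    refine le_iSup_of_le (h (B + 1)).toFinset (le_iInf fun x => ?_)
    have hx := x.2
    rw [Set.Finite.mem_toFinset] at hx
    exact EReal.coe_le_coe_iff.mpr (not_le.mp hx).le

end SchrodingerForm

/-! ### Comparison of eigenvalues -/

section Eigenvalues

open ContinuousLinearMap

variable {H : Type*} [NormedAddCommGroup H] [InnerProductSpace ℂ H] [CompleteSpace H]

/-- The real numbers `t` such that there are `n + 1` linearly independent eigenvectors to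
eigenvalues at most `t`. Its infimum is the `n`-th eigenvalue when there is no essential spectrum. -/
def eigenvalueSet (T : H →ₗ.[ℂ] H) (n : ℕ) : Set ℝ :=
  {t : ℝ | ∃ v : Fin (n + 1) → H, LinearIndependent ℂ v ∧
    ∀ i, ∃ s : ℝ, s ≤ t ∧ v i ∈ eigenspace T (s : ℂ)}

theorem eigenvalue_eq_sInf {T : H →ₗ.[ℂ] H} (h : HasPurelyDiscreteSpectrum T) (n : ℕ) :
    eigenvalue T n = sInf (eigenvalueSet T n) := by
  rw [HasPurelyDiscreteSpectrum] at h
  simp [eigenvalue, eigenvalueSet, h]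

theorem IsResolventAt.bddBelow_eigenvalueSet {T : H →ₗ.[ℂ] H} {c : ℝ} {R : H →L[ℂ] H}
    (h : IsResolventAt T c R) (n : ℕ) : BddBelow (eigenvalueSet T n) := by
  refine ⟨-c, fun t ht => ?_⟩
  obtain ⟨v, hv, hs⟩ := ht
  obtain ⟨s, hst, hs⟩ := hs 0
  rw [h.mem_eigenspace_iff] at hs
  have h0 : 0 ≤ (inner ℂ (v 0) (R (v 0))).re := h.isPositive.re_inner_nonneg_right (v 0)
  have h1 : ‖v 0‖ ^ 2 = (s + c) * (inner ℂ (v 0) (R (v 0))).re := by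
    have e : inner ℂ (v 0) ((((s : ℂ) + c)) • R (v 0)) = inner ℂ (v 0) (v 0) := by rw [hs]
    rw [inner_smul_right, inner_self_eq_norm_sq_to_K, ← Complex.ofReal_add] at e
    have e2 := congrArg Complex.re e
    rw [Complex.re_ofReal_mul] at e2
    rw [e2]
    norm_cast
  have h2 : 0 < ‖v 0‖ ^ 2 := by
    have := norm_pos_iff.mpr (hv.ne_zero 0)
    positivity
  have h3 : 0 < s + c := by
    by_contra h4
    nlinarith [mul_nonneg (by linarith : 0 ≤ -(s + c)) h0]
  linarith

variable {V : Type*}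

theorem exists_mem_span_apply_eq_zero {n : ℕ} {v : Fin (n + 1) → L2 V}
    (hv : LinearIndependent ℂ v) (F : Finset V) (hF : F.card ≤ n) :
    ∃ f ∈ Submodule.span ℂ (Set.range v), f ≠ 0 ∧ ∀ x ∈ F, f x = 0 := by
  have hE : Module.finrank ℂ (Submodule.span ℂ (Set.range fun x : F => delta (x : V))) ≤ n := by
    refine le_trans (finrank_range_le_card _) ?_
    rwa [Fintype.card_coe]
  have := FiniteDimensional.span_of_finite ℂ (Set.finite_range fun x : F => delta (x : V))
  obtain ⟨f, hf, h0, hfE⟩ := exists_ne_zero_mem_orthogonal hv _ hE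
  refine ⟨f, hf, h0, fun x hx => ?_⟩
  rw [← inner_delta_left]
  exact (Submodule.mem_orthogonal _ f).mp hfE _ (Submodule.subset_span ⟨⟨x, hx⟩, rfl⟩)

theorem mem_eigenspace_mulOp_iff {g : V → ℝ} {s : ℝ} {φ : L2 V} :
    φ ∈ eigenspace (mulOp g) (s : ℂ) ↔ ∀ x, φ x ≠ 0 → g x = s := by
  rw [mem_eigenspace_iff_graph, mulOp, mem_graph_maxOp, funext_iff]
  refine forall_congr' fun x => ?_
  change (s : ℂ) * φ x = (g x : ℂ) * φ x ↔ _
  constructor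
  · intro h h0
    exact Complex.ofReal_injective (mul_right_cancel₀ h0 h).symm
  · intro h
    by_cases h0 : φ x = 0
    · rw [h0, mul_zero, mul_zero]
    · rw [h h0]

/-- The eigenvalue counting function of multiplication by `g` at `t` is the number of vertices with
`g ≤ t`. -/
theorem mem_eigenvalueSet_mulOp_iff {g : V → ℝ} (hfin : ∀ B, {x | g x ≤ B}.Finite) {n : ℕ} {t : ℝ} :
    t ∈ eigenvalueSet (mulOp g) n ↔ n + 1 ≤ (hfin t).toFinset.card := by
  classical
  constructor
  · rintro ⟨v, hv, hs⟩
    by_contra! hlt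
    obtain ⟨f, hf, h0, hfx⟩ := exists_mem_span_apply_eq_zero hv _ (Nat.lt_succ_iff.mp hlt)
    refine h0 (lp.ext (funext fun x => ?_))
    by_cases hx : x ∈ (hfin t).toFinset
    · exact hfx x hx
    · have hle : Submodule.span ℂ (Set.range v)
          ≤ LinearMap.ker (innerSL ℂ (delta x : L2 V)).toLinearMap := by
        rw [Submodule.span_le]
        rintro _ ⟨i, rfl⟩
        obtain ⟨s, hst, hs⟩ := hs i
        change inner ℂ (delta x) (v i) = 0
        rw [inner_delta_left]
        by_contra hne
        refine hx ((hfin t).mem_toFinset.mpr ?_)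
        exact (mem_eigenspace_mulOp_iff.mp hs x hne).trans_le hst
      have : inner ℂ (delta x) f = 0 := hle hf
      rwa [inner_delta_left] at this
  · intro hcard
    obtain ⟨e⟩ : Nonempty (Fin (n + 1) ↪ (hfin t).toFinset) :=
      Function.Embedding.nonempty_of_card_le (by simpa using hcard)
    refine ⟨fun i => delta (e i : V), ?_, fun i => ⟨g (e i), ?_, ?_⟩⟩
    · exact orthonormal_delta.linearIndependent.comp (fun i => (e i : V))
        (Subtype.val_injective.comp e.injective)
    · exact (hfin t).mem_toFinset.mp (e i).2
    · rw [mem_eigenspace_mulOp_iff]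
      intro x hx
      rw [delta_apply] at hx
      split_ifs at hx with h
      · rw [h]
      · exact absurd rfl hx

theorem nonempty_eigenvalueSet_mulOp [Infinite V] {g : V → ℝ} (hfin : ∀ B, {x | g x ≤ B}.Finite)
    (n : ℕ) : (eigenvalueSet (mulOp g) n).Nonempty := by
  obtain ⟨s, hs⟩ := Infinite.exists_subset_card_eq V (n + 1)
  have hne : s.Nonempty := Finset.card_pos.mp (by omega)
  obtain ⟨x, -, hx⟩ := s.exists_max_image g hne
  refine ⟨g x, (mem_eigenvalueSet_mulOp_iff hfin).mpr (hs.symm.trans_le ?_)⟩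
  exact Finset.card_le_card fun y hy => (hfin (g x)).mem_toFinset.mpr (hx y hy)

theorem tendsto_sInf_eigenvalueSet_mulOp [Infinite V] {g : V → ℝ}
    (hfin : ∀ B, {x | g x ≤ B}.Finite) :
    Filter.Tendsto (fun n => sInf (eigenvalueSet (mulOp g) n)) Filter.atTop Filter.atTop := by
  rw [Filter.tendsto_atTop]
  intro B
  filter_upwards [Filter.eventually_ge_atTop (hfin B).toFinset.card] with n hn
  refine le_csInf (nonempty_eigenvalueSet_mulOp hfin n) fun t ht => ?_
  rw [mem_eigenvalueSet_mulOp_iff hfin] at ht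
  by_contra! hlt
  have : (hfin t).toFinset.card ≤ (hfin B).toFinset.card :=
    Finset.card_le_card fun y hy => (hfin B).mem_toFinset.mpr
      (le_trans ((hfin t).mem_toFinset.mp hy) hlt.le)
  omega

variable {G : SimpleGraph V} [G.LocallyFinite] {q : V → ℝ}

namespace NegPart

variable {α C : ℝ} (D : NegPart G q α C)
include D

/-- One half of the min-max comparison: the unit vectors at the vertices with `deg + q ≤ t` span
a space of trial functions for `Δ + q`. -/
theorem mem_eigenvalueSet_of_upperBound {a k : ℝ} (h : UpperBound G q a k) (ha : 0 ≤ a)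
    (hc : IsCompactOperator D.resolvent) (hfin : ∀ B, {x | degAdd G q x ≤ B}.Finite) {n : ℕ}
    {t t' : ℝ} (ht : t ∈ eigenvalueSet (mulOp (degAdd G q)) n) (htt' : (1 + a) * t + k < t') :
    t' ∈ eigenvalueSet (schrodingerOp G q) n := by
  rw [mem_eigenvalueSet_mulOp_iff hfin] at ht
  obtain ⟨e⟩ : Nonempty (Fin (n + 1) ↪ (hfin t).toFinset) :=
    Function.Embedding.nonempty_of_card_le (by simpa using ht)
  have hv : LinearIndependent ℂ fun i => delta (e i : V) :=
    orthonormal_delta.linearIndependent.comp (fun i => (e i : V))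
      (Subtype.val_injective.comp e.injective)
  set m := (1 + a) * t + k + (C + 1) with hm
  have hgram : ∀ f : V →₀ ℂ, (∀ x ∈ f.support, degAdd G q x ≤ t) →
      (inner ℂ (lift G (qPos q) f) (D.gram (lift G (qPos q) f))).re ≤ m * ‖toL2 f‖ ^ 2 := by
    intro f hf
    have h1 : quadForm (mulFun (degAdd G q)) f ≤ t * normSq f := by
      rw [quadForm_mulFun, normSq, Finset.mul_sum]
      exact Finset.sum_le_sum fun x hx => mul_le_mul_of_nonneg_right (hf x hx) (sq_nonneg _)
    rw [D.re_inner_gram_lift, ← normSq_eq]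
    nlinarith [h f]
  have hspan : ∀ f ∈ Submodule.span ℂ (Set.range fun i => delta (e i : V)),
      ∃ f₀ : V →₀ ℂ, toL2 f₀ = f ∧ ∀ x ∈ f₀.support, degAdd G q x ≤ t := by
    have hle : Submodule.span ℂ (Set.range fun i => delta (e i : V))
        ≤ (Finsupp.supported ℂ ℂ {x | degAdd G q x ≤ t}).map toL2 := by
      rw [Submodule.span_le]
      rintro _ ⟨i, rfl⟩
      exact ⟨Finsupp.single (e i : V) 1,
        Finsupp.single_mem_supported ℂ 1 ((hfin t).mem_toFinset.mp (e i).2), toL2_single _⟩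
    intro f hf
    obtain ⟨f₀, h1, h2⟩ := hle hf
    exact ⟨f₀, h2, fun x hx => (Finsupp.mem_supported ℂ f₀).mp h1 hx⟩
  have hm0 : 0 < m := by
    obtain ⟨f₀, h1, h2⟩ := hspan (delta (e 0 : V)) (Submodule.subset_span ⟨0, rfl⟩)
    have h3 := hgram f₀ h2
    rw [h1, norm_delta, one_pow, mul_one] at h3
    have h4 := le_re_inner_perturbedGram D.bound D.pos.le (lift G (qPos q) f₀)
    have h5 : 0 < ‖lift G (qPos q) f₀‖ := by
      rw [norm_pos_iff]
      intro h0
      have := graphFst_lift (G := G) (p := qPos q) f₀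
      rw [h0, map_zero, h1] at this
      have h6 := norm_delta (e 0 : V)
      rw [← this, norm_zero] at h6
      exact zero_ne_one h6
    have h6 : 0 < 1 - α := by linarith [D.lt_one]
    have : 0 < (1 - α) * ‖lift G (qPos q) f₀‖ ^ 2 := by positivity
    linarith
  have hmt : m < t' + (C + 1) := by linarith
  refine exists_linearIndependent_eigenvectors D.isResolventAt hc (by linarith) hv
    fun f hf hf0 => ?_
  obtain ⟨f₀, rfl, h2⟩ := hspan f hf
  have h3 := le_re_inner_perturbedResolvent D.bound D.pos.le D.lt_one hm0 (lift G (qPos q) f₀)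
    (by rw [graphFst_lift]; exact hgram f₀ h2)
  rw [graphFst_lift] at h3
  refine lt_of_lt_of_le (mul_lt_mul_of_pos_right (inv_strictAnti₀ hm0 hmt) ?_) h3
  have := norm_pos_iff.mpr hf0
  positivity

/-- The other half of the min-max comparison: some combination of the low eigenvectors of `Δ + q`
vanishes where `deg + q ≤ t'`. -/
theorem mem_eigenvalueSet_of_lowerBound {a k : ℝ} (h : LowerBound G q a k) (ha : a < 1)
    (hfin : ∀ B, {x | degAdd G q x ≤ B}.Finite) {n : ℕ} {t t' : ℝ}
    (ht : t ∈ eigenvalueSet (schrodingerOp G q) n) (htt' : t + k < (1 - a) * t') :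
    t' ∈ eigenvalueSet (mulOp (degAdd G q)) n := by
  rw [mem_eigenvalueSet_mulOp_iff hfin]
  by_contra! hlt
  obtain ⟨v, hv, hs⟩ := ht
  obtain ⟨f, hf, hf0, hfx⟩ := exists_mem_span_apply_eq_zero hv _ (Nat.lt_succ_iff.mp hlt)
  have hlow : f ∈ lowSpace (schrodingerOp G q) t := by
    refine (Submodule.span_le.mpr ?_ : _ ≤ lowSpace (schrodingerOp G q) t) hf
    rintro _ ⟨i, rfl⟩
    obtain ⟨s, hst, hs⟩ := hs i
    exact Submodule.mem_iSup_of_mem (⟨s, hst⟩ : {s : ℝ // s ≤ t}) hs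
  obtain ⟨η, hη, hle⟩ := exists_mem_graph_of_mem_lowSpace D.isResolventAt.isSelfAdjoint hlow
  rw [D.isResolventAt.mem_graph_iff] at hη
  obtain ⟨y, hy1, hy2⟩ := exists_perturbedResolvent_eq D.bound D.pos.le D.lt_one
    (η + ((C + 1 : ℝ) : ℂ) • f)
  have hfy : formEmb G q y = f := hy1.symm.trans hη
  have hf2 : 0 < ‖f‖ ^ 2 := by
    have := norm_pos_iff.mpr hf0
    positivity
  have hgram : (inner ℂ y (D.gram y)).re ≤ (t + (C + 1)) * ‖f‖ ^ 2 := by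
    have : (inner ℂ f f).re = ‖f‖ ^ 2 := by
      rw [inner_self_eq_norm_sq_to_K]
      norm_cast
    rw [hy2, adjoint_inner_right, hfy, inner_add_right, inner_smul_right,
      Complex.add_re, Complex.re_ofReal_mul, this,
      show (t + (C + 1)) * ‖f‖ ^ 2 = t * ‖f‖ ^ 2 + (C + 1) * ‖f‖ ^ 2 by ring]
    exact add_le_add hle le_rfl
  have hsum := D.sum_le_of_lowerBound h ha y
  rw [hfy] at hsum
  have hcoef : ∀ s : Finset V, (1 - a) * (t' + (C + 1)) * ∑ x ∈ s, ‖f x‖ ^ 2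
      ≤ (t + k + (1 - a) * (C + 1)) * ‖f‖ ^ 2 := by
    intro s
    refine le_trans ?_ ((hsum s).trans (by linarith))
    rw [Finset.mul_sum]
    refine Finset.sum_le_sum fun x _ => ?_
    by_cases hx : x ∈ (hfin t').toFinset
    · rw [hfx x hx]
      simp
    · have hx' : t' < degAdd G q x := by
        simpa using hx
      have h1a : 0 ≤ 1 - a := by linarith
      gcongr
  have h0 : 0 ≤ t + k + (1 - a) * (C + 1) := by
    have := hcoef ∅
    rw [Finset.sum_empty, mul_zero] at this
    exact nonneg_of_mul_nonneg_left this hf2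
  have hp : 0 < (1 - a) * (t' + (C + 1)) := by linarith
  have h1 : ‖f‖ ^ 2 ≤ (t + k + (1 - a) * (C + 1)) * ‖f‖ ^ 2 / ((1 - a) * (t' + (C + 1))) :=
    L2.norm_sq_le fun s => by
      rw [le_div_iff₀ hp, mul_comm]
      exact hcoef s
  rw [le_div_iff₀ hp] at h1
  nlinarith

theorem hasPurelyDiscreteSpectrum_mulOp (hfin : ∀ B, {x | degAdd G q x ≤ B}.Finite) :
    HasPurelyDiscreteSpectrum (mulOp (degAdd G q)) :=
  hasPurelyDiscreteSpectrum_of_isCompactOperator (isResolventAt_mulOp D.one_le)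
    ((D.isCompactOperator_mulCLM_inv_sqrt hfin).comp_clm _)

theorem eigenvalue_le [Infinite V] {a k : ℝ} (h : LowerBound G q a k) (ha : 0 ≤ a) (ha1 : a < 1)
    (hfin : ∀ B, {x | degAdd G q x ≤ B}.Finite) (n : ℕ) :
    eigenvalue (schrodingerOp G q) n ≤ (1 + a) * eigenvalue (mulOp (degAdd G q)) n + k := by
  have hc := D.isCompactOperator_resolvent h ha1 hfin
  rw [eigenvalue_eq_sInf (hasPurelyDiscreteSpectrum_of_isCompactOperator D.isResolventAt hc),
    eigenvalue_eq_sInf (D.hasPurelyDiscreteSpectrum_mulOp hfin), ← sub_le_iff_le_add,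
    mul_comm, ← div_le_iff₀ (by linarith)]
  refine le_csInf (nonempty_eigenvalueSet_mulOp hfin n) fun t ht => ?_
  rw [div_le_iff₀ (by linarith), sub_le_iff_le_add, mul_comm]
  refine le_of_forall_gt_imp_ge_of_dense fun t' ht' => ?_
  exact csInf_le (D.isResolventAt.bddBelow_eigenvalueSet n)
    (D.mem_eigenvalueSet_of_upperBound h.upperBound ha hc hfin ht ht')

theorem le_eigenvalue [Infinite V] {a k : ℝ} (h : LowerBound G q a k) (ha : 0 ≤ a) (ha1 : a < 1)
    (hfin : ∀ B, {x | degAdd G q x ≤ B}.Finite) (n : ℕ) :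
    (1 - a) * eigenvalue (mulOp (degAdd G q)) n - k ≤ eigenvalue (schrodingerOp G q) n := by
  have hc := D.isCompactOperator_resolvent h ha1 hfin
  rw [eigenvalue_eq_sInf (hasPurelyDiscreteSpectrum_of_isCompactOperator D.isResolventAt hc),
    eigenvalue_eq_sInf (D.hasPurelyDiscreteSpectrum_mulOp hfin)]
  obtain ⟨t₀, ht₀⟩ := nonempty_eigenvalueSet_mulOp hfin n
  refine le_csInf ⟨_, D.mem_eigenvalueSet_of_upperBound h.upperBound ha hc hfin ht₀
    (lt_add_one _)⟩ fun t ht => ?_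
  rw [sub_le_iff_le_add, mul_comm, ← le_div_iff₀ (by linarith)]
  refine le_of_forall_gt_imp_ge_of_dense fun t' ht' => ?_
  rw [div_lt_iff₀ (by linarith), mul_comm] at ht'
  exact csInf_le ((isResolventAt_mulOp D.one_le).bddBelow_eigenvalueSet n)
    (D.mem_eigenvalueSet_of_lowerBound h ha1 hfin ht ht')

theorem tendsto_eigenvalue_mulOp [Infinite V] (hfin : ∀ B, {x | degAdd G q x ≤ B}.Finite) :
    Filter.Tendsto (eigenvalue (mulOp (degAdd G q))) Filter.atTop Filter.atTop := by
  rw [funext (eigenvalue_eq_sInf (D.hasPurelyDiscreteSpectrum_mulOp hfin))]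
  exact tendsto_sInf_eigenvalueSet_mulOp hfin

end NegPart

theorem tendsto_coe_add_div (b k : ℝ) {y : ℕ → ℝ} (hy : Filter.Tendsto y Filter.atTop Filter.atTop) :
    Filter.Tendsto (fun n => ((b + k / y n : ℝ) : EReal)) Filter.atTop (𝓝 (b : EReal)) := by
  refine (continuous_coe_real_ereal.tendsto _).comp ?_
  simpa using tendsto_const_nhds.add (hy.const_div_atTop k)

theorem le_liminf_div {b k : ℝ} {x y : ℕ → ℝ} (hy : Filter.Tendsto y Filter.atTop Filter.atTop)
    (h : ∀ n, b * y n - k ≤ x n) :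
    (b : EReal) ≤ Filter.liminf (fun n => ((x n / y n : ℝ) : EReal)) Filter.atTop := by
  rw [← (tendsto_coe_add_div b (-k) hy).liminf_eq]
  refine Filter.liminf_le_liminf ?_
  filter_upwards [hy.eventually_gt_atTop 0] with n hn
  rw [EReal.coe_le_coe_iff, le_div_iff₀ hn, add_mul, div_mul_cancel₀ _ hn.ne']
  linarith [h n]

theorem limsup_div_le {b k : ℝ} {x y : ℕ → ℝ} (hy : Filter.Tendsto y Filter.atTop Filter.atTop)
    (h : ∀ n, x n ≤ b * y n + k) :
    Filter.limsup (fun n => ((x n / y n : ℝ) : EReal)) Filter.atTop ≤ (b : EReal) := by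
  rw [← (tendsto_coe_add_div b k hy).limsup_eq]
  refine Filter.limsup_le_limsup ?_
  filter_upwards [hy.eventually_gt_atTop 0] with n hn
  rw [EReal.coe_le_coe_iff, div_le_iff₀ hn, add_mul, div_mul_cancel₀ _ hn.ne']
  exact h n

end Eigenvalues

end SparseForm

end

open Filter SparseForm in
theorem theoremt {V : Type*} [Countable V] (G : SimpleGraph V) [G.LocallyFinite]
    (q : V → ℝ) (α : ℝ) (hα0 : 0 < α) (hα1 : α < 1) (hq : MemK G α q) :
    List.TFAE
      [ ∃ a k : ℝ, 0 ≤ a ∧ 0 ≤ k ∧ IsSparse G q a k,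
        ∃ a k : ℝ, 0 < a ∧ a < 1 ∧ 0 ≤ k ∧ LowerBound G q a k ∧ UpperBound G q a k,
        ∃ a k : ℝ, 0 < a ∧ a < 1 ∧ 0 ≤ k ∧ LowerBound G q a k,
        formDomain (schrodingerOp G q) = formDomain (mulOp (degAdd G q)) ] ∧
    (HasPurelyDiscreteSpectrum (schrodingerOp G q) → liminfAtInfinity (degAdd G q) = ⊤) ∧
    ((∃ a k : ℝ, 0 ≤ a ∧ 0 ≤ k ∧ IsSparse G q a k) →
      liminfAtInfinity (degAdd G q) = ⊤ → HasPurelyDiscreteSpectrum (schrodingerOp G q)) ∧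
    (∀ a k : ℝ, 0 < a → a < 1 → 0 ≤ k → LowerBound G q a k →
      Infinite V → liminfAtInfinity (degAdd G q) = ⊤ →
      ((1 - a : ℝ) : EReal) ≤
          liminf (fun n : ℕ => ((eigenvalue (schrodingerOp G q) n /
            eigenvalue (mulOp (degAdd G q)) n : ℝ) : EReal)) atTop ∧
        liminf (fun n : ℕ => ((eigenvalue (schrodingerOp G q) n /
            eigenvalue (mulOp (degAdd G q)) n : ℝ) : EReal)) atTop ≤
          limsup (fun n : ℕ => ((eigenvalue (schrodingerOp G q) n /
            eigenvalue (mulOp (degAdd G q)) n : ℝ) : EReal)) atTop ∧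
        limsup (fun n : ℕ => ((eigenvalue (schrodingerOp G q) n /
            eigenvalue (mulOp (degAdd G q)) n : ℝ) : EReal)) atTop ≤
          ((1 + a : ℝ) : EReal)) := by
  obtain ⟨C, ⟨D⟩⟩ := hq.exists_negPart hα0 hα1
  refine ⟨?_, fun h => ?_, ?_, ?_⟩
  · tfae_have 1 → 3 := fun ⟨a, k, ha, hk, h⟩ => h.exists_lowerBound ha hk hα0 hα1 hq
    tfae_have 3 → 1 := fun ⟨a, k, ha, ha1, hk, h⟩ =>
      ⟨_, _, div_nonneg ha.le (by linarith), div_nonneg hk (by linarith), h.isSparse ha.le ha1⟩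
    tfae_have 3 → 2 := fun ⟨a, k, ha, ha1, hk, h⟩ => ⟨a, k, ha, ha1, hk, h, h.upperBound⟩
    tfae_have 2 → 3 := fun ⟨a, k, ha, ha1, hk, h, _⟩ => ⟨a, k, ha, ha1, hk, h⟩
    tfae_have 3 → 4 := fun ⟨a, k, ha, ha1, hk, h⟩ => D.formDomain_eq_of_lowerBound h ha.le ha1 hk
    tfae_have 4 → 3 := D.exists_lowerBound_of_formDomain_eq
    tfae_finish
  · exact liminfAtInfinity_eq_top_iff.mpr (D.finite_of_isCompactOperator
      (isCompactOperator_of_hasPurelyDiscreteSpectrum D.isResolventAt h))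
  · rintro ⟨a, k, ha, hk, h⟩ hinf
    obtain ⟨a', k', -, ha1, -, h'⟩ := h.exists_lowerBound ha hk hα0 hα1 hq
    exact hasPurelyDiscreteSpectrum_of_isCompactOperator D.isResolventAt
      (D.isCompactOperator_resolvent h' ha1 (liminfAtInfinity_eq_top_iff.mp hinf))
  · intro a k ha ha1 _ h _ hinf
    have hfin := liminfAtInfinity_eq_top_iff.mp hinf
    have hy := D.tendsto_eigenvalue_mulOp hfin
    exact ⟨le_liminf_div hy (D.le_eigenvalue h ha.le ha1 hfin), liminf_le_limsup,
      limsup_div_le hy (D.eigenvalue_le h ha.le ha1 hfin)⟩
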